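/- **Setting.** Let $n\ge 1$ and let $r=\tfrac12\sum_i e_{ii}\otimes e_{ii}+\sum_{i<j}e_{ij}\otimes e_{ji}$. On the group $G^*$ of pairs $(g,f)$ with $g\in GL(n,\mathbb{C})$ upper triangular, $f\in GL(n,\mathbb C)$ lower triangular and $g_{ii}f_{ii}=1$ for all $i$, consider the Poisson bracket $$\{g^1,g^2\}=[r,g^1g^2],\qquad \{f^1,f^2\}=[r,f^1f^2],\qquad \{g^1,f^2\}=[r,g^1f^2],$$ where $g^1=g\otimes 1$, $g^2=1\otimes g$. The Poisson–Lie group $U(n)^*$ is the real form $f^*=g^{-1}$ with the bracket $\{\cdot,\cdot\}^{\mathbb R}=i\{\cdot,\cdot\}$. For $1\le l\le k\le n$ let $\Delta^{(k)}_l$ be the minor of $g$ with rows $n-k+1,\dots,n-k+l$ and the last $l$ columns. On $U(n)^*$ its complex conjugate $\bar\Delta^{(k)}_l$ is the minor of $f^{-1}$ with columns $n-k+1,\dots,n-k+l$ and the last $l$ rows, and $\Delta^{(k)}_k$ is real. **Tropicalization.** Let $x_i>0$ and $z_a\in\mathbb{C}^*$ be coordinates such that the brackets of any two of the functions $x_i,z_a,\bar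 z_a$ are Laurent polynomials in the $x$, $z$ and $\bar z$. For two of these functions $c,d$, let $\pi_{c,d}$ be the coefficient of the monomial $cd$ in $\{c,d\}$, and suppose that $\pi_{x_i,x_j}=0$ and that $\pi_{x_i,z_a}$, $\pi_{z_a,z_b}$, $\pi_{z_a,\bar z_b}$ are purely imaginary. Give $x_i$ the weight $\xi_i$, give $z_a$ and $\bar z_a$ the weight $\zeta_a$, and let the weight of a monomial be additive. The *tropicalization* is $\mathcal{C}\times\mathbb{T}$, where $\mathcal C$ is the open cone of all real vectors $(\xi,\zeta)$ such that, for all $c,d$, the weight of $cd$ is strictly larger than the weight of every other monomial occurring in $\{c,d\}$, and $\mathbb T$ is the torus of angles $\phi_a\in\mathbb R/2\pi\mathbb Z$, one for each $z_a$; it carries the constant Poisson bracket $$\{\xi_i,\phi_a\}_\infty=\operatorname{Im}\pi_{x_i,z_a},\qquad \{\zeta_b,\phi_a\}_\infty=\tfrac12\operatorname{Im}(\pi_{z_b,z_a}-\pi_{z_b,\bar z_a}),$$ and all other brackets of coordinates vanish. **Gelfand–Zeitlin system.** Let $\mathcal{C}_{GZ}\subset\mathbb{R}^{n(n+1)/2}$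 be the open cone of all $(\lambda^{(k)}_l)_{1\le l\le k\le n}$ with $\lambda^{(k)}_l>\lambda^{(k-1)}_l>\lambda^{(k)}_{l+1}$ for $1\le l<k\le n$. The Gelfand–Zeitlin system is $\mathcal{C}_{GZ}\times\mathbb{T}^{n(n-1)/2}$, with angles $\psi^{(k)}_l\in\mathbb R/2\pi\mathbb Z$ ($1\le l\le k\le n-1$) and $\{\lambda^{(k)}_l,\psi^{(p)}_q\}=-\delta_{kp}\delta_{lq}$, all other brackets of coordinates being zero. **Theorem.** (a) The functions $\Delta^{(k)}_k$ ($1\le k\le n$) and $\Delta^{(k)}_l$ ($1\le l<k\le n$) map the part of $U(n)^*$ on which $\Delta^{(k)}_k>0$ for all $k$ and $\Delta^{(k)}_l\neq0$ for all $l<k$ bijectively onto $\mathbb{R}_{>0}^n\times(\mathbb{C}^*)^{n(n-1)/2}$. The brackets $\{\cdot,\cdot\}^{\mathbb R}$ of the functions $\Delta^{(k)}_l,\bar\Delta^{(k)}_l$ are given there by uniquely determined Laurent polynomials in these functions, and the coefficients $\pi_{c,d}$ satisfy the conditions above. Hence the tropicalization $\mathcal{C}\times\mathbb{T}^{n(n-1)/2}$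 is defined; denote by $\zeta^{(k)}_l$ the action variable that belongs to $\Delta^{(k)}_l$ (for all $l\le k$) and by $\phi^{(k)}_l$ the angle that belongs to $\Delta^{(k)}_l$ (for $l<k$). (b) The tropicalization is isomorphic to the Gelfand–Zeitlin system. More precisely, there is exactly one Poisson isomorphism (a diffeomorphism preserving the brackets) $\mathcal{C}_{GZ}\times\mathbb{T}^{n(n-1)/2}\to\mathcal{C}\times\mathbb{T}^{n(n-1)/2}$ of the form $$\zeta^{(k)}_l=\tfrac12\bigl(\lambda^{(k)}_1+\dots+\lambda^{(k)}_l\bigr)\quad(1\le l\le k\le n),$$ $$\phi^{(k)}_l=\psi^{(k-1)}_l+\sum_{(p,q)} m^{(k,l)}_{(p,q)}\,\psi^{(p)}_q\quad(1\le l<k\le n)$$ with integers $m^{(k,l)}_{(p,q)}$, where the sum runs over the pairs $1\le q\le p\le n-1$ that come after $(k-1,l)$ in the order in which larger upper indices come first and, for equal upper indices, smaller lower indices come first, i.e. over the pairs with $p<k-1$, or $p=k-1$ and $q>l$. -/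

import Mathlib

open scoped Kronecker Matrix ContDiff

noncomputable section

/-! ## Tropicalization of Poisson brackets with Laurent polynomial coefficients

A chart carries positive real coordinates `x i` (`i : ι`) and non-vanishing complex coordinates
`z a` (`a : κ`).  The index type `ι ⊕ κ ⊕ κ` labels the functions `x i`, `z a`, `conj (z a)`. -/

/-- The label of the conjugate coordinate. -/
def conjIdx {ι κ : Type*} : ι ⊕ κ ⊕ κ → ι ⊕ κ ⊕ κ
  | Sum.inl i => Sum.inl i
  | Sum.inr (Sum.inl a) => Sum.inr (Sum.inr a)
  | Sum.inr (Sum.inr a) => Sum.inr (Sum.inl a)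

/-- All values `(x, z, conj z)` with `x i` real positive and `z a` complex non-zero. -/
def chartValues (ι κ : Type*) : Set (ι ⊕ κ ⊕ κ → ℂ) :=
  {v | (∀ c, v (conjIdx c) = (starRingEnd ℂ) (v c)) ∧ (∀ i, 0 < (v (Sum.inl i)).re) ∧
    ∀ a, v (Sum.inr (Sum.inl a)) ≠ 0}

/-- Complex Laurent polynomials in the variables `x`, `z`, `conj z`: finite sums of
`c_m x^I z^J (conj z)^K`, with `m = (I, J, K)`. -/
abbrev ChartLaurent (ι κ : Type*) := AddMonoidAlgebra ℂ (ι ⊕ κ ⊕ κ → ℤ)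

/-- The value of a Laurent polynomial. -/
def ChartLaurent.eval {ι κ : Type*} [Fintype ι] [Fintype κ] (p : ChartLaurent ι κ)
    (v : ι ⊕ κ ⊕ κ → ℂ) : ℂ :=
  p.coeff.sum fun m c => c * ∏ r, v r ^ m r

/-- A bivector with Laurent polynomial coefficients, given by the table of the brackets of the
coordinate functions. -/
abbrev BracketTable (ι κ : Type*) := ι ⊕ κ ⊕ κ → ι ⊕ κ ⊕ κ → ChartLaurent ι κ

/-- The exponent of the monomial which is the product of the coordinates `c` and `d`. -/
def logExponent {ι κ : Type*} [DecidableEq ι] [DecidableEq κ] (c d : ι ⊕ κ ⊕ κ) :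
    ι ⊕ κ ⊕ κ → ℤ :=
  Pi.single c 1 + Pi.single d 1

/-- The coefficients of the log-canonical part of the bivector: the bracket of the coordinates
`c` and `d` is `logCoeff P c d` times their product, plus other monomials. -/
def logCoeff {ι κ : Type*} [DecidableEq ι] [DecidableEq κ] (P : BracketTable ι κ)
    (c d : ι ⊕ κ ⊕ κ) : ℂ :=
  (P c d).coeff (logExponent c d)

/-- What remains of the bracket of the coordinates `c` and `d` after the log-canonical part has
been removed. -/
def bracketRemainder {ι κ : Type*} [DecidableEq ι] [DecidableEq κ] (P : BracketTable ι κ)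
    (c d : ι ⊕ κ ⊕ κ) : ChartLaurent ι κ :=
  P c d - AddMonoidAlgebra.single (logExponent c d) (logCoeff P c d)

/-- The reality conditions on the log-canonical part, which allow for a linear scaling. -/
def RealityConditions {ι κ : Type*} [DecidableEq ι] [DecidableEq κ] (P : BracketTable ι κ) :
    Prop :=
  (∀ i j, logCoeff P (Sum.inl i) (Sum.inl j) = 0) ∧
  (∀ i a, (logCoeff P (Sum.inl i) (Sum.inr (Sum.inl a))).re = 0) ∧
  (∀ a b, (logCoeff P (Sum.inr (Sum.inl a)) (Sum.inr (Sum.inl b))).re = 0) ∧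
  (∀ a b, (logCoeff P (Sum.inr (Sum.inl a)) (Sum.inr (Sum.inr b))).re = 0)

/-- The logarithmic absolute value which belongs to a coordinate: `ξ i` for `x i`, and `ζ a` for
both `z a` and `conj (z a)`. -/
def actionIdx {ι κ : Type*} : ι ⊕ κ ⊕ κ → ι ⊕ κ
  | Sum.inl i => Sum.inl i
  | Sum.inr (Sum.inl a) => Sum.inr a
  | Sum.inr (Sum.inr a) => Sum.inr a

/-- The open polyhedral cone of all `η = (ξ, ζ)` at which the log-canonical term of the bracket of
any two coordinates dominates each monomial of the remainder. -/
def tropicalCone {ι κ : Type*} [Fintype ι] [Fintype κ] [DecidableEq ι] [DecidableEq κ]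
    (P : BracketTable ι κ) : Set (ι ⊕ κ → ℝ) :=
  {η | ∀ c d, ∀ m ∈ (bracketRemainder P c d).coeff.support,
    ∑ r, (m r : ℝ) * η (actionIdx r) < η (actionIdx c) + η (actionIdx d)}

/-- The constant brackets `{ξ i, φ a}` and `{ζ b, φ a}` of the linear scaling limit. -/
def tropicalPairing {ι κ : Type*} [DecidableEq ι] [DecidableEq κ] (P : BracketTable ι κ) :
    ι ⊕ κ → κ → ℝ
  | Sum.inl i, a => (logCoeff P (Sum.inl i) (Sum.inr (Sum.inl a))).im
  | Sum.inr b, a => (1 / 2) * (logCoeff P (Sum.inr (Sum.inl b)) (Sum.inr (Sum.inl a)) -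
      logCoeff P (Sum.inr (Sum.inl b)) (Sum.inr (Sum.inr a))).im

/-! ## Cone times torus with a constant Poisson bracket -/

/-- An open set `cone` of action variables indexed by `α`, times the torus of angle variables
(modulo `2π`) indexed by `κ`, with a constant skew-symmetric bivector: `tensor u v` is the bracket
of the coordinates `u` and `v`. -/
structure TorusSystem (α κ : Type*) where
  cone : Set (α → ℝ)
  isOpen_cone : IsOpen cone
  tensor : α ⊕ κ → α ⊕ κ → ℝ
  skew : ∀ u v, tensor u v = -tensor v u

/-- The constant bivector for which the actions commute, the angles commute, and the bracket of
the action `j` with the angle `a` is `B j a`. -/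
def actionAngleTensor {α κ : Type*} (B : α → κ → ℝ) : α ⊕ κ → α ⊕ κ → ℝ
  | Sum.inl _, Sum.inl _ => 0
  | Sum.inl j, Sum.inr a => B j a
  | Sum.inr a, Sum.inl j => -B j a
  | Sum.inr _, Sum.inr _ => 0

theorem actionAngleTensor_skew {α κ : Type*} (B : α → κ → ℝ) (u v : α ⊕ κ) :
    actionAngleTensor B u v = -actionAngleTensor B v u := by
  rcases u with u | u <;> rcases v with v | v <;> simp [actionAngleTensor]

namespace TorusSystem

/-- The underlying manifold, cone times torus. -/
abbrev Points {α κ : Type*} (X : TorusSystem α κ) : Type _ :=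
  ↥(X.cone ×ˢ (Set.univ : Set (κ → Real.Angle)))

/-- Translation by `s` in the direction of the coordinate `u`. -/
def translate {α κ : Type*} [DecidableEq α] [DecidableEq κ] (u : α ⊕ κ) (s : ℝ)
    (x : (α → ℝ) × (κ → Real.Angle)) : (α → ℝ) × (κ → Real.Angle) :=
  match u with
  | Sum.inl j => (x.1 + Pi.single j s, x.2)
  | Sum.inr a => (x.1, x.2 + Pi.single a (s : Real.Angle))

/-- Partial derivative of a function on cone times torus along the coordinate `u` (the value of
the extension outside the open set does not matter). -/
def partialDeriv {α κ : Type*} [DecidableEq α] [DecidableEq κ] (X : TorusSystem α κ)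
    (u : α ⊕ κ) (F : X.Points → ℝ) (x : X.Points) : ℝ :=
  deriv (fun s : ℝ => Function.extend Subtype.val F 0 (translate u s x.1)) 0

/-- The Poisson bracket of two functions on cone times torus. -/
def bracket {α κ : Type*} [Fintype α] [Fintype κ] [DecidableEq α] [DecidableEq κ]
    (X : TorusSystem α κ) (F H : X.Points → ℝ) (x : X.Points) : ℝ :=
  ∑ u, ∑ v, X.tensor u v * X.partialDeriv u F x * X.partialDeriv v H x

/-- Smooth functions on cone times torus: the pull-back to the universal cover of the torus is
smooth. -/
def Smooth {α κ : Type*} [Fintype α] [Fintype κ] (X : TorusSystem α κ) (F : X.Points → ℝ) :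
    Prop :=
  ContDiffOn ℝ ∞ (fun q : (α → ℝ) × (κ → ℝ) =>
    Function.extend Subtype.val F 0 (q.1, fun a => (q.2 a : Real.Angle)))
    (X.cone ×ˢ (Set.univ : Set (κ → ℝ)))

/-- A Poisson isomorphism: a diffeomorphism (a bijection under which the smooth functions of both
sides correspond to each other) which preserves the Poisson brackets of smooth functions. -/
def IsPoissonIso {α κ β μ : Type*} [Fintype α] [Fintype κ] [Fintype β] [Fintype μ]
    [DecidableEq α] [DecidableEq κ] [DecidableEq β] [DecidableEq μ]
    {X : TorusSystem α κ} {Y : TorusSystem β μ} (Φ : X.Points ≃ Y.Points) : Prop :=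
  (∀ F : Y.Points → ℝ, Y.Smooth F ↔ X.Smooth (F ∘ Φ)) ∧
  ∀ F H : Y.Points → ℝ, Y.Smooth F → Y.Smooth H →
    ∀ x, X.bracket (F ∘ Φ) (H ∘ Φ) x = Y.bracket F H (Φ x)

end TorusSystem

theorem isOpen_tropicalCone {ι κ : Type*} [Fintype ι] [Fintype κ] [DecidableEq ι] [DecidableEq κ]
    (P : BracketTable ι κ) : IsOpen (tropicalCone P) := by
  have h : tropicalCone P = ⋂ c, ⋂ d, ⋂ m ∈ (bracketRemainder P c d).coeff.support,
      {η | ∑ r, (m r : ℝ) * η (actionIdx r) < η (actionIdx c) + η (actionIdx d)} := by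
    ext η
    simp only [tropicalCone, Set.mem_ofPred_eq, Set.mem_iInter]
  rw [h]
  refine isOpen_iInter_of_finite fun c => isOpen_iInter_of_finite fun d =>
    isOpen_biInter_finset fun m _ => isOpen_lt ?_ ?_ <;> fun_prop

/-- The tropicalization of a bivector with Laurent polynomial coefficients. -/
def tropicalization {ι κ : Type*} [Fintype ι] [Fintype κ] [DecidableEq ι] [DecidableEq κ]
    (P : BracketTable ι κ) : TorusSystem (ι ⊕ κ) κ where
  cone := tropicalCone P
  isOpen_cone := isOpen_tropicalCone P
  tensor := actionAngleTensor (tropicalPairing P)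
  skew := actionAngleTensor_skew _

/-! ## The Poisson structure on the dual Poisson-Lie group -/

/-- Pairs `(g, f)` of complex matrices. -/
abbrev MatPair (n : ℕ) := Matrix (Fin n) (Fin n) ℂ × Matrix (Fin n) (Fin n) ℂ

/-- The standard classical `r`-matrix. -/
def rMatrix (n : ℕ) : Matrix (Fin n × Fin n) (Fin n × Fin n) ℂ :=
  (1 / 2 : ℂ) • ∑ i : Fin n, Matrix.single i i (1 : ℂ) ⊗ₖ Matrix.single i i (1 : ℂ) +
    ∑ i : Fin n, ∑ j : Fin n,
      if i < j then Matrix.single i j (1 : ℂ) ⊗ₖ Matrix.single j i (1 : ℂ) else 0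

/-- The commutator `[r, a¹ b²]`, with `a¹ = a ⊗ 1` and `b² = 1 ⊗ b`. -/
def rCommutator {n : ℕ} (a b : Matrix (Fin n) (Fin n) ℂ) :
    Matrix (Fin n × Fin n) (Fin n × Fin n) ℂ :=
  rMatrix n * ((a ⊗ₖ (1 : Matrix (Fin n) (Fin n) ℂ)) * ((1 : Matrix (Fin n) (Fin n) ℂ) ⊗ₖ b)) -
    ((a ⊗ₖ (1 : Matrix (Fin n) (Fin n) ℂ)) * ((1 : Matrix (Fin n) (Fin n) ℂ) ⊗ₖ b)) * rMatrix n

/-- Labels of the matrix entries of `g` (left) and of `f` (right). -/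
abbrev EntryIdx (n : ℕ) := (Fin n × Fin n) ⊕ (Fin n × Fin n)

/-- The brackets of the matrix entries at the point `p = (g, f)`: `{g¹, g²} = [r, g¹ g²]`,
`{f¹, f²} = [r, f¹ f²]`, `{g¹, f²} = [r, g¹ f²]`. -/
def entryBracket {n : ℕ} (p : MatPair n) : EntryIdx n → EntryIdx n → ℂ
  | Sum.inl a, Sum.inl b => rCommutator p.1 p.1 (a.1, b.1) (a.2, b.2)
  | Sum.inl a, Sum.inr b => rCommutator p.1 p.2 (a.1, b.1) (a.2, b.2)
  | Sum.inr a, Sum.inl b => -rCommutator p.1 p.2 (b.1, a.1) (b.2, a.2)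
  | Sum.inr a, Sum.inr b => rCommutator p.2 p.2 (a.1, b.1) (a.2, b.2)

/-- The direction of a matrix entry. -/
def entryDir {n : ℕ} : EntryIdx n → MatPair n
  | Sum.inl a => (Matrix.single a.1 a.2 1, 0)
  | Sum.inr a => (0, Matrix.single a.1 a.2 1)

/-- Complex partial derivative of a function of `(g, f)` along a matrix entry. -/
def entryDeriv {n : ℕ} (e : EntryIdx n) (F : MatPair n → ℂ) (p : MatPair n) : ℂ :=
  deriv (fun s : ℂ => F (p + s • entryDir e)) 0

/-- The bracket `{·,·}^ℝ = i {·,·}` of holomorphic functions of `(g, f)`. The bivector is tangent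
to the subgroup `{(g, f) ∈ B₊ × B₋ | g_d f_d = 1}`. -/
def dualBracket {n : ℕ} (F H : MatPair n → ℂ) (p : MatPair n) : ℂ :=
  Complex.I * ∑ a, ∑ b, entryDeriv a F p * entryDeriv b H p * entryBracket p a b

/-- The real form `f* = g⁻¹` of the group of all pairs of an upper triangular matrix `g` and a
lower triangular matrix `f` with mutually inverse diagonal parts. -/
def dualUnitaryGroup (n : ℕ) : Set (MatPair n) :=
  {p | (∀ i j, j < i → p.1 i j = 0) ∧ (∀ i j, i < j → p.2 i j = 0) ∧
    (∀ i, p.1 i i * p.2 i i = 1) ∧ p.2ᴴ = p.1⁻¹}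

/-! ## Solid minors -/

/-- Labels `k` with `1 ≤ k ≤ n`, of the real coordinates. -/
abbrev RealIdx (n : ℕ) := {k : ℕ // 1 ≤ k ∧ k ≤ n}

/-- Labels `(k, l)` with `1 ≤ l < k ≤ n`, of the complex coordinates. -/
abbrev CplxIdx (n : ℕ) := {p : ℕ × ℕ // 1 ≤ p.2 ∧ p.2 < p.1 ∧ p.1 ≤ n}

/-- Labels `(k, l)` with `1 ≤ l ≤ k ≤ n`. -/
abbrev TriIdx (n : ℕ) := {p : ℕ × ℕ // 1 ≤ p.2 ∧ p.2 ≤ p.1 ∧ p.1 ≤ n}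

instance instFintypeRealIdx (n : ℕ) : Fintype (RealIdx n) :=
  Fintype.subtype (Finset.Icc 1 n) (by simp)

instance instFintypeCplxIdx (n : ℕ) : Fintype (CplxIdx n) :=
  Fintype.subtype ((Finset.Icc 1 n ×ˢ Finset.Icc 1 n).filter fun p => p.2 < p.1) (by
    rintro ⟨k, l⟩
    simp only [Finset.mem_filter, Finset.mem_product, Finset.mem_Icc]
    omega)

instance instFintypeTriIdx (n : ℕ) : Fintype (TriIdx n) :=
  Fintype.subtype ((Finset.Icc 1 n ×ˢ Finset.Icc 1 n).filter fun p => p.2 ≤ p.1) (by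
    rintro ⟨k, l⟩
    simp only [Finset.mem_filter, Finset.mem_product, Finset.mem_Icc]
    omega)

/-- The solid minor of size `l` with rows `n-k+1, …, n-k+l` and with the last `l` columns (rows
and columns are numbered from `1` here, and from `0` in `Fin n`). -/
def solidMinor {n : ℕ} (M : Matrix (Fin n) (Fin n) ℂ) (k l : ℕ) (hl : l ≤ k) (hk : k ≤ n) : ℂ :=
  (M.submatrix (fun i : Fin l => (⟨n - k + i, by omega⟩ : Fin n))
    (fun j : Fin l => (⟨n - l + j, by omega⟩ : Fin n))).det

/-- The coordinate functions: the minors `Δ^(k)_k` and `Δ^(k)_l` (`l < k`) of `g`, and the minors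
`Λ^(k)_l` of `f⁻¹` with columns `n-k+1, …, n-k+l` and with the last `l` rows. The latter are the
complex conjugates of `Δ^(k)_l` on the real form. -/
def minorCoord {n : ℕ} : RealIdx n ⊕ CplxIdx n ⊕ CplxIdx n → MatPair n → ℂ
  | Sum.inl k, p => solidMinor p.1 k.1 k.1 le_rfl k.2.2
  | Sum.inr (Sum.inl a), p => solidMinor p.1 a.1.1 a.1.2 a.2.2.1.le a.2.2.2
  | Sum.inr (Sum.inr a), p => solidMinor (p.2⁻¹)ᵀ a.1.1 a.1.2 a.2.2.1.le a.2.2.2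

/-- The part of the real form where `Δ^(k)_k > 0` for all `k`, and `Δ^(k)_l ≠ 0` for all `l < k`. -/
def minorChart (n : ℕ) : Set (MatPair n) :=
  {p | p ∈ dualUnitaryGroup n ∧ (∀ k : RealIdx n, 0 < (minorCoord (Sum.inl k) p).re) ∧
    ∀ a : CplxIdx n, minorCoord (Sum.inr (Sum.inl a)) p ≠ 0}

/-- The Laurent polynomials `P c d` express the brackets of the coordinate functions. -/
def IsMinorBracketTable {n : ℕ} (P : BracketTable (RealIdx n) (CplxIdx n)) : Prop :=
  ∀ c d, ∀ p ∈ minorChart n,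
    dualBracket (minorCoord c) (minorCoord d) p = (P c d).eval fun r => minorCoord r p

/-! ## The Gelfand-Zeitlin system -/

/-- The label `(k, l)`, `l ≤ k < n`, as a label with `l ≤ k ≤ n`. -/
def TriIdx.up {n : ℕ} (q : TriIdx (n - 1)) : TriIdx n :=
  ⟨q.1, q.2.1, q.2.2.1, q.2.2.2.trans (Nat.sub_le n 1)⟩

/-- The label `(k - 1, l)`, for `l < k ≤ n`. -/
def CplxIdx.down {n : ℕ} (a : CplxIdx n) : TriIdx (n - 1) :=
  ⟨(a.1.1 - 1, a.1.2), by
    obtain ⟨⟨k, l⟩, h1, h2, h3⟩ := a; dsimp only at h1 h2 h3 ⊢; omega⟩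

/-- The label `(k, l)`, for `l < k ≤ n`. -/
def CplxIdx.tri {n : ℕ} (a : CplxIdx n) : TriIdx n :=
  ⟨a.1, a.2.1, a.2.2.1.le, a.2.2.2⟩

/-- The label `(k, l + 1)`, for `l < k ≤ n`. -/
def CplxIdx.next {n : ℕ} (a : CplxIdx n) : TriIdx n :=
  ⟨(a.1.1, a.1.2 + 1), by
    obtain ⟨⟨k, l⟩, h1, h2, h3⟩ := a; dsimp only at h1 h2 h3 ⊢; omega⟩

/-- The (open) Gelfand-Zeitlin cone, given by the interlacing inequalities
`λ^(k)_l > λ^(k-1)_l > λ^(k)_(l+1)`. -/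
def gzCone (n : ℕ) : Set (TriIdx n → ℝ) :=
  {x | ∀ a : CplxIdx n, x a.down.up < x a.tri ∧ x a.next < x a.down.up}

theorem isOpen_gzCone (n : ℕ) : IsOpen (gzCone n) := by
  have h : gzCone n = ⋂ a : CplxIdx n,
      {x : TriIdx n → ℝ | x a.down.up < x a.tri} ∩ {x | x a.next < x a.down.up} := by
    ext x
    simp only [gzCone, Set.mem_ofPred_eq, Set.mem_iInter, Set.mem_inter_iff]
  rw [h]
  exact isOpen_iInter_of_finite fun a =>
    (isOpen_lt (by fun_prop) (by fun_prop)).inter (isOpen_lt (by fun_prop) (by fun_prop))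

/-- The Gelfand-Zeitlin system: actions `λ^(k)_l` (`l ≤ k ≤ n`) and angles `ψ^(k)_l`
(`l ≤ k ≤ n - 1`) with `{λ^(k)_l, ψ^(x)_y} = -δ_{k,x} δ_{l,y}`. -/
def gelfandZeitlin (n : ℕ) : TorusSystem (TriIdx n) (TriIdx (n - 1)) where
  cone := gzCone n
  isOpen_cone := isOpen_gzCone n
  tensor := actionAngleTensor fun j q => if j = q.up then -1 else 0
  skew := actionAngleTensor_skew _

/-- The action variable `ζ^(k)_l` of the tropicalization, which belongs to the real coordinate
`Δ^(k)_k` if `l = k` and to the complex coordinate `Δ^(k)_l` if `l < k`. -/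
def zetaIdx {n : ℕ} (j : TriIdx n) : RealIdx n ⊕ CplxIdx n :=
  if h : j.1.2 = j.1.1 then Sum.inl ⟨j.1.1, j.2.1.trans j.2.2.1, j.2.2.2⟩
  else Sum.inr ⟨j.1, j.2.1, lt_of_le_of_ne j.2.2.1 h, j.2.2.2⟩

/-- The order of the labels: those with larger `k` come first, and among those with equal `k` the
ones with smaller `l` come first. -/
def labelBefore {n : ℕ} (p q : TriIdx n) : Prop :=
  q.1.1 < p.1.1 ∨ (q.1.1 = p.1.1 ∧ p.1.2 < q.1.2)

instance instDecidableLabelBefore {n : ℕ} (p q : TriIdx n) : Decidable (labelBefore p q) := by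
  unfold labelBefore
  infer_instance

end

/-! Numbered from the last row and column, `g` becomes a lower triangular array, and the coordinates
become the solid minors Δ(k,l) on rows k-l, …, k-1 and columns 0, …, l-1. They are coordinates
because Δ(k+1,l+1) is affine in its corner entry, with slope Δ(k,l) ≠ 0 (`solid_corner`). Laurent
polynomials on the chart are determined by their values because distinct characters are linearly
independent.

The matrix r is a weighted flip, so the bracket of two minors is a weighted sum over exchanges of
rows minus one over exchanges of columns. For two minors of `g`, the non-vanishing exchanges of rows
that are not common all have the same weight, and the bracket is log-canonical
(`dualBracket_left_left_eq`). On the real form `dualPart`, the transpose of f⁻¹, is the complex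
conjugate of `g`. The bracket of a minor of `g` with one of `dualPart` is log-canonical plus a
remainder, in which a common row or column is replaced in both minors by the same one outside both
(`dualBracket_left_right_eq`).

Three-term determinant identities (`det_threeTerm`) express the minors with an exchanged row or
column recursively, dividing only by solid minors, that is, by coordinates. This gives Laurent
expansions whose weights can be controlled. With ζ^(k)_l half the partial sums of λ^(k), the
monomials Δ(k+1,l)Δ(k,l+1)/Δ(k,l) and Δ(k+1,l+2)Δ(k,l)/Δ(k,l+1) are lighter than Δ(k+1,l+1) exactly
when λ^(k)_(l+1) < λ^(k+1)_(l+1) and λ^(k+1)_(l+2) < λ^(k)_(l+1). Under all these inequalities every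
exchanged minor in the remainder is lighter than the unexchanged one (`rowSmall`, `colSmall`). Hence
the interlacing cone lies in the tropical cone, and the log-canonical coefficients can be read off.

Conversely, for test weights that violate a single inequality, one exchange dominates the remainder
of the bracket of Δ(k+1,l+1) with its conjugate. So the product of the corresponding monomial with
its conjugate really occurs there, with coefficient -i or i, and the cone condition for it is the
inequality in question (`mem_tropicalCone_iff`).

Finally, ζ^(k)_l and φ^(p)_q pair to -1/2 times the number of integers i ≥ 1 with k+q-p < i ≤
min(l,q) (`tropicalPairing_eq`). Taking differences in l, this forces φ^(p)_q to be the sum of the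
ψ^(k)_i with k+q-p < i ≤ q. That integer matrix is unitriangular, hence an isomorphism of tori, and
the pairing determines it uniquely. -/

noncomputable section

/-! ## Minors of infinite arrays and three-term relations -/

/-- The minor of an array with the listed rows and columns. -/
def minorOf (a : ℕ → ℕ → ℂ) {l : ℕ} (r c : Fin l → ℕ) : ℂ :=
  (Matrix.of fun i j => a (r i) (c j)).det

/-- The rows of the solid minor of size `l` which ends in row `k - 1`. -/
def solidSeq (k l : ℕ) (i : Fin l) : ℕ := k - l + i

/-- The first `l` columns. -/
def initSeq (l : ℕ) (j : Fin l) : ℕ := j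

/-- The minor with the `l` consecutive rows up to `k - 1` and the first `l` columns. -/
def solid (a : ℕ → ℕ → ℂ) (k l : ℕ) : ℂ := minorOf a (solidSeq k l) (initSeq l)

/-- The solid minor with the row in position `t` replaced by row `x`. -/
def rowRep (a : ℕ → ℕ → ℂ) (k l : ℕ) (t : Fin l) (x : ℕ) : ℂ :=
  minorOf a (Function.update (solidSeq k l) t x) (initSeq l)

/-- The solid minor with the column in position `t` replaced by column `y`. -/
def colRep (a : ℕ → ℕ → ℂ) (k l : ℕ) (t : Fin l) (y : ℕ) : ℂ :=
  minorOf a (solidSeq k l) (Function.update (initSeq l) t y)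

theorem minorOf_swap (a : ℕ → ℕ → ℂ) {l : ℕ} (r c : Fin l → ℕ) :
    minorOf (fun x y => a y x) r c = minorOf a c r := by
  rw [minorOf, ← Matrix.det_transpose]; rfl

theorem minorOf_update_row (a : ℕ → ℕ → ℂ) {l : ℕ} (r c : Fin l → ℕ) (t : Fin l) (x : ℕ) :
    minorOf a (Function.update r t x) c =
      ((Matrix.of fun i j => a (r i) (c j)).updateRow t fun j => a x (c j)).det := by
  rw [minorOf]
  congr 1
  ext i j
  by_cases h : i = t
  · subst h; simp
  · simp [h]

theorem minorOf_update_col (a : ℕ → ℕ → ℂ) {l : ℕ} (r c : Fin l → ℕ) (t : Fin l) (y : ℕ) :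
    minorOf a r (Function.update c t y) =
      ((Matrix.of fun i j => a (r i) (c j)).updateCol t fun i => a (r i) y).det := by
  rw [minorOf]
  congr 1
  ext i j
  by_cases h : j = t
  · subst h; simp
  · simp [h]

theorem minorOf_eq_zero_of_row {a : ℕ → ℕ → ℂ} {l : ℕ} {r c : Fin l → ℕ} {i j : Fin l}
    (hij : i ≠ j) (h : r i = r j) : minorOf a r c = 0 :=
  Matrix.det_zero_of_row_eq hij (by ext; simp [h])

theorem minorOf_eq_zero_of_col {a : ℕ → ℕ → ℂ} {l : ℕ} {r c : Fin l → ℕ} {i j : Fin l}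
    (hij : i ≠ j) (h : c i = c j) : minorOf a r c = 0 := by
  rw [← minorOf_swap]
  exact minorOf_eq_zero_of_row hij h

/-- Cramer's rule for the rows of a minor. -/
theorem sum_minorOf_update_row (a : ℕ → ℕ → ℂ) {l : ℕ} (r c : Fin l → ℕ) (x : ℕ) (j : Fin l) :
    ∑ i, minorOf a (Function.update r i x) c * a (r i) (c j) = minorOf a r c * a x (c j) := by
  have h := congrFun (Matrix.mulVec_cramer (Matrix.of fun i j => a (r i) (c j))ᵀ
    (fun j => a x (c j))) j
  simp only [Matrix.mulVec, dotProduct, Matrix.cramer_transpose_apply, Matrix.transpose_apply,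
    Matrix.of_apply, Matrix.det_transpose, Pi.smul_apply, smul_eq_mul] at h
  rw [minorOf, ← h]
  exact Finset.sum_congr rfl fun i _ => by rw [minorOf_update_row, mul_comm]

/-- The three-term relation between a minor, its leading principal minor, and the minors in which
a row has been exchanged. -/
theorem det_threeTerm {l : ℕ} (M : Matrix (Fin (l + 1)) (Fin (l + 1)) ℂ) (t : Fin l)
    (y : Fin (l + 1) → ℂ) :
    (M.submatrix Fin.castSucc Fin.castSucc).det * (M.updateRow t.castSucc y).det +
      ((M.submatrix Fin.castSucc Fin.castSucc).updateRow t
        fun j => M (Fin.last l) j.castSucc).det * (M.updateRow (Fin.last l) y).det =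
    M.det * ((M.submatrix Fin.castSucc Fin.castSucc).updateRow t fun j => y j.castSucc).det := by
  set N := M.submatrix Fin.castSucc Fin.castSucc with hN
  have h := Matrix.mulVec_cramer Mᵀ y
  have h1 : (fun j : Fin l => M.det * y j.castSucc) =
      ∑ b, (M.updateRow b y).det • fun j : Fin l => M b j.castSucc := by
    ext j
    have := congrFun h j.castSucc
    simp only [Matrix.mulVec, dotProduct, Matrix.cramer_transpose_apply, Matrix.transpose_apply,
      Matrix.det_transpose, Pi.smul_apply, smul_eq_mul] at this
    rw [← this]
    simp [mul_comm]
  have h2 : M.det * (N.updateRow t fun j => y j.castSucc).det =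
      Matrix.cramer Nᵀ (fun j : Fin l => M.det * y j.castSucc) t := by
    have : (fun j : Fin l => M.det * y j.castSucc) = M.det • fun j : Fin l => y j.castSucc := rfl
    rw [this, map_smul, Pi.smul_apply, smul_eq_mul, Matrix.cramer_transpose_apply]
  rw [h2, h1, map_sum, Finset.sum_apply, Fin.sum_univ_castSucc]
  simp only [map_smul, Pi.smul_apply, smul_eq_mul]
  have h3 : ∀ b : Fin l, Matrix.cramer Nᵀ (fun j : Fin l => M b.castSucc j.castSucc) t =
      if t = b then N.det else 0 := by
    intro b
    have := Matrix.cramer_transpose_row_self N b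
    have e : (fun j : Fin l => M b.castSucc j.castSucc) = N b := rfl
    rw [e, this, Pi.single_apply]
  simp only [h3, Matrix.cramer_transpose_apply]
  simp only [mul_ite, mul_zero, Finset.sum_ite_eq, Finset.mem_univ, if_true]
  ring

theorem minorOf_threeTerm_row (a : ℕ → ℕ → ℂ) {l : ℕ} (r c : Fin (l + 1) → ℕ) (t : Fin l)
    (x : ℕ) :
    minorOf a (r ∘ Fin.castSucc) (c ∘ Fin.castSucc) *
        minorOf a (Function.update r t.castSucc x) c +
      minorOf a (Function.update (r ∘ Fin.castSucc) t (r (Fin.last l))) (c ∘ Fin.castSucc) *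
        minorOf a (Function.update r (Fin.last l) x) c =
    minorOf a r c * minorOf a (Function.update (r ∘ Fin.castSucc) t x) (c ∘ Fin.castSucc) := by
  simp only [minorOf_update_row]
  exact det_threeTerm (Matrix.of fun i j => a (r i) (c j)) t fun j => a x (c j)

/-- Minors whose rows agree up to order agree up to sign. -/
theorem exists_sign_minorOf {l : ℕ} {r r' : Fin l → ℕ} (hr : Function.Injective r)
    (h : ∀ i, ∃ j, r' j = r i) :
    ∃ ε : ℂ, ε * ε = 1 ∧ ∀ (a : ℕ → ℕ → ℂ) (c : Fin l → ℕ), minorOf a r c = ε * minorOf a r' c := by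
  choose σ hσ using h
  have inj : Function.Injective σ := fun i j hij => hr (by rw [← hσ, ← hσ, hij])
  let e : Equiv.Perm (Fin l) := Equiv.ofBijective σ (Finite.injective_iff_bijective.1 inj)
  refine ⟨((Equiv.Perm.sign e : ℤ) : ℂ), ?_, fun a c => ?_⟩
  · rw [← Int.cast_mul, ← Units.val_mul, Int.units_mul_self]; simp
  · rw [minorOf, minorOf, ← Matrix.det_permute]
    congr 1
    ext i j
    simp [e, hσ]

theorem solidSeq_castSucc (k l : ℕ) : solidSeq (k + 1) (l + 1) ∘ Fin.castSucc = solidSeq k l := by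
  ext i; simp [solidSeq]

theorem initSeq_castSucc (l : ℕ) : initSeq (l + 1) ∘ Fin.castSucc = initSeq l := by
  ext i; simp [initSeq]

theorem solidSeq_injective (k l : ℕ) : Function.Injective (solidSeq k l) := fun i j h => by
  simp only [solidSeq] at h; ext; omega

theorem injective_update_seq {l : ℕ} {r : Fin l → ℕ} (hr : Function.Injective r) (t : Fin l)
    {x : ℕ} (hx : ∀ i, r i ≠ x) : Function.Injective (Function.update r t x) := by
  intro i j h
  by_cases hi : i = t <;> by_cases hj : j = t
  · rw [hi, hj]
  · subst hi; simp [hj] at h; exact absurd h.symm (hx j)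
  · subst hj; simp [hi] at h; exact absurd h (hx i)
  · simp [hi, hj] at h; exact hr h

/-- This recursion drives all estimates for rows: an exchange in a position before the last one is
reduced to exchanges in a smaller minor and to an exchange of the last row. -/
theorem rowRep_castSucc (a : ℕ → ℕ → ℂ) {k l : ℕ} (hl : l ≤ k) (t : Fin l) (x : ℕ) :
    solid a k l * rowRep a (k + 1) (l + 1) t.castSucc x =
      solid a (k + 1) (l + 1) * rowRep a k l t x -
        rowRep a k l t k * rowRep a (k + 1) (l + 1) (Fin.last l) x := by
  have h := minorOf_threeTerm_row a (solidSeq (k + 1) (l + 1)) (initSeq (l + 1)) t x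
  rw [solidSeq_castSucc, initSeq_castSucc] at h
  have e : solidSeq (k + 1) (l + 1) (Fin.last l) = k := by simp [solidSeq]; omega
  rw [e] at h
  simp only [solid, rowRep]
  linear_combination h

/-- The row identity applied to the transposed array. -/
theorem colRep_castSucc (a : ℕ → ℕ → ℂ) {k l : ℕ} (t : Fin l) (y : ℕ) :
    solid a k l * colRep a (k + 1) (l + 1) t.castSucc y =
      solid a (k + 1) (l + 1) * colRep a k l t y -
        colRep a k l t l * colRep a (k + 1) (l + 1) (Fin.last l) y := by
  have h := minorOf_threeTerm_row (fun x y => a y x) (initSeq (l + 1)) (solidSeq (k + 1) (l + 1)) t y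
  simp only [minorOf_swap] at h
  rw [solidSeq_castSucc, initSeq_castSucc] at h
  have e : initSeq (l + 1) (Fin.last l) = l := by simp [initSeq]
  rw [e] at h
  simp only [solid, colRep]
  linear_combination h

/-- A solid minor whose first row is moved past the last one. -/
theorem rowRep_next_zero (k l : ℕ) (hl : l + 1 ≤ k) :
    ∃ ε : ℂ, ε * ε = 1 ∧ ∀ a, rowRep a k (l + 1) 0 k = ε * solid a (k + 1) (l + 1) := by
  obtain ⟨ε, h1, h2⟩ := exists_sign_minorOf (r := Function.update (solidSeq k (l + 1)) 0 k)
    (r' := solidSeq (k + 1) (l + 1))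
    (injective_update_seq (solidSeq_injective _ _) _ fun i => by simp only [solidSeq]; omega)
    (fun i => by
      refine Fin.cases ?_ (fun i => ?_) i
      · exact ⟨Fin.last l, by simp [solidSeq]; omega⟩
      · exact ⟨i.castSucc, by simp [solidSeq]; omega⟩)
  exact ⟨ε, h1, fun a => h2 a _⟩

/-- Both sides use the rows k-l-1, …, k with one interior row left out. Thus appending row k at
level k is the same as prepending row k-l-1 at level k+1, which brings the minor into the range of
the estimates at that level. -/
theorem rowRep_next_succ (k l : ℕ) (hl : l + 1 ≤ k) (t : Fin l) :
    ∃ ε : ℂ, ε * ε = 1 ∧ ∀ a, rowRep a k (l + 1) t.succ k =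
      ε * rowRep a (k + 1) (l + 1) t.castSucc (k - (l + 1)) := by
  obtain ⟨ε, h1, h2⟩ := exists_sign_minorOf (r := Function.update (solidSeq k (l + 1)) t.succ k)
    (r' := Function.update (solidSeq (k + 1) (l + 1)) t.castSucc (k - (l + 1)))
    (injective_update_seq (solidSeq_injective _ _) _ fun i => by simp only [solidSeq]; omega)
    (fun i => by
      refine Fin.cases ?_ (fun i => ?_) i
      · refine ⟨t.castSucc, ?_⟩
        rw [Function.update_self, Function.update_of_ne (Fin.succ_ne_zero t).symm]
        simp [solidSeq]
      · by_cases h : i = t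
        · subst h
          refine ⟨Fin.last l, ?_⟩
          rw [Function.update_self, Function.update_of_ne (Fin.castSucc_lt_last i).ne']
          simp [solidSeq]; omega
        · refine ⟨i.castSucc, ?_⟩
          rw [Function.update_of_ne (by simpa using h), Function.update_of_ne (by simpa using h)]
          simp [solidSeq]; omega)
  exact ⟨ε, h1, fun a => h2 a _⟩

/-- Without its last row k, the interval together with its predecessor k-l-1 is again an interval,
which now ends at k-1. -/
theorem rowRep_last_sub_one (k l : ℕ) (hl : l < k) :
    ∃ ε : ℂ, ε * ε = 1 ∧ ∀ a, rowRep a (k + 1) (l + 1) (Fin.last l) (k - l - 1) =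
      ε * solid a k (l + 1) := by
  obtain ⟨ε, h1, h2⟩ := exists_sign_minorOf
    (r := Function.update (solidSeq (k + 1) (l + 1)) (Fin.last l) (k - l - 1))
    (r' := solidSeq k (l + 1))
    (injective_update_seq (solidSeq_injective _ _) _ fun i => by simp only [solidSeq]; omega)
    (fun i => by
      refine Fin.lastCases ?_ (fun i => ?_) i
      · exact ⟨0, by simp [solidSeq]; omega⟩
      · refine ⟨i.succ, ?_⟩
        rw [Function.update_of_ne (Fin.castSucc_lt_last i).ne]
        simp [solidSeq]; omega)
  exact ⟨ε, h1, fun a => h2 a _⟩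

theorem rowRep_last (k l x : ℕ) (hl : l < k) (hx : x < k - l - 1) :
    ∃ ε : ℂ, ε * ε = 1 ∧ ∀ a, rowRep a (k + 1) (l + 1) (Fin.last l) x =
      ε * rowRep a k (l + 1) 0 x := by
  obtain ⟨ε, h1, h2⟩ := exists_sign_minorOf
    (r := Function.update (solidSeq (k + 1) (l + 1)) (Fin.last l) x)
    (r' := Function.update (solidSeq k (l + 1)) 0 x)
    (injective_update_seq (solidSeq_injective _ _) _ fun i => by simp only [solidSeq]; omega)
    (fun i => by
      refine Fin.lastCases ?_ (fun i => ?_) i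
      · exact ⟨0, by simp⟩
      · refine ⟨i.succ, ?_⟩
        rw [Function.update_of_ne (Fin.castSucc_lt_last i).ne,
          Function.update_of_ne (Fin.succ_ne_zero i)]
        simp [solidSeq]; omega)
  exact ⟨ε, h1, fun a => h2 a _⟩

theorem colRep_self (a : ℕ → ℕ → ℂ) (k l : ℕ) : colRep a k (l + 1) (Fin.last l) l = solid a k (l + 1) := by
  rw [colRep, solid]
  congr 1
  exact Function.update_eq_self_iff.2 (by simp [initSeq])

theorem det_updateRow_single {l : ℕ} (M : Matrix (Fin (l + 1)) (Fin (l + 1)) ℂ)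
    (i j : Fin (l + 1)) : (M.updateRow i (Pi.single j 1)).det =
      (-1) ^ (i + j : ℕ) * (M.submatrix i.succAbove j.succAbove).det := by
  rw [← Matrix.adjugate_apply, Matrix.adjugate_fin_succ_eq_det_submatrix]

/-- The Desnanot-Jacobi type relation for the last column of solid minors. -/
theorem colRep_last (k l : ℕ) (hl : l < k) :
    ∃ ε δ : ℂ, ε * ε = 1 ∧ δ * δ = 1 ∧ ∀ a y,
      solid a k (l + 1) * colRep a (k + 1) (l + 1) (Fin.last l) y =
        ε * (solid a (k + 1) (l + 1) * colRep a k (l + 1) (Fin.last l) y) +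
        δ * (colRep a (k + 1) (l + 2) (Fin.last (l + 1)) y * solid a k l) := by
  obtain ⟨ε, hε, hε'⟩ := rowRep_next_zero k l hl
  have hs : ∀ m : ℕ, ((-1 : ℂ) ^ m) * (-1) ^ m = 1 := fun m => by
    rw [← mul_pow]; simp
  refine ⟨(-1) ^ l * ε, 1, by linear_combination ε * ε * hs l + hε, by norm_num, fun a y => ?_⟩
  let c : Fin (l + 2) → ℕ := Function.update (initSeq (l + 2)) (Fin.last (l + 1)) y
  let M : Matrix (Fin (l + 2)) (Fin (l + 2)) ℂ :=
    Matrix.of fun i j => a (solidSeq (k + 1) (l + 2) i) (c j)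
  have hc : ∀ j : Fin (l + 1), c j.castSucc = j := fun j => by
    simp only [c]
    rw [Function.update_of_ne (Fin.castSucc_lt_last j).ne]; simp [initSeq]
  have hcl : c (Fin.last (l + 1)) = y := by simp [c]
  -- The inserted row is a unit vector at the last but one column. It turns the exchanged
  -- determinants into cofactors, each a solid minor of size one less, possibly with its last column
  -- replaced by column `y`.
  have h := det_threeTerm M 0 (Pi.single (Fin.last l).castSucc 1)
  have e0 : (M.submatrix Fin.castSucc Fin.castSucc) =
      Matrix.of fun i j => a (solidSeq k (l + 1) i) (initSeq (l + 1) j) := by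
    ext i j
    simp only [M, Matrix.submatrix_apply, Matrix.of_apply, hc, initSeq]
    rw [← solidSeq_castSucc k (l + 1)]; rfl
  have e1 : (fun j : Fin (l + 1) => (Pi.single (Fin.last l).castSucc 1 : Fin (l + 2) → ℂ) j.castSucc)
      = Pi.single (Fin.last l) 1 := by
    ext j
    simp [Pi.single_apply]
  have e2 : (M.submatrix (Fin.castSucc (0 : Fin (l + 1))).succAbove
      (Fin.castSucc (Fin.last l)).succAbove) = Matrix.of fun i j =>
        a (solidSeq (k + 1) (l + 1) i) (Function.update (initSeq (l + 1)) (Fin.last l) y j) := by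
    ext i j
    simp only [M, Matrix.submatrix_apply, Matrix.of_apply]
    congr 1
    · simp [solidSeq]; omega
    · refine Fin.lastCases ?_ (fun j => ?_) j
      · rw [Fin.succAbove_castSucc_self, Fin.succ_last, hcl, Function.update_self]
      · rw [Fin.succAbove_castSucc_of_lt _ _ (Fin.castSucc_lt_last j), hc,
          Function.update_of_ne (Fin.castSucc_lt_last j).ne]; simp [initSeq]
  have e3 : (M.submatrix (Fin.last (l + 1)).succAbove
      (Fin.castSucc (Fin.last l)).succAbove) = Matrix.of fun i j =>
        a (solidSeq k (l + 1) i) (Function.update (initSeq (l + 1)) (Fin.last l) y j) := by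
    ext i j
    simp only [M, Matrix.submatrix_apply, Matrix.of_apply]
    congr 1
    · rw [← solidSeq_castSucc k (l + 1)]; simp
    · refine Fin.lastCases ?_ (fun j => ?_) j
      · rw [Fin.succAbove_castSucc_self, Fin.succ_last, hcl, Function.update_self]
      · rw [Fin.succAbove_castSucc_of_lt _ _ (Fin.castSucc_lt_last j), hc,
          Function.update_of_ne (Fin.castSucc_lt_last j).ne]; simp [initSeq]
  have e4 : (Matrix.of fun i j => a (solidSeq k (l + 1) i) (initSeq (l + 1) j)).submatrix
      (Fin.succAbove 0) (Fin.last l).succAbove =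
      Matrix.of fun i j => a (solidSeq k l i) (initSeq l j) := by
    ext i j
    simp [solidSeq, initSeq]
    congr 1; omega
  have e5 : (fun j : Fin (l + 1) => M (Fin.last (l + 1)) j.castSucc) =
      fun j => a k (initSeq (l + 1) j) := by
    ext j
    simp only [M, Matrix.of_apply, hc, initSeq]
    congr 1
    simp [solidSeq]; omega
  rw [e1, e0, e5, det_updateRow_single, det_updateRow_single, det_updateRow_single, e2, e3, e4,
    ← minorOf_update_row] at h
  have h' := hε' a
  rw [rowRep] at h'
  rw [h'] at h
  change solid a k (l + 1) * ((-1) ^ (0 + l) * colRep a (k + 1) (l + 1) (Fin.last l) y) +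
    _ * ((-1) ^ (l + 1 + l) * colRep a k (l + 1) (Fin.last l) y) =
    colRep a (k + 1) (l + 2) (Fin.last (l + 1)) y * ((-1) ^ (0 + l) * solid a k l) at h
  have p : (-1 : ℂ) ^ (l + 1 + l) = -1 := by rw [show l + 1 + l = 2 * l + 1 by ring]; simp [pow_add, pow_mul]
  rw [p, zero_add] at h
  linear_combination (-1) ^ l * h - (solid a k (l + 1) * colRep a (k + 1) (l + 1) (Fin.last l) y -
    colRep a (k + 1) (l + 2) (Fin.last (l + 1)) y * solid a k l) * hs l

/-- A minor with a column above the diagonal of a lower triangular array vanishes. -/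
theorem colRep_eq_zero {a : ℕ → ℕ → ℂ} (ha : ∀ x y, x < y → a x y = 0) {k : ℕ} (t : Fin k) {y : ℕ}
    (hy : k ≤ y) : colRep a k k t y = 0 := by
  rw [colRep, minorOf_update_col]
  refine Matrix.det_eq_zero_of_column_eq_zero t fun i => ?_
  simp only [Matrix.updateCol_self]
  exact ha _ _ (by simp [solidSeq]; omega)

theorem rowRep_eq_zero {a : ℕ → ℕ → ℂ} {k l : ℕ} (t : Fin l) {x : ℕ} (h1 : k - l ≤ x)
    (h2 : x < k - l + l) (h3 : x ≠ solidSeq k l t) : rowRep a k l t x = 0 := by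
  have hi : solidSeq k l ⟨x - (k - l), by omega⟩ = x := by simp [solidSeq]; omega
  have hne : (⟨x - (k - l), by omega⟩ : Fin l) ≠ t := fun h => h3 (by rw [← h, hi])
  exact minorOf_eq_zero_of_row hne (by rw [Function.update_of_ne hne, hi, Function.update_self])

theorem rowRep_self (a : ℕ → ℕ → ℂ) (k l : ℕ) (t : Fin l) :
    rowRep a k l t (solidSeq k l t) = solid a k l := by
  rw [rowRep, Function.update_eq_self]; rfl

theorem colRep_eq_zero_of_lt {a : ℕ → ℕ → ℂ} {k l : ℕ} (t : Fin l) {y : ℕ} (h2 : y < l)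
    (h3 : y ≠ t) : colRep a k l t y = 0 := by
  have hne : (⟨y, h2⟩ : Fin l) ≠ t := fun h => h3 (by rw [← h])
  exact minorOf_eq_zero_of_col hne (by rw [Function.update_of_ne hne, Function.update_self]; rfl)

theorem colRep_self' (a : ℕ → ℕ → ℂ) (k l : ℕ) (t : Fin l) :
    colRep a k l t t = solid a k l := by
  rw [colRep, solid]
  congr 1
  exact Function.update_eq_self_iff.2 rfl

/-! ## Derivatives of minors along matrix entries -/

/-- Jacobi's formula, obtained by differentiating the Leibniz expansion row by row. -/
theorem hasDerivAt_det {l : ℕ} {M : ℂ → Matrix (Fin l) (Fin l) ℂ} {M' : Matrix (Fin l) (Fin l) ℂ}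
    {s : ℂ} (h : ∀ i j, HasDerivAt (fun s => M s i j) (M' i j) s) :
    HasDerivAt (fun s => (M s).det) ((M s).adjugate * M').trace s := by
  have e1 : (fun s => (M s).det) = fun s => ∑ σ : Equiv.Perm (Fin l),
      ((Equiv.Perm.sign σ : ℤ) : ℂ) * ∏ i, M s i (σ i) := by
    ext s
    rw [← Matrix.det_transpose, Matrix.det_apply']
    rfl
  have e2 : ((M s).adjugate * M').trace = ∑ i, ((M s).updateRow i fun j => M' i j).det := by
    rw [Matrix.trace_mul_comm, Matrix.trace]
    refine Finset.sum_congr rfl fun i _ => ?_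
    rw [← Matrix.cramer_transpose_apply, Matrix.cramer_eq_adjugate_mulVec,
      ← Matrix.adjugate_transpose]
    simp [Matrix.mulVec, dotProduct, Matrix.mul_apply, mul_comm]
  have e3 : ∀ i, ((M s).updateRow i fun j => M' i j).det = ∑ σ : Equiv.Perm (Fin l),
      ((Equiv.Perm.sign σ : ℤ) : ℂ) * ((∏ j ∈ Finset.univ.erase i, M s j (σ j)) * M' i (σ i)) := by
    intro i
    rw [← Matrix.det_transpose, Matrix.det_apply']
    refine Finset.sum_congr rfl fun σ _ => ?_
    rw [← Finset.mul_prod_erase _ _ (Finset.mem_univ i), mul_comm (Matrix.transpose _ _ _)]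
    congr 2
    · refine Finset.prod_congr rfl fun j hj => ?_
      rw [Matrix.transpose_apply, Matrix.updateRow_ne (Finset.ne_of_mem_erase hj)]
    · simp
  rw [e1, e2, Finset.sum_congr rfl fun i _ => e3 i, Finset.sum_comm]
  refine HasDerivAt.fun_sum fun σ _ => ?_
  rw [← Finset.mul_sum]
  refine HasDerivAt.const_mul _ ?_
  have := HasDerivAt.fun_finsetProd (u := Finset.univ) (fun i _ => h i (σ i))
  simpa [smul_eq_mul] using this

/-- The derivative of the minor of `M` with rows `e` and columns `f` in the direction `X`. -/
def minorDeriv {n l : ℕ} (M : Matrix (Fin n) (Fin n) ℂ) (e f : Fin l → Fin n) :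
    Matrix (Fin n) (Fin n) ℂ →ₗ[ℂ] ℂ where
  toFun X := ((M.submatrix e f).adjugate * X.submatrix e f).trace
  map_add' X Y := by
    rw [show (X + Y).submatrix e f = X.submatrix e f + Y.submatrix e f from rfl, mul_add,
      Matrix.trace_add]
  map_smul' c X := by
    rw [show (c • X).submatrix e f = c • X.submatrix e f from rfl, mul_smul_comm,
      Matrix.trace_smul]
    rfl

theorem minorDeriv_eq_sum_row {n l : ℕ} (M X : Matrix (Fin n) (Fin n) ℂ) (e f : Fin l → Fin n) :
    minorDeriv M e f X =
      ∑ i, ((M.submatrix e f).updateRow i fun j => X (e i) (f j)).det := by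
  change ((M.submatrix e f).adjugate * X.submatrix e f).trace = _
  rw [Matrix.trace_mul_comm, Matrix.trace]
  refine Finset.sum_congr rfl fun i _ => ?_
  rw [← Matrix.cramer_transpose_apply, Matrix.cramer_eq_adjugate_mulVec,
    ← Matrix.adjugate_transpose]
  simp [Matrix.mulVec, dotProduct, Matrix.mul_apply, mul_comm]

theorem minorDeriv_eq_sum_col {n l : ℕ} (M X : Matrix (Fin n) (Fin n) ℂ) (e f : Fin l → Fin n) :
    minorDeriv M e f X =
      ∑ j, ((M.submatrix e f).updateCol j fun i => X (e i) (f j)).det := by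
  change ((M.submatrix e f).adjugate * X.submatrix e f).trace = _
  rw [Matrix.trace]
  refine Finset.sum_congr rfl fun i _ => ?_
  rw [← Matrix.cramer_apply, Matrix.cramer_eq_adjugate_mulVec]
  simp [Matrix.mulVec, dotProduct, Matrix.mul_apply]

/-- An infinitesimal row operation moves only row `a`, in the direction of row `c`. By
multilinearity its effect on a minor is to substitute one row for the other. -/
theorem minorDeriv_single_mul {n l : ℕ} (M : Matrix (Fin n) (Fin n) ℂ) (e f : Fin l → Fin n)
    (a c : Fin n) : minorDeriv M e f (Matrix.single a c 1 * M) =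
      ∑ i, if e i = a then (M.submatrix (Function.update e i c) f).det else 0 := by
  rw [minorDeriv_eq_sum_row]
  refine Finset.sum_congr rfl fun i _ => ?_
  split_ifs with h
  · congr 1
    ext x y
    by_cases hx : x = i
    · subst hx; simp [h]
    · simp [hx]
  · refine Matrix.det_eq_zero_of_row_eq_zero i fun j => ?_
    rw [Matrix.updateRow_self, Matrix.single_mul_apply_of_ne _ _ _ _ _ h]

theorem minorDeriv_mul_single {n l : ℕ} (M : Matrix (Fin n) (Fin n) ℂ) (e f : Fin l → Fin n)
    (d b : Fin n) : minorDeriv M e f (M * Matrix.single d b 1) =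
      ∑ j, if f j = b then (M.submatrix e (Function.update f j d)).det else 0 := by
  rw [minorDeriv_eq_sum_col]
  refine Finset.sum_congr rfl fun i _ => ?_
  split_ifs with h
  · congr 1
    ext x y
    by_cases hx : y = i
    · subst hx; simp [h]
    · simp [hx]
  · refine Matrix.det_eq_zero_of_column_eq_zero i fun j => ?_
    rw [Matrix.updateCol_self, Matrix.mul_single_apply_of_ne _ _ _ _ _ h]

theorem entryDeriv_minor_left {n l : ℕ} (e f : Fin l → Fin n) (p : MatPair n) (x : Fin n × Fin n) :
    entryDeriv (Sum.inl x) (fun p => (p.1.submatrix e f).det) p =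
      minorDeriv p.1 e f (Matrix.single x.1 x.2 1) := by
  have h := hasDerivAt_det (M := fun s : ℂ => (p.1 + s • Matrix.single x.1 x.2 1).submatrix e f)
    (M' := (Matrix.single x.1 x.2 (1 : ℂ)).submatrix e f) (s := 0) fun i j => by
      have := (hasDerivAt_id (0 : ℂ)).mul_const (Matrix.single x.1 x.2 (1 : ℂ) (e i) (f j))
      rw [one_mul] at this
      exact this.const_add (p.1 (e i) (f j))
  have h2 := h.deriv
  simp only [zero_smul, add_zero] at h2
  exact h2

theorem entryDeriv_left_of_right {n : ℕ} (F : Matrix (Fin n) (Fin n) ℂ → ℂ) (p : MatPair n)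
    (x : Fin n × Fin n) : entryDeriv (Sum.inl x) (fun p => F p.2) p = 0 := by
  simp [entryDeriv, entryDir]

theorem entryDeriv_right_of_left {n : ℕ} (F : Matrix (Fin n) (Fin n) ℂ → ℂ) (p : MatPair n)
    (x : Fin n × Fin n) : entryDeriv (Sum.inr x) (fun p => F p.1) p = 0 := by
  simp [entryDeriv, entryDir]

-- The norm only makes the matrices a Banach algebra, where the derivative of inversion is known;
-- the statement about entries does not depend on its choice.
attribute [local instance] Matrix.linftyOpNormedRing Matrix.linftyOpNormedAlgebra in
theorem hasDerivAt_matrix_inv {n : ℕ} {M : Matrix (Fin n) (Fin n) ℂ} (hM : IsUnit M)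
    (X : Matrix (Fin n) (Fin n) ℂ) (i j : Fin n) :
    HasDerivAt (fun s : ℂ => (M + s • X)⁻¹ i j) ((-(M⁻¹ * X * M⁻¹)) i j) 0 := by
  obtain ⟨u, rfl⟩ := hM
  have h1 : HasDerivAt (fun s : ℂ => (u : Matrix (Fin n) (Fin n) ℂ) + s • X) X 0 := by
    have := ((hasDerivAt_id (0 : ℂ)).smul_const X).const_add (u : Matrix (Fin n) (Fin n) ℂ)
    rw [one_smul] at this
    exact this
  have h2 := hasFDerivAt_ringInverse (𝕜 := ℂ) u
  have h3 := HasFDerivAt.comp_hasDerivAt (0 : ℂ) (by simpa using h2) h1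
  let E : Matrix (Fin n) (Fin n) ℂ →ₗ[ℂ] ℂ := Matrix.entryLinearMap ℂ ℂ i j
  have h4 := (LinearMap.toContinuousLinearMap E).hasFDerivAt.comp_hasDerivAt (0 : ℂ) h3
  have e : (LinearMap.toContinuousLinearMap E ∘ Ring.inverse ∘
      fun s : ℂ => (u : Matrix (Fin n) (Fin n) ℂ) + s • X) =
      fun s : ℂ => ((u : Matrix (Fin n) (Fin n) ℂ) + s • X)⁻¹ i j := by
    ext s
    simp [E, Matrix.nonsing_inv_eq_ringInverse]
  rw [e] at h4
  exact h4

/-- The transpose of the inverse of the second component. -/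
def dualPart {n : ℕ} (p : MatPair n) : Matrix (Fin n) (Fin n) ℂ := (p.2⁻¹)ᵀ

/-- The derivative of a minor of `dualPart p` as a functional of the variation of `p.2`. -/
def dualMinorDeriv {n l : ℕ} (p : MatPair n) (e f : Fin l → Fin n) :
    Matrix (Fin n) (Fin n) ℂ →ₗ[ℂ] ℂ :=
  (minorDeriv (dualPart p) e f).comp
    { toFun := fun X => -(p.2⁻¹ * X * p.2⁻¹)ᵀ
      map_add' := fun X Y => by
        rw [mul_add, add_mul, Matrix.transpose_add, neg_add]
      map_smul' := fun c X => by
        rw [mul_smul_comm, smul_mul_assoc, Matrix.transpose_smul, RingHom.id_apply, smul_neg] }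

theorem entryDeriv_minor_right {n l : ℕ} (e f : Fin l → Fin n) {p : MatPair n} (hp : IsUnit p.2)
    (x : Fin n × Fin n) :
    entryDeriv (Sum.inr x) (fun p => ((dualPart p).submatrix e f).det) p =
      dualMinorDeriv p e f (Matrix.single x.1 x.2 1) := by
  have h := hasDerivAt_det
    (M := fun s : ℂ => (((p.2 + s • Matrix.single x.1 x.2 1)⁻¹)ᵀ).submatrix e f)
    (M' := ((-(p.2⁻¹ * Matrix.single x.1 x.2 (1 : ℂ) * p.2⁻¹))ᵀ).submatrix e f) (s := 0)
    fun i j => hasDerivAt_matrix_inv hp (Matrix.single x.1 x.2 1) (f j) (e i)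
  have h2 := h.deriv
  simp only [zero_smul, add_zero] at h2
  exact h2.trans (by rw [Matrix.transpose_neg]; rfl)

/-- The variation of f⁻¹ is -f⁻¹(δf)f⁻¹. After transposition a row operation on `f` is again a row
operation on `dualPart`, with the opposite sign and transposed unit matrix. -/
theorem dualMinorDeriv_single_mul {n l : ℕ} (e f : Fin l → Fin n) {p : MatPair n}
    (hp : IsUnit p.2) (a c : Fin n) : dualMinorDeriv p e f (Matrix.single a c 1 * p.2) =
      -minorDeriv (dualPart p) e f (Matrix.single c a 1 * dualPart p) := by
  have hu : IsUnit p.2.det := (Matrix.isUnit_iff_isUnit_det _).1 hp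
  rw [← map_neg]
  change minorDeriv (dualPart p) e f (-(p.2⁻¹ * (Matrix.single a c 1 * p.2) * p.2⁻¹)ᵀ) = _
  congr 1
  rw [← mul_assoc, Matrix.mul_nonsing_inv_cancel_right _ _ hu,
    Matrix.transpose_mul, Matrix.transpose_single]
  rfl

theorem dualMinorDeriv_mul_single {n l : ℕ} (e f : Fin l → Fin n) {p : MatPair n}
    (hp : IsUnit p.2) (a c : Fin n) : dualMinorDeriv p e f (p.2 * Matrix.single a c 1) =
      -minorDeriv (dualPart p) e f (dualPart p * Matrix.single c a 1) := by
  have hu : IsUnit p.2.det := (Matrix.isUnit_iff_isUnit_det _).1 hp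
  rw [← map_neg]
  change minorDeriv (dualPart p) e f (-(p.2⁻¹ * (p.2 * Matrix.single a c 1) * p.2⁻¹)ᵀ) = _
  congr 1
  rw [← mul_assoc, Matrix.nonsing_inv_mul _ hu, one_mul,
    Matrix.transpose_mul, Matrix.transpose_single]
  rfl

/-! ## The entries of the commutator with the r-matrix -/

/-- The coefficients of the `r`-matrix. -/
def rCoeff {α : Type*} [LinearOrder α] (a c : α) : ℂ := if a < c then 1 else if a = c then 1 / 2 else 0

/-- The matrix r is the flip of the two tensor factors with weights `rCoeff`; multiplication by it
therefore exchanges indices between the factors. -/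
theorem rMatrix_apply {n : ℕ} (i j k l : Fin n) :
    rMatrix n (i, j) (k, l) = if k = j ∧ l = i then rCoeff i j else 0 := by
  have h1 : ((1 / 2 : ℂ) • ∑ a : Fin n, Matrix.single a a (1 : ℂ) ⊗ₖ Matrix.single a a (1 : ℂ))
      (i, j) (k, l) = if k = j ∧ l = i ∧ i = j then 1 / 2 else 0 := by
    rw [Matrix.smul_apply, Matrix.sum_apply]
    simp only [Matrix.kroneckerMap_apply, Matrix.single_apply]
    rw [Finset.sum_eq_single i]
    · by_cases h1 : k = j <;> by_cases h2 : l = i <;> by_cases h3 : i = j <;>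
        simp [h1, h2, h3, eq_comm] <;> grind
    · intro b _ hb; simp [hb]
    · simp
  have h2 : (∑ a : Fin n, ∑ b : Fin n,
      if a < b then Matrix.single a b (1 : ℂ) ⊗ₖ Matrix.single b a (1 : ℂ) else 0)
      (i, j) (k, l) = if k = j ∧ l = i ∧ i < j then 1 else 0 := by
    rw [Matrix.sum_apply, Finset.sum_eq_single i, Matrix.sum_apply, Finset.sum_eq_single j]
    · by_cases h : i < j
      · simp only [h, if_true, Matrix.kroneckerMap_apply, Matrix.single_apply]
        grind
      · simp [h]
    · intro b _ hb
      split_ifs <;> simp [Matrix.kroneckerMap_apply, Matrix.single_apply, hb]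
    · simp
    · intro b _ hb
      rw [Matrix.sum_apply]
      refine Finset.sum_eq_zero fun c _ => ?_
      split_ifs <;> simp [Matrix.kroneckerMap_apply, Matrix.single_apply, hb]
    · simp
  rw [rMatrix, Matrix.add_apply, h1, h2, rCoeff]
  by_cases h : k = j ∧ l = i
  · rcases lt_trichotomy i j with h3 | h3 | h3
    · simp [h, h3, h3.ne]
    · simp [h, h3]
    · simp [h, h3.ne', h3.not_gt]
  · have h' : ∀ q : Prop, ¬ (k = j ∧ l = i ∧ q) := fun q hq => h ⟨hq.1, hq.2.1⟩
    simp [h, h']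

theorem rCommutator_apply {n : ℕ} (g g' : Matrix (Fin n) (Fin n) ℂ) (i j k l : Fin n) :
    rCommutator g g' (i, j) (k, l) =
      rCoeff i j * (g j k * g' i l) - rCoeff l k * (g i l * g' j k) := by
  have h0 : (g ⊗ₖ (1 : Matrix (Fin n) (Fin n) ℂ)) * ((1 : Matrix (Fin n) (Fin n) ℂ) ⊗ₖ g') =
      g ⊗ₖ g' := by
    rw [← Matrix.mul_kronecker_mul, mul_one, one_mul]
  rw [rCommutator, h0, Matrix.sub_apply, Matrix.mul_apply, Matrix.mul_apply]
  congr 1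
  · rw [Finset.sum_eq_single (j, i)]
    · simp [rMatrix_apply]
    · rintro ⟨x, y⟩ _ h
      rw [rMatrix_apply, if_neg, zero_mul]
      rintro ⟨rfl, rfl⟩; exact h rfl
    · simp
  · rw [Finset.sum_eq_single (l, k)]
    · simp [rMatrix_apply]; ring
    · rintro ⟨x, y⟩ _ h
      rw [rMatrix_apply, if_neg, mul_zero]
      rintro ⟨rfl, rfl⟩; exact h rfl
    · simp

/-- The two halves of the commutator are contractions along left and along right translations. This
form is wanted because translations by unit matrices act on minors by substituting rows or columns.
-/
theorem sum_mul_rCommutator {n : ℕ} (φ ψ : Matrix (Fin n) (Fin n) ℂ →ₗ[ℂ] ℂ)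
    (g g' : Matrix (Fin n) (Fin n) ℂ) :
    ∑ x : Fin n × Fin n, ∑ y : Fin n × Fin n, φ (Matrix.single x.1 x.2 1) *
        ψ (Matrix.single y.1 y.2 1) * rCommutator g g' (x.1, y.1) (x.2, y.2) =
      ∑ a, ∑ c, rCoeff a c * (φ (Matrix.single a c 1 * g) * ψ (Matrix.single c a 1 * g')) -
      ∑ b, ∑ d, rCoeff d b * (φ (g * Matrix.single d b 1) * ψ (g' * Matrix.single b d 1)) := by
  have hrow : ∀ (χ : Matrix (Fin n) (Fin n) ℂ →ₗ[ℂ] ℂ) (M : Matrix (Fin n) (Fin n) ℂ) (a c : Fin n),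
      χ (Matrix.single a c 1 * M) = ∑ b, χ (Matrix.single a b 1) * M c b := by
    intro χ M a c
    have : Matrix.single a c 1 * M = ∑ b, M c b • Matrix.single a b (1 : ℂ) := by
      ext x y
      rw [Matrix.sum_apply]
      by_cases h : x = a
      · subst h; simp [Matrix.single_apply]
      · simp [h, Ne.symm h]
    rw [this, map_sum]
    exact Finset.sum_congr rfl fun b _ => by rw [map_smul, smul_eq_mul, mul_comm]
  have hcol : ∀ (χ : Matrix (Fin n) (Fin n) ℂ →ₗ[ℂ] ℂ) (M : Matrix (Fin n) (Fin n) ℂ) (d b : Fin n),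
      χ (M * Matrix.single d b 1) = ∑ a, χ (Matrix.single a b 1) * M a d := by
    intro χ M d b
    have : M * Matrix.single d b 1 = ∑ a, M a d • Matrix.single a b (1 : ℂ) := by
      ext x y
      rw [Matrix.sum_apply]
      by_cases h : y = b
      · subst h; simp [Matrix.single_apply]
      · simp [h, Ne.symm h]
    rw [this, map_sum]
    exact Finset.sum_congr rfl fun b _ => by rw [map_smul, smul_eq_mul, mul_comm]
  simp only [rCommutator_apply, mul_sub, Finset.sum_sub_distrib]
  congr 1
  · simp only [hrow, Finset.sum_mul_sum, Fintype.sum_prod_type]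
    refine Finset.sum_congr rfl fun a _ => ?_
    rw [Finset.sum_comm]
    refine Finset.sum_congr rfl fun c _ => ?_
    rw [Finset.mul_sum]
    refine Finset.sum_congr rfl fun b _ => ?_
    rw [Finset.mul_sum]
    refine Finset.sum_congr rfl fun d _ => ?_
    ring
  · simp only [hcol, Finset.sum_mul_sum, Fintype.sum_prod_type]
    rw [Finset.sum_comm]
    refine Finset.sum_congr rfl fun b _ => ?_
    have h4 : ∀ F : Fin n → Fin n → Fin n → ℂ, ∑ x, ∑ y, ∑ z, F x y z = ∑ z, ∑ x, ∑ y, F x y z := by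
      intro F
      rw [Finset.sum_comm' (t' := Finset.univ) (s' := fun _ => Finset.univ) (by simp)]
      rw [Finset.sum_congr rfl fun y _ => Finset.sum_comm, Finset.sum_comm]
      exact Finset.sum_congr rfl fun z _ => Finset.sum_comm
    rw [h4]
    refine Finset.sum_congr rfl fun d _ => ?_
    rw [Finset.mul_sum]
    refine Finset.sum_congr rfl fun a _ => ?_
    rw [Finset.mul_sum]
    refine Finset.sum_congr rfl fun c _ => ?_
    ring

theorem dualBracket_of_left_left {n : ℕ} {F H : MatPair n → ℂ} {p : MatPair n}
    {φ ψ : Matrix (Fin n) (Fin n) ℂ →ₗ[ℂ] ℂ} (hF : ∀ x, entryDeriv (Sum.inr x) F p = 0)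
    (hH : ∀ x, entryDeriv (Sum.inr x) H p = 0)
    (hφ : ∀ x, entryDeriv (Sum.inl x) F p = φ (Matrix.single x.1 x.2 1))
    (hψ : ∀ x, entryDeriv (Sum.inl x) H p = ψ (Matrix.single x.1 x.2 1)) :
    dualBracket F H p = Complex.I *
      (∑ a, ∑ c, rCoeff a c * (φ (Matrix.single a c 1 * p.1) * ψ (Matrix.single c a 1 * p.1)) -
      ∑ b, ∑ d, rCoeff d b * (φ (p.1 * Matrix.single d b 1) * ψ (p.1 * Matrix.single b d 1))) := by
  rw [dualBracket, ← sum_mul_rCommutator, Fintype.sum_sum_type]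
  simp only [Fintype.sum_sum_type, hF, hH, hφ, hψ, zero_mul, mul_zero, Finset.sum_const_zero,
    add_zero]
  rfl

theorem dualBracket_of_left_right {n : ℕ} {F H : MatPair n → ℂ} {p : MatPair n}
    {φ ψ : Matrix (Fin n) (Fin n) ℂ →ₗ[ℂ] ℂ} (hF : ∀ x, entryDeriv (Sum.inr x) F p = 0)
    (hH : ∀ x, entryDeriv (Sum.inl x) H p = 0)
    (hφ : ∀ x, entryDeriv (Sum.inl x) F p = φ (Matrix.single x.1 x.2 1))
    (hψ : ∀ x, entryDeriv (Sum.inr x) H p = ψ (Matrix.single x.1 x.2 1)) :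
    dualBracket F H p = Complex.I *
      (∑ a, ∑ c, rCoeff a c * (φ (Matrix.single a c 1 * p.1) * ψ (Matrix.single c a 1 * p.2)) -
      ∑ b, ∑ d, rCoeff d b * (φ (p.1 * Matrix.single d b 1) * ψ (p.2 * Matrix.single b d 1))) := by
  rw [dualBracket, ← sum_mul_rCommutator, Fintype.sum_sum_type]
  simp only [Fintype.sum_sum_type, hF, hH, hφ, hψ, zero_mul, mul_zero, Finset.sum_const_zero,
    add_zero, zero_add]
  rfl

theorem dualBracket_of_right_right {n : ℕ} {F H : MatPair n → ℂ} {p : MatPair n}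
    {φ ψ : Matrix (Fin n) (Fin n) ℂ →ₗ[ℂ] ℂ} (hF : ∀ x, entryDeriv (Sum.inl x) F p = 0)
    (hH : ∀ x, entryDeriv (Sum.inl x) H p = 0)
    (hφ : ∀ x, entryDeriv (Sum.inr x) F p = φ (Matrix.single x.1 x.2 1))
    (hψ : ∀ x, entryDeriv (Sum.inr x) H p = ψ (Matrix.single x.1 x.2 1)) :
    dualBracket F H p = Complex.I *
      (∑ a, ∑ c, rCoeff a c * (φ (Matrix.single a c 1 * p.2) * ψ (Matrix.single c a 1 * p.2)) -
      ∑ b, ∑ d, rCoeff d b * (φ (p.2 * Matrix.single d b 1) * ψ (p.2 * Matrix.single b d 1))) := by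
  rw [dualBracket, ← sum_mul_rCommutator, Fintype.sum_sum_type]
  simp only [Fintype.sum_sum_type, hF, hH, hφ, hψ, zero_mul, mul_zero, Finset.sum_const_zero,
    zero_add]
  rfl

/-- The brackets of two minors of `g`. -/
theorem dualBracket_left_left {n l q : ℕ} (e f : Fin l → Fin n) (e' f' : Fin q → Fin n)
    (p : MatPair n) :
    dualBracket (fun p => (p.1.submatrix e f).det) (fun p => (p.1.submatrix e' f').det) p =
      Complex.I * (∑ a, ∑ c, rCoeff a c * (minorDeriv p.1 e f (Matrix.single a c 1 * p.1) *
          minorDeriv p.1 e' f' (Matrix.single c a 1 * p.1)) -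
        ∑ b, ∑ d, rCoeff d b * (minorDeriv p.1 e f (p.1 * Matrix.single d b 1) *
          minorDeriv p.1 e' f' (p.1 * Matrix.single b d 1))) :=
  dualBracket_of_left_left
    (entryDeriv_right_of_left (fun g : Matrix (Fin n) (Fin n) ℂ => (g.submatrix e f).det) p)
    (entryDeriv_right_of_left (fun g : Matrix (Fin n) (Fin n) ℂ => (g.submatrix e' f').det) p)
    (entryDeriv_minor_left e f p) (entryDeriv_minor_left e' f' p)

/-- The brackets of a minor of `g` with a minor of `dualPart`. -/
theorem dualBracket_left_right {n l q : ℕ} (e f : Fin l → Fin n) (e' f' : Fin q → Fin n)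
    {p : MatPair n} (hp : IsUnit p.2) :
    dualBracket (fun p => (p.1.submatrix e f).det)
        (fun p => ((dualPart p).submatrix e' f').det) p =
      Complex.I * (∑ b, ∑ d, rCoeff d b * (minorDeriv p.1 e f (p.1 * Matrix.single d b 1) *
          minorDeriv (dualPart p) e' f' (dualPart p * Matrix.single d b 1)) -
        ∑ a, ∑ c, rCoeff a c * (minorDeriv p.1 e f (Matrix.single a c 1 * p.1) *
          minorDeriv (dualPart p) e' f' (Matrix.single a c 1 * dualPart p))) := by
  refine (dualBracket_of_left_right
    (entryDeriv_right_of_left (fun g : Matrix (Fin n) (Fin n) ℂ => (g.submatrix e f).det) p)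
    (entryDeriv_left_of_right (fun g : Matrix (Fin n) (Fin n) ℂ => ((g⁻¹)ᵀ.submatrix e' f').det) p)
    (entryDeriv_minor_left e f p) (entryDeriv_minor_right e' f' hp)).trans ?_
  simp only [dualMinorDeriv_single_mul _ _ hp, dualMinorDeriv_mul_single _ _ hp, mul_neg,
    Finset.sum_neg_distrib]
  ring

/-- The brackets of two minors of `dualPart`. -/
theorem dualBracket_right_right {n l q : ℕ} (e f : Fin l → Fin n) (e' f' : Fin q → Fin n)
    {p : MatPair n} (hp : IsUnit p.2) :
    dualBracket (fun p => ((dualPart p).submatrix e f).det)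
        (fun p => ((dualPart p).submatrix e' f').det) p =
      Complex.I * (∑ a, ∑ c, rCoeff a c *
          (minorDeriv (dualPart p) e f (Matrix.single c a 1 * dualPart p) *
          minorDeriv (dualPart p) e' f' (Matrix.single a c 1 * dualPart p)) -
        ∑ b, ∑ d, rCoeff d b *
          (minorDeriv (dualPart p) e f (dualPart p * Matrix.single b d 1) *
          minorDeriv (dualPart p) e' f' (dualPart p * Matrix.single d b 1))) := by
  refine (dualBracket_of_right_right
    (entryDeriv_left_of_right (fun g : Matrix (Fin n) (Fin n) ℂ => ((g⁻¹)ᵀ.submatrix e f).det) p)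
    (entryDeriv_left_of_right (fun g : Matrix (Fin n) (Fin n) ℂ => ((g⁻¹)ᵀ.submatrix e' f').det) p)
    (entryDeriv_minor_right e f hp) (entryDeriv_minor_right e' f' hp)).trans ?_
  simp only [dualMinorDeriv_single_mul _ _ hp, dualMinorDeriv_mul_single _ _ hp, mul_neg, neg_mul,
    neg_neg]

theorem dualBracket_swap {n : ℕ} (F H : Matrix (Fin n) (Fin n) ℂ → ℂ) (p : MatPair n) :
    dualBracket (fun p => H p.2) (fun p => F p.1) p =
      -dualBracket (fun p => F p.1) (fun p => H p.2) p := by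
  rw [dualBracket, dualBracket, Fintype.sum_sum_type, Fintype.sum_sum_type]
  simp only [Fintype.sum_sum_type, entryDeriv_right_of_left, entryDeriv_left_of_right, zero_mul,
    mul_zero, Finset.sum_const_zero, zero_add, add_zero, ← mul_neg, ← Finset.sum_neg_distrib]
  congr 1
  rw [Finset.sum_comm]
  refine Finset.sum_congr rfl fun x _ => Finset.sum_congr rfl fun y _ => ?_
  simp only [entryBracket]
  ring

/-! ## Brackets of solid minors -/

/-- The entries of a matrix, numbered from the last row and column. -/
def arr {n : ℕ} (M : Matrix (Fin n) (Fin n) ℂ) (x y : ℕ) : ℂ :=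
  if h : x < n ∧ y < n then M ⟨n - 1 - x, by omega⟩ ⟨n - 1 - y, by omega⟩ else 0

/-- Indices numbered from the end. -/
def revSeq {n l : ℕ} (r : Fin l → ℕ) (h : ∀ i, r i < n) (i : Fin l) : Fin n :=
  ⟨n - 1 - r i, by have := h i; omega⟩

theorem minorOf_arr {n l : ℕ} (M : Matrix (Fin n) (Fin n) ℂ) {r c : Fin l → ℕ}
    (hr : ∀ i, r i < n) (hc : ∀ i, c i < n) :
    minorOf (arr M) r c = (M.submatrix (revSeq r hr) (revSeq c hc)).det := by
  rw [minorOf]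
  congr 1
  ext i j
  simp [arr, revSeq, hr, hc]

theorem solidMinor_eq_solid {n : ℕ} (M : Matrix (Fin n) (Fin n) ℂ) {k l : ℕ} (hl : l ≤ k)
    (hk : k ≤ n) : solidMinor M k l hl hk = solid (arr M) k l := by
  rw [solid, minorOf_arr M (fun i => by simp only [solidSeq]; omega)
    (fun i => by simp only [initSeq]; omega), solidMinor,
    ← Matrix.det_submatrix_equiv_self Fin.revPerm, Matrix.submatrix_submatrix]
  congr 1
  ext i j
  simp only [Matrix.submatrix_apply, Function.comp_apply, Fin.revPerm_apply, revSeq, solidSeq,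
    initSeq, Fin.val_rev]
  congr 2 <;> omega

theorem revSeq_update {n l : ℕ} {r : Fin l → ℕ} (h : ∀ i, r i < n) (t : Fin l) (c : Fin n)
    (h' : ∀ i, Function.update r t (n - 1 - c) i < n) :
    Function.update (revSeq r h) t c = revSeq (Function.update r t (n - 1 - c)) h' := by
  ext i
  by_cases hi : i = t
  · subst hi; simp [revSeq]; omega
  · simp [revSeq, hi]

theorem update_lt {n l : ℕ} {r : Fin l → ℕ} (h : ∀ i, r i < n) (t : Fin l) {x : ℕ} (hx : x < n)
    (i : Fin l) : Function.update r t x i < n := by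
  by_cases hi : i = t
  · subst hi; simpa using hx
  · simpa [hi] using h i

/-- Numbering from the end reverses the order, so the two arguments change places. -/
theorem rCoeff_rev {n : ℕ} (x y : Fin n) :
    rCoeff x y = rCoeff (n - 1 - (y : ℕ)) (n - 1 - (x : ℕ)) := by
  simp only [rCoeff]
  have h1 : (x < y) ↔ (n - 1 - (y : ℕ) < n - 1 - (x : ℕ)) := by rw [Fin.lt_def]; omega
  have h2 : (x = y) ↔ (n - 1 - (y : ℕ) = n - 1 - (x : ℕ)) := by rw [Fin.ext_iff]; omega
  simp only [h1, h2]

theorem minorDeriv_single_mul_arr {n l : ℕ} (M : Matrix (Fin n) (Fin n) ℂ) {r c : Fin l → ℕ}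
    (hr : ∀ i, r i < n) (hc : ∀ i, c i < n) (a b : Fin n) :
    minorDeriv M (revSeq r hr) (revSeq c hc) (Matrix.single a b 1 * M) =
      ∑ i, if revSeq r hr i = a then
        minorOf (arr M) (Function.update r i (n - 1 - b)) c else 0 := by
  rw [minorDeriv_single_mul]
  refine Finset.sum_congr rfl fun i _ => ?_
  rw [revSeq_update hr i b (update_lt hr i (by omega)), minorOf_arr]

theorem minorDeriv_mul_single_arr {n l : ℕ} (M : Matrix (Fin n) (Fin n) ℂ) {r c : Fin l → ℕ}
    (hr : ∀ i, r i < n) (hc : ∀ i, c i < n) (d b : Fin n) :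
    minorDeriv M (revSeq r hr) (revSeq c hc) (M * Matrix.single d b 1) =
      ∑ j, if revSeq c hc j = b then
        minorOf (arr M) r (Function.update c j (n - 1 - d)) else 0 := by
  rw [minorDeriv_mul_single]
  refine Finset.sum_congr rfl fun i _ => ?_
  rw [revSeq_update hc i d (update_lt hc i (by omega)), minorOf_arr]

theorem sum_sum_sum_sum_comm {α β : Type*} [Fintype α] [Fintype β] {l q : ℕ}
    (F : α → β → Fin l → Fin q → ℂ) :
    ∑ a, ∑ c, ∑ i, ∑ j, F a c i j = ∑ i, ∑ j, ∑ a, ∑ c, F a c i j := by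
  have h1 : ∀ a, ∑ c, ∑ i, ∑ j, F a c i j = ∑ i, ∑ j, ∑ c, F a c i j := fun a => by
    rw [Finset.sum_comm]
    exact Finset.sum_congr rfl fun i _ => Finset.sum_comm
  rw [Finset.sum_congr rfl fun a _ => h1 a, Finset.sum_comm]
  exact Finset.sum_congr rfl fun i _ => Finset.sum_comm

/-- The pattern for two minors of the same matrix: opposite unit matrices act on the two factors,
and a row of the first changes places with a row of the second. -/
theorem sum_ite_mul_ite_swap {α : Type*} [Fintype α] [DecidableEq α] {l q : ℕ} (R : α → α → ℂ)
    (e : Fin l → α) (e' : Fin q → α) (u : Fin l → α → ℂ) (v : Fin q → α → ℂ) :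
    ∑ a, ∑ c, R a c * ((∑ i, if e i = a then u i c else 0) * ∑ i, if e' i = c then v i a else 0) =
      ∑ i, ∑ j, R (e i) (e' j) * (u i (e' j) * v j (e i)) := by
  simp only [Finset.sum_mul_sum]
  simp only [Finset.mul_sum]
  rw [sum_sum_sum_sum_comm]
  refine Finset.sum_congr rfl fun i _ => Finset.sum_congr rfl fun j _ => ?_
  rw [Finset.sum_eq_single (e i), Finset.sum_eq_single (e' j)]
  · simp
  · intro b _ hb; simp [hb.symm]
  · simp
  · intro b _ hb; simp [hb.symm]
  · simp

/-- The pattern for a minor of `g` and one of `dualPart`: the same unit matrix acts on both factors,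
so a common row (or column) is replaced by the same new one in both. -/
theorem sum_ite_mul_ite_same {α : Type*} [Fintype α] [DecidableEq α] {l q : ℕ} (R : α → α → ℂ)
    (e : Fin l → α) (e' : Fin q → α) (u : Fin l → α → ℂ) (v : Fin q → α → ℂ) :
    ∑ a, ∑ c, R a c * ((∑ i, if e i = a then u i c else 0) * ∑ i, if e' i = a then v i c else 0) =
      ∑ i, ∑ j, if e i = e' j then ∑ c, R (e i) c * (u i c * v j c) else 0 := by
  simp only [Finset.sum_mul_sum]
  simp only [Finset.mul_sum]
  rw [sum_sum_sum_sum_comm]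
  refine Finset.sum_congr rfl fun i _ => Finset.sum_congr rfl fun j _ => ?_
  rw [Finset.sum_eq_single (e i)]
  · by_cases h : e i = e' j
    · simp [h]
    · simp [h, Ne.symm h]
  · intro b _ hb; simp [hb.symm]
  · simp

theorem solidSeq_lt {n k l : ℕ} (hl : l ≤ k) (hk : k ≤ n) (i : Fin l) : solidSeq k l i < n := by
  simp only [solidSeq]; omega

theorem initSeq_lt {n l : ℕ} (hl : l ≤ n) (i : Fin l) : initSeq l i < n := by
  simp only [initSeq]; omega

theorem sum_fin_rev {n : ℕ} (F : ℕ → ℂ) : ∑ c : Fin n, F (n - 1 - c) = ∑ x ∈ Finset.range n, F x := by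
  rw [← Finset.sum_range_reflect, Finset.sum_range]

theorem rev_rev_seq {n l : ℕ} {r : Fin l → ℕ} (h : ∀ i, r i < n) (i : Fin l) :
    n - 1 - (revSeq r h i : ℕ) = r i := by
  have := h i
  simp only [revSeq]; omega

theorem revSeq_eq_iff {n l q : ℕ} {r : Fin l → ℕ} (h : ∀ i, r i < n) {r' : Fin q → ℕ}
    (h' : ∀ i, r' i < n) (i : Fin l) (j : Fin q) : revSeq r h i = revSeq r' h' j ↔ r i = r' j := by
  have := h i
  have := h' j
  simp only [revSeq, Fin.ext_iff]; omega

/-! ### Brackets of solid minors as sums over exchanges of rows and columns -/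

section
variable {n : ℕ} {k l p q : ℕ}

theorem solid_arr_eq (hl : l ≤ k) (hk : k ≤ n) (M : Matrix (Fin n) (Fin n) ℂ) :
    solid (arr M) k l = (M.submatrix (revSeq _ (solidSeq_lt hl hk))
      (revSeq _ (initSeq_lt (hl.trans hk)))).det := minorOf_arr _ _ _

theorem dualBracket_solid_left_left (hl : l ≤ k) (hk : k ≤ n) (hq : q ≤ p) (hp : p ≤ n)
    (P : MatPair n) :
    dualBracket (fun P => solid (arr P.1) k l) (fun P => solid (arr P.1) p q) P =
      Complex.I * (∑ i, ∑ j, rCoeff (solidSeq p q j) (solidSeq k l i) *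
          (rowRep (arr P.1) k l i (solidSeq p q j) * rowRep (arr P.1) p q j (solidSeq k l i)) -
        ∑ i : Fin l, ∑ j : Fin q, rCoeff (i : ℕ) (j : ℕ) *
          (colRep (arr P.1) k l i j * colRep (arr P.1) p q j i)) := by
  simp only [solid_arr_eq hl hk, solid_arr_eq hq hp]
  rw [dualBracket_left_left]
  simp only [minorDeriv_single_mul_arr, minorDeriv_mul_single_arr]
  rw [sum_ite_mul_ite_swap rCoeff, sum_ite_mul_ite_swap fun b d => rCoeff d b]
  simp only [rCoeff_rev (n := n), rev_rev_seq]
  rfl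

theorem dualBracket_solid_right_right (hl : l ≤ k) (hk : k ≤ n) (hq : q ≤ p) (hp : p ≤ n)
    {P : MatPair n} (hP : IsUnit P.2) :
    dualBracket (fun P => solid (arr (dualPart P)) k l) (fun P => solid (arr (dualPart P)) p q) P =
      Complex.I * (∑ i, ∑ j, rCoeff (solidSeq k l i) (solidSeq p q j) *
          (rowRep (arr (dualPart P)) k l i (solidSeq p q j) *
            rowRep (arr (dualPart P)) p q j (solidSeq k l i)) -
        ∑ i : Fin l, ∑ j : Fin q, rCoeff (j : ℕ) (i : ℕ) *
          (colRep (arr (dualPart P)) k l i j * colRep (arr (dualPart P)) p q j i)) := by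
  simp only [solid_arr_eq hl hk, solid_arr_eq hq hp]
  rw [dualBracket_right_right _ _ _ _ hP]
  simp only [minorDeriv_single_mul_arr, minorDeriv_mul_single_arr]
  rw [Finset.sum_comm, sum_ite_mul_ite_swap fun b d => rCoeff d b, Finset.sum_comm (s := Finset.univ)
    (t := Finset.univ) (f := fun b d : Fin n => rCoeff d b * _), sum_ite_mul_ite_swap rCoeff]
  simp only [rCoeff_rev (n := n), rev_rev_seq]
  rfl

theorem dualBracket_solid_left_right (hl : l ≤ k) (hk : k ≤ n) (hq : q ≤ p) (hp : p ≤ n)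
    {P : MatPair n} (hP : IsUnit P.2) :
    dualBracket (fun P => solid (arr P.1) k l) (fun P => solid (arr (dualPart P)) p q) P =
      Complex.I * (∑ i : Fin l, ∑ j : Fin q, (if (i : ℕ) = j then ∑ y ∈ Finset.range n,
          rCoeff (i : ℕ) y * (colRep (arr P.1) k l i y * colRep (arr (dualPart P)) p q j y) else 0) -
        ∑ i, ∑ j, (if solidSeq k l i = solidSeq p q j then ∑ x ∈ Finset.range n,
          rCoeff x (solidSeq k l i) *
            (rowRep (arr P.1) k l i x * rowRep (arr (dualPart P)) p q j x) else 0)) := by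
  simp only [solid_arr_eq hl hk, solid_arr_eq hq hp]
  rw [dualBracket_left_right _ _ _ _ hP]
  simp only [minorDeriv_single_mul_arr, minorDeriv_mul_single_arr]
  rw [sum_ite_mul_ite_same rCoeff, sum_ite_mul_ite_same fun b d => rCoeff d b]
  simp only [rCoeff_rev (n := n), rev_rev_seq, revSeq_eq_iff, ← sum_fin_rev (n := n)]
  rfl

/-- The number of common rows of two solid minors. -/
def overlap (k l p q : ℕ) : ℕ := min k p - max (k - l) (p - q)

theorem sum_solidSeq_eq (hl : l ≤ k) (hq : q ≤ p) :
    ∑ i : Fin l, ∑ j : Fin q, (if solidSeq k l i = solidSeq p q j then (1 : ℂ) else 0) =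
      overlap k l p q := by
  have h1 : ∀ i : Fin l, ∑ j : Fin q, (if solidSeq k l i = solidSeq p q j then (1 : ℂ) else 0) =
      if k - l + i ∈ Finset.Ico (p - q) p then 1 else 0 := by
    intro i
    split_ifs with h
    · rw [Finset.mem_Ico] at h
      rw [Finset.sum_eq_single ⟨k - l + i - (p - q), by omega⟩]
      · rw [if_pos (by simp only [solidSeq]; omega)]
      · intro j _ hj
        rw [if_neg]
        intro h'
        simp only [solidSeq] at h'
        exact hj (by ext; simp only; omega)
      · simp
    · rw [Finset.mem_Ico] at h
      refine Finset.sum_eq_zero fun j _ => if_neg fun h' => h ?_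
      simp only [solidSeq] at h'
      omega
  rw [Finset.sum_congr rfl fun i _ => h1 i,
    Fin.sum_univ_eq_sum_range (fun i => if k - l + i ∈ Finset.Ico (p - q) p then (1 : ℂ) else 0) l,
    Finset.sum_boole, overlap, ← Nat.card_Ico (max (k - l) (p - q))]
  congr 1
  refine Finset.card_bij (fun i _ => k - l + i) ?_ ?_ ?_
  · intro i hi
    simp only [Finset.mem_filter, Finset.mem_range, Finset.mem_Ico] at hi ⊢
    omega
  · intro i _ j _ h
    omega
  · intro b hb
    simp only [Finset.mem_filter, Finset.mem_range, Finset.mem_Ico] at hb ⊢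
    exact ⟨b - (k - l), by omega, by omega⟩

theorem sum_fin_eq_fin (l q : ℕ) :
    ∑ i : Fin l, ∑ j : Fin q, (if (i : ℕ) = j then (1 : ℂ) else 0) = (min l q : ℕ) := by
  have h := sum_solidSeq_eq (k := l) (l := l) (p := q) (q := q) le_rfl le_rfl
  simp only [solidSeq, Nat.sub_self, zero_add, overlap, max_self, Nat.sub_zero] at h
  exact h

/-- Expanded along the exchanged row, `rowRep a p q j x` is a combination of the entries `a x m`
with `m < q`, with coefficients that do not depend on `x`. Since `q ≤ l`, these columns also belong
to the other minor, and Cramer's rule applies to each of them. -/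
theorem sum_rowRep_mul_rowRep (a : ℕ → ℕ → ℂ) (hq : q ≤ l) (j : Fin q)
    (x : ℕ) : ∑ i, rowRep a k l i x * rowRep a p q j (solidSeq k l i) =
      solid a k l * rowRep a p q j x := by
  have h : ∀ x, ∃ w : Fin q → ℂ, w = (Matrix.of fun i j => a (solidSeq p q i) (initSeq q j))ᵀ.adjugate j ∧
      rowRep a p q j x = ∑ m : Fin q, w m * a x m := by
    intro x
    refine ⟨_, rfl, ?_⟩
    rw [rowRep, minorOf_update_row, ← Matrix.cramer_transpose_apply,
      Matrix.cramer_eq_adjugate_mulVec]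
    rfl
  obtain ⟨w, hw, -⟩ := h 0
  have h' : ∀ x, rowRep a p q j x = ∑ m : Fin q, w m * a x m := fun x => by
    obtain ⟨w', hw', h1⟩ := h x
    rw [h1, hw', hw]
  simp only [h', Finset.mul_sum]
  rw [Finset.sum_comm]
  refine Finset.sum_congr rfl fun m _ => ?_
  have h2 : ∑ i, rowRep a k l i x * a (solidSeq k l i) m = solid a k l * a x m :=
    sum_minorOf_update_row a (solidSeq k l) (initSeq l) x ⟨m, by omega⟩
  rw [mul_left_comm, ← h2, Finset.mul_sum]
  exact Finset.sum_congr rfl fun i _ => by ring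

/-- The sum over all exchanges of a row of one solid minor with a row of another one. -/
theorem sum_exchange (a : ℕ → ℕ → ℂ) (k l p q : ℕ) :
    ∑ i, ∑ j, rowRep a k l i (solidSeq p q j) * rowRep a p q j (solidSeq k l i) =
      (min l q : ℕ) * (solid a k l * solid a p q) := by
  rcases le_total q l with h | h
  · rw [Finset.sum_comm, Finset.sum_congr rfl fun j _ => sum_rowRep_mul_rowRep a h j _]
    simp [rowRep_self, h]
  · rw [Finset.sum_congr rfl fun i _ => Finset.sum_congr rfl fun j _ => mul_comm _ _,
      Finset.sum_congr rfl fun j _ => sum_rowRep_mul_rowRep a h j _]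
    simp [rowRep_self, h, mul_comm (solid a p q)]

/-- An exchange that repeats a row vanishes. Apart from common rows, only rows that belong to one of
the two intervals and not to the other can be exchanged. If such rows exist on both sides, those of
one interval all lie on the same side of those of the other, so `rCoeff` is constantly 1 or
constantly 0 on them. The sum is then the unweighted `sum_exchange`, or zero, corrected on the
common rows, where the weight is 1/2. -/
theorem sum_rCoeff_rowRep (a : ℕ → ℕ → ℂ) (hl : l ≤ k) (hq : q ≤ p) :
    ∑ i, ∑ j, rCoeff (solidSeq p q j) (solidSeq k l i) *
        (rowRep a k l i (solidSeq p q j) * rowRep a p q j (solidSeq k l i)) =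
      (overlap k l p q / 2 + if p ≤ k ∧ p - q ≤ k - l then
        ((min l q : ℕ) : ℂ) - overlap k l p q else 0) * (solid a k l * solid a p q) := by
  have key : ∀ i j, rCoeff (solidSeq p q j) (solidSeq k l i) *
        (rowRep a k l i (solidSeq p q j) * rowRep a p q j (solidSeq k l i)) =
      (if p ≤ k ∧ p - q ≤ k - l then (1 : ℂ) else 0) *
        (rowRep a k l i (solidSeq p q j) * rowRep a p q j (solidSeq k l i)) +
      (if p ≤ k ∧ p - q ≤ k - l then (-1 / 2 : ℂ) else 1 / 2) * (solid a k l * solid a p q) *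
        (if solidSeq k l i = solidSeq p q j then (1 : ℂ) else 0) := by
    intro i j
    by_cases h : solidSeq k l i = solidSeq p q j
    · rw [h, rowRep_self, ← h, rowRep_self]
      simp only [rCoeff, lt_irrefl, if_false, if_true]
      split_ifs <;> ring
    · by_cases h1 : k - l ≤ solidSeq p q j ∧ solidSeq p q j < k - l + l
      · rw [rowRep_eq_zero i h1.1 h1.2 (Ne.symm h)]
        simp [h]
      by_cases h2 : p - q ≤ solidSeq k l i ∧ solidSeq k l i < p - q + q
      · rw [rowRep_eq_zero j h2.1 h2.2 h]
        simp [h]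
      have e : rCoeff (solidSeq p q j) (solidSeq k l i) =
          if p ≤ k ∧ p - q ≤ k - l then (1 : ℂ) else 0 := by
        simp only [rCoeff, if_neg (Ne.symm h)]
        simp only [solidSeq] at *
        refine if_congr ?_ rfl rfl
        omega
      rw [e]
      simp [h]
  simp only [key, Finset.sum_add_distrib, ← Finset.mul_sum]
  rw [sum_exchange, sum_solidSeq_eq hl hq]
  split_ifs <;> ring

/-- The column sets are nested initial segments, so every exchange of two different columns repeats
a column in one of the minors. Only the weight 1/2 on common columns remains. -/
theorem sum_rCoeff_colRep (a : ℕ → ℕ → ℂ) :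
    ∑ i : Fin l, ∑ j : Fin q, rCoeff (i : ℕ) (j : ℕ) * (colRep a k l i j * colRep a p q j i) =
      ((min l q : ℕ) : ℂ) / 2 * (solid a k l * solid a p q) := by
  have key : ∀ (i : Fin l) (j : Fin q), rCoeff (i : ℕ) (j : ℕ) *
      (colRep a k l i j * colRep a p q j i) =
      1 / 2 * (solid a k l * solid a p q) * (if (i : ℕ) = j then (1 : ℂ) else 0) := by
    intro i j
    by_cases h : (i : ℕ) = j
    · rw [h, ← h, colRep_self', h, colRep_self']
      simp [rCoeff]
    · rcases le_total l q with h' | h'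
      · rw [colRep_eq_zero_of_lt j (by omega) h]
        simp [h]
      · rw [colRep_eq_zero_of_lt i (by omega) (Ne.symm h)]
        simp [h]
  simp only [key, ← Finset.mul_sum, sum_fin_eq_fin]
  ring

/-- Solid minors of `g` have log-canonical brackets. -/
theorem dualBracket_left_left_eq (hl : l ≤ k) (hk : k ≤ n) (hq : q ≤ p) (hp : p ≤ n)
    (P : MatPair n) :
    dualBracket (fun P => solid (arr P.1) k l) (fun P => solid (arr P.1) p q) P =
      Complex.I * (((if p ≤ k ∧ p - q ≤ k - l then 1 else 0) - 1 / 2) *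
        (((min l q : ℕ) : ℂ) - overlap k l p q)) * (solid (arr P.1) k l * solid (arr P.1) p q) := by
  rw [dualBracket_solid_left_left hl hk hq hp, sum_rCoeff_rowRep _ hl hq, sum_rCoeff_colRep]
  split_ifs <;> ring

theorem overlap_comm (k l p q : ℕ) : overlap k l p q = overlap p q k l := by
  rw [overlap, overlap, min_comm, max_comm]

theorem dualBracket_right_right_eq (hl : l ≤ k) (hk : k ≤ n) (hq : q ≤ p) (hp : p ≤ n)
    {P : MatPair n} (hP : IsUnit P.2) :
    dualBracket (fun P => solid (arr (dualPart P)) k l) (fun P => solid (arr (dualPart P)) p q) P =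
      Complex.I * (((if k ≤ p ∧ k - l ≤ p - q then 1 else 0) - 1 / 2) *
        (((min l q : ℕ) : ℂ) - overlap k l p q)) *
          (solid (arr (dualPart P)) k l * solid (arr (dualPart P)) p q) := by
  have h1 := sum_rCoeff_rowRep (arr (dualPart P)) hq hl
  have h2 := sum_rCoeff_colRep (k := p) (l := q) (p := k) (q := l) (arr (dualPart P))
  rw [Finset.sum_comm] at h1 h2
  simp only [mul_comm (rowRep _ p _ _ _)] at h1
  simp only [mul_comm (colRep _ p _ _ _)] at h2
  rw [dualBracket_solid_right_right hl hk hq hp hP, h1, h2, overlap_comm p q, min_comm q l]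
  split_ifs <;> ring

/-- The bracket of solid minors of `g` and of `dualPart`. -/
theorem dualBracket_left_right_eq (hl : l ≤ k) (hk : k ≤ n) (hq : q ≤ p) (hp : p ≤ n)
    {P : MatPair n} (hP : IsUnit P.2) :
    dualBracket (fun P => solid (arr P.1) k l) (fun P => solid (arr (dualPart P)) p q) P =
      Complex.I * ((((min l q : ℕ) : ℂ) - overlap k l p q) / 2 *
          (solid (arr P.1) k l * solid (arr (dualPart P)) p q) +
        ∑ i : Fin l, ∑ j : Fin q, (if (i : ℕ) = j then ∑ y ∈ Finset.range n,
          (if l ≤ y ∧ q ≤ y then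
            colRep (arr P.1) k l i y * colRep (arr (dualPart P)) p q j y else 0) else 0) -
        ∑ i, ∑ j, (if solidSeq k l i = solidSeq p q j then ∑ x ∈ Finset.range n,
          (if x < k - l ∧ x < p - q then
            rowRep (arr P.1) k l i x * rowRep (arr (dualPart P)) p q j x else 0) else 0)) := by
  rw [dualBracket_solid_left_right hl hk hq hp hP]
  set A := arr P.1
  set B := arr (dualPart P)
  -- A new column `y` different from the common column `i` contributes only if it lies outside both
  -- initial segments; then `i < y` and the weight is 1. The term `y = i` has weight 1/2.
  have hc : ∀ (i : Fin l) (j : Fin q), (if (i : ℕ) = j then ∑ y ∈ Finset.range n,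
      rCoeff (i : ℕ) y * (colRep A k l i y * colRep B p q j y) else 0) =
      (if (i : ℕ) = j then ∑ y ∈ Finset.range n, (if l ≤ y ∧ q ≤ y then
        colRep A k l i y * colRep B p q j y else 0) else 0) +
      1 / 2 * (solid A k l * solid B p q) * (if (i : ℕ) = j then 1 else 0) := by
    intro i j
    split_ifs with h
    · rw [← Finset.add_sum_erase _ _ (Finset.mem_range.2 (show (i : ℕ) < n by omega)),
        ← Finset.add_sum_erase _ _ (Finset.mem_range.2 (show (i : ℕ) < n by omega)), colRep_self', h,
        colRep_self', if_neg (by omega)]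
      rw [Finset.sum_congr rfl (g := fun y => if l ≤ y ∧ q ≤ y then
        colRep A k l i y * colRep B p q j y else 0)]
      · simp [rCoeff]; ring
      · intro y hy
        rw [← h, Finset.mem_erase] at hy
        by_cases h1 : y < l
        · rw [colRep_eq_zero_of_lt i h1 hy.1]; simp
        by_cases h2 : y < q
        · rw [colRep_eq_zero_of_lt j h2 (by omega)]; simp
        rw [if_pos (by omega), rCoeff, if_pos (by omega), one_mul]
    · simp
  -- A new row contributes only if it lies outside both intervals. If its index exceeds that of the
  -- common row the weight is 0; otherwise it precedes both intervals and the weight is 1.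
  have hr : ∀ (i : Fin l) (j : Fin q), (if solidSeq k l i = solidSeq p q j then
      ∑ x ∈ Finset.range n, rCoeff x (solidSeq k l i) * (rowRep A k l i x * rowRep B p q j x) else 0) =
      (if solidSeq k l i = solidSeq p q j then ∑ x ∈ Finset.range n, (if x < k - l ∧ x < p - q then
        rowRep A k l i x * rowRep B p q j x else 0) else 0) +
      1 / 2 * (solid A k l * solid B p q) * (if solidSeq k l i = solidSeq p q j then 1 else 0) := by
    intro i j
    split_ifs with h
    · have hi := solidSeq_lt hl hk i
      have e1 : ¬ (solidSeq k l i < k - l ∧ solidSeq k l i < p - q) := by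
        simp only [solidSeq]; omega
      rw [← Finset.add_sum_erase _ _ (Finset.mem_range.2 hi),
        ← Finset.add_sum_erase _ _ (Finset.mem_range.2 hi), rowRep_self, if_neg e1]
      rw [Finset.sum_congr rfl (g := fun x => if x < k - l ∧ x < p - q then
        rowRep A k l i x * rowRep B p q j x else 0)]
      · rw [h, rowRep_self]
        simp [rCoeff]; ring
      · intro x hx
        rw [Finset.mem_erase] at hx
        by_cases h1 : k - l ≤ x ∧ x < k - l + l
        · rw [rowRep_eq_zero i h1.1 h1.2 hx.1]; simp
        by_cases h2 : p - q ≤ x ∧ x < p - q + q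
        · rw [rowRep_eq_zero j h2.1 h2.2 (h ▸ hx.1)]; simp
        simp only [rCoeff, if_neg hx.1]
        by_cases h3 : x < k - l ∧ x < p - q
        · rw [if_pos h3, if_pos (by simp only [solidSeq]; omega), one_mul]
        · rw [if_neg h3, if_neg (by simp only [solidSeq] at *; omega), zero_mul]
    · simp
  simp only [hc, hr, Finset.sum_add_distrib, ← Finset.mul_sum]
  rw [sum_fin_eq_fin, sum_solidSeq_eq hl hq]
  ring

end

/-! ## Laurent polynomials on a chart -/

section Laurent
variable {ι κ : Type*}

theorem chartValues_ne_zero {v : ι ⊕ κ ⊕ κ → ℂ} (hv : v ∈ chartValues ι κ) (r : ι ⊕ κ ⊕ κ) :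
    v r ≠ 0 := by
  obtain ⟨h1, h2, h3⟩ := hv
  rcases r with i | a | a
  · intro h
    have := h2 i
    rw [h] at this
    simp at this
  · exact h3 a
  · have := h1 (Sum.inr (Sum.inl a))
    simp only [conjIdx] at this
    rw [this]
    simpa using h3 a

/-- Logarithmic coordinates on the chart. -/
def logPoint (u : (ι → ℝ) × (κ → ℂ)) : ι ⊕ κ ⊕ κ → ℂ
  | Sum.inl i => u.1 i
  | Sum.inr (Sum.inl a) => u.2 a
  | Sum.inr (Sum.inr a) => (starRingEnd ℂ) (u.2 a)

theorem exp_logPoint_mem (u : (ι → ℝ) × (κ → ℂ)) :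
    (fun r => Complex.exp (logPoint u r)) ∈ chartValues ι κ := by
  refine ⟨?_, fun i => ?_, fun a => Complex.exp_ne_zero _⟩
  · rintro (i | a | a)
    · simp only [conjIdx, logPoint, ← Complex.exp_conj, Complex.conj_ofReal]
    · simp only [conjIdx, logPoint, ← Complex.exp_conj]
    · simp only [conjIdx, logPoint, ← Complex.exp_conj, Complex.conj_conj]
  · simp only [logPoint]
    rw [← Complex.ofReal_exp, Complex.ofReal_re]
    exact Real.exp_pos _

variable [Fintype ι] [Fintype κ]

/-- Laurent monomials at a point with non-zero coordinates, as a character of the exponents. -/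
def monomialHom (v : ι ⊕ κ ⊕ κ → ℂ) (hv : ∀ r, v r ≠ 0) : Multiplicative (ι ⊕ κ ⊕ κ → ℤ) →* ℂ where
  toFun m := ∏ r, v r ^ (m.toAdd r)
  map_one' := by simp
  map_mul' a b := by
    simp only [toAdd_mul, Pi.add_apply]
    rw [← Finset.prod_mul_distrib]
    exact Finset.prod_congr rfl fun r _ => zpow_add₀ (hv r) _ _

theorem ChartLaurent.eval_eq_lift (p : ChartLaurent ι κ) {v : ι ⊕ κ ⊕ κ → ℂ} (hv : ∀ r, v r ≠ 0) :
    p.eval v = AddMonoidAlgebra.lift ℂ ℂ (ι ⊕ κ ⊕ κ → ℤ) (monomialHom v hv) p := by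
  rw [AddMonoidAlgebra.lift_apply]
  rfl

theorem ChartLaurent.eval_add (p q : ChartLaurent ι κ) {v : ι ⊕ κ ⊕ κ → ℂ} (hv : ∀ r, v r ≠ 0) :
    (p + q).eval v = p.eval v + q.eval v := by
  simp only [eval_eq_lift _ hv, map_add]

theorem ChartLaurent.eval_mul (p q : ChartLaurent ι κ) {v : ι ⊕ κ ⊕ κ → ℂ} (hv : ∀ r, v r ≠ 0) :
    (p * q).eval v = p.eval v * q.eval v := by
  simp only [eval_eq_lift _ hv, map_mul]

theorem ChartLaurent.eval_single (m : ι ⊕ κ ⊕ κ → ℤ) (c : ℂ) (v : ι ⊕ κ ⊕ κ → ℂ) :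
    ChartLaurent.eval (AddMonoidAlgebra.single m c) v = c * ∏ r, v r ^ m r := by
  rw [ChartLaurent.eval, AddMonoidAlgebra.coeff_single, Finsupp.sum_single_index]
  simp

theorem ChartLaurent.eval_zero (v : ι ⊕ κ ⊕ κ → ℂ) : (0 : ChartLaurent ι κ).eval v = 0 := by
  simp [ChartLaurent.eval]

/-- The character of the logarithmic coordinates given by a monomial. -/
def logChar (m : ι ⊕ κ ⊕ κ → ℤ) : Multiplicative ((ι → ℝ) × (κ → ℂ)) →* ℂ where
  toFun u := Complex.exp (∑ r, m r * logPoint u.toAdd r)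
  map_one' := by
    rw [Finset.sum_eq_zero, Complex.exp_zero]
    rintro (i | a | a) - <;> simp [logPoint]
  map_mul' a b := by
    rw [← Complex.exp_add, ← Finset.sum_add_distrib]
    congr 1
    refine Finset.sum_congr rfl ?_
    rintro (i | c | c) - <;> simp [logPoint, mul_add]

theorem eq_zero_of_exp_mul_eq_one {d : ℂ} (h : ∀ s : ℝ, Complex.exp (s * d) = 1) : d = 0 := by
  have h1 : d.re = 0 := by
    have := congrArg norm (h 1)
    rw [Complex.norm_exp] at this
    simpa using this
  by_contra hd
  have h2 : d.im ≠ 0 := fun h2 => hd (Complex.ext h1 h2)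
  have h3 := h (Real.pi / d.im)
  have h4 : ((Real.pi / d.im : ℝ) : ℂ) * d = Real.pi * Complex.I := by
    apply Complex.ext
    · simp [h1]
    · simp [h2]
  rw [h4, Complex.exp_pi_mul_I] at h3
  norm_num at h3

/-- Along real one-parameter subgroups, equality of two characters forces equality of their
exponents as real-linear forms. Testing a complex coordinate at 1 and at i then separates the
exponent of z from that of its conjugate. -/
theorem logChar_injective [DecidableEq ι] [DecidableEq κ] :
    Function.Injective (logChar : (ι ⊕ κ ⊕ κ → ℤ) → _) := by
  intro m m' h
  have h1 : ∀ u : (ι → ℝ) × (κ → ℂ), ∑ r, (m r - m' r) * logPoint u r = 0 := by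
    intro u
    refine eq_zero_of_exp_mul_eq_one fun s => ?_
    have h2 := DFunLike.congr_fun h (Multiplicative.ofAdd (s • u))
    change Complex.exp (∑ r, m r * logPoint (s • u) r) =
      Complex.exp (∑ r, m' r * logPoint (s • u) r) at h2
    have h3 : ∀ r, logPoint (s • u) r = s * logPoint u r := by
      rintro (i | a | a) <;> simp [logPoint]
    have h4 : (s : ℂ) * ∑ r, ((m r : ℂ) - m' r) * logPoint u r =
        ∑ r, m r * logPoint (s • u) r - ∑ r, m' r * logPoint (s • u) r := by
      rw [← Finset.sum_sub_distrib, Finset.mul_sum]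
      exact Finset.sum_congr rfl fun r _ => by rw [h3]; ring
    rw [h4, Complex.exp_sub, h2, div_self (Complex.exp_ne_zero _)]
  have h5 : ∀ a (w : ℂ), ((m (Sum.inr (Sum.inl a)) : ℂ) - m' (Sum.inr (Sum.inl a))) * w +
      ((m (Sum.inr (Sum.inr a)) : ℂ) - m' (Sum.inr (Sum.inr a))) * (starRingEnd ℂ) w = 0 := by
    intro a w
    have := h1 (0, Pi.single a w)
    simpa [Fintype.sum_sum_type, logPoint, Pi.single_apply, apply_ite (starRingEnd ℂ)] using this
  ext r
  rcases r with i | a | a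
  · have := h1 (Pi.single i 1, 0)
    simp [Fintype.sum_sum_type, logPoint, Pi.single_apply, apply_ite ((↑) : ℝ → ℂ)] at this
    exact_mod_cast sub_eq_zero.1 this
  · have e1 := h5 a 1
    have e2 := h5 a Complex.I
    simp only [map_one, Complex.conj_I] at e1 e2
    have : ((m (Sum.inr (Sum.inl a)) : ℂ) - m' (Sum.inr (Sum.inl a))) = 0 := by
      linear_combination e1 / 2 - Complex.I * e2 / 2 + (Complex.I_mul_I) / 2 *
        (((m (Sum.inr (Sum.inl a)) : ℂ) - m' (Sum.inr (Sum.inl a))) -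
          ((m (Sum.inr (Sum.inr a)) : ℂ) - m' (Sum.inr (Sum.inr a))))
    exact_mod_cast sub_eq_zero.1 this
  · have e1 := h5 a 1
    have e2 := h5 a Complex.I
    simp only [map_one, Complex.conj_I] at e1 e2
    have : ((m (Sum.inr (Sum.inr a)) : ℂ) - m' (Sum.inr (Sum.inr a))) = 0 := by
      linear_combination e1 / 2 + Complex.I * e2 / 2 - (Complex.I_mul_I) / 2 *
        (((m (Sum.inr (Sum.inl a)) : ℂ) - m' (Sum.inr (Sum.inl a))) -
          ((m (Sum.inr (Sum.inr a)) : ℂ) - m' (Sum.inr (Sum.inr a))))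
    exact_mod_cast sub_eq_zero.1 this

/-- A Laurent polynomial is determined by its values on the chart. -/
theorem ChartLaurent.ext_of_eval {p q : ChartLaurent ι κ}
    (h : ∀ v ∈ chartValues ι κ, p.eval v = q.eval v) : p = q := by
  classical
  have key : ∀ d : ChartLaurent ι κ, (∀ v ∈ chartValues ι κ, d.eval v = 0) → d = 0 := by
    intro d hd
    -- Dedekind's independence of characters: in logarithmic coordinates a Laurent polynomial is a
    -- linear combination of distinct characters.
    have li := (linearIndependent_monoidHom (Multiplicative ((ι → ℝ) × (κ → ℂ))) ℂ).comp
      (logChar : (ι ⊕ κ ⊕ κ → ℤ) → _) logChar_injective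
    rw [linearIndependent_iff] at li
    refine AddMonoidAlgebra.coeff_eq_zero.1 (li d.coeff ?_)
    ext u
    have := hd _ (exp_logPoint_mem u.toAdd)
    rw [Finsupp.linearCombination_apply, Finsupp.sum, Finset.sum_apply, Pi.zero_apply, ← this,
      ChartLaurent.eval, Finsupp.sum]
    refine Finset.sum_congr rfl fun m _ => ?_
    rw [Pi.smul_apply, smul_eq_mul]
    congr 1
    change Complex.exp _ = _
    rw [Complex.exp_sum]
    exact Finset.prod_congr rfl fun r _ => by rw [← Complex.exp_int_mul]
  rw [← sub_eq_zero]
  refine key _ fun v hv => ?_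
  have h0 := chartValues_ne_zero hv
  have := h v hv
  rw [eval_eq_lift _ h0] at this ⊢
  rw [eval_eq_lift _ h0] at this
  rw [map_sub, this, sub_self]

end Laurent

/-! ## The chart of solid minors -/

section
variable {n : ℕ}

theorem arr_map_star (M : Matrix (Fin n) (Fin n) ℂ) (x y : ℕ) :
    arr (M.map (starRingEnd ℂ)) x y = (starRingEnd ℂ) (arr M x y) := by
  simp only [arr]
  split_ifs <;> simp

theorem solid_arr_map_star (M : Matrix (Fin n) (Fin n) ℂ) (k l : ℕ) :
    solid (arr (M.map (starRingEnd ℂ))) k l = (starRingEnd ℂ) (solid (arr M) k l) := by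
  rw [solid, minorOf, solid, minorOf, RingHom.map_det]
  congr 1
  ext i j
  simp [arr_map_star]

theorem isUnit_fst {p : MatPair n} (hp : p ∈ dualUnitaryGroup n) : IsUnit p.1 := by
  rw [Matrix.isUnit_iff_isUnit_det, Matrix.det_of_isUpperTriangular (fun i j h => hp.1 i j h),
    isUnit_iff_ne_zero, Finset.prod_ne_zero_iff]
  exact fun i _ => left_ne_zero_of_mul_eq_one (hp.2.2.1 i)

theorem isUnit_snd {p : MatPair n} (hp : p ∈ dualUnitaryGroup n) : IsUnit p.2 := by
  rw [Matrix.isUnit_iff_isUnit_det, Matrix.det_of_isLowerTriangular p.2 (fun i j h => hp.2.1 i j h),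
    isUnit_iff_ne_zero, Finset.prod_ne_zero_iff]
  exact fun i _ => right_ne_zero_of_mul_eq_one (hp.2.2.1 i)

theorem snd_eq {p : MatPair n} (hp : p ∈ dualUnitaryGroup n) : p.2 = (p.1⁻¹)ᴴ := by
  rw [← hp.2.2.2, Matrix.conjTranspose_conjTranspose]

/-- On the real form, `dualPart` is the complex conjugate of `g`. -/
theorem dualPart_eq {p : MatPair n} (hp : p ∈ dualUnitaryGroup n) :
    dualPart p = p.1.map (starRingEnd ℂ) := by
  have h := (Matrix.isUnit_iff_isUnit_det _).1 (isUnit_fst hp)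
  rw [dualPart, snd_eq hp, ← Matrix.conjTranspose_nonsing_inv, Matrix.nonsing_inv_nonsing_inv _ h]
  rfl

/-- The diagonal of the product of the triangular matrices `g` and f* = g⁻¹ shows that the conjugate
of f_ii inverts g_ii; so does f_ii itself. -/
theorem conj_diag {p : MatPair n} (hp : p ∈ dualUnitaryGroup n) (i : Fin n) :
    (starRingEnd ℂ) (p.1 i i) = p.1 i i := by
  have h := (Matrix.isUnit_iff_isUnit_det _).1 (isUnit_fst hp)
  have h1 : p.1 * p.2ᴴ = 1 := by rw [hp.2.2.2, Matrix.mul_nonsing_inv _ h]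
  have h2 := congrFun (congrFun h1 i) i
  rw [Matrix.mul_apply, Finset.sum_eq_single i] at h2
  · rw [Matrix.one_apply_eq, Matrix.conjTranspose_apply] at h2
    have h3 := hp.2.2.1 i
    have h4 := congrArg (starRingEnd ℂ) h3
    rw [map_mul, map_one] at h4
    have h5 : (starRingEnd ℂ) (p.2 i i) = star (p.2 i i) := rfl
    rw [← h5] at h2
    exact mul_right_cancel₀ (right_ne_zero_of_mul_eq_one h2) (h4.trans h2.symm)
  · intro j _ hj
    rcases lt_or_gt_of_ne hj with h' | h'
    · rw [hp.1 i j h', zero_mul]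
    · rw [Matrix.conjTranspose_apply, hp.2.1 i j h', star_zero, mul_zero]
  · simp

theorem arr_eq_zero {M : Matrix (Fin n) (Fin n) ℂ} (hM : ∀ i j, j < i → M i j = 0) {x y : ℕ}
    (h : x < y) : arr M x y = 0 := by
  simp only [arr]
  split_ifs with h'
  · exact hM _ _ (by rw [Fin.lt_def]; simp only; omega)
  · rfl

theorem solid_full {a : ℕ → ℕ → ℂ} (ha : ∀ x y, x < y → a x y = 0) (k : ℕ) :
    solid a k k = ∏ x ∈ Finset.range k, a x x := by
  rw [solid, minorOf, Matrix.det_of_isLowerTriangular _ (fun i j h => ?_), Finset.prod_range]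
  · simp [solidSeq, initSeq]
  · have : i < j := h
    exact ha _ _ (by simp [solidSeq, initSeq]; exact this)

theorem conj_solid_full {p : MatPair n} (hp : p ∈ dualUnitaryGroup n) (k : ℕ) :
    (starRingEnd ℂ) (solid (arr p.1) k k) = solid (arr p.1) k k := by
  rw [solid_full (fun x y h => arr_eq_zero hp.1 h), map_prod]
  refine Finset.prod_congr rfl fun x _ => ?_
  simp only [arr]
  split_ifs
  · exact conj_diag hp _
  · simp

/-- The coordinate which belongs to a solid minor of `g` (`s = false`) or of `dualPart`
(`s = true`). -/
def coordIdx (s : Bool) (k l : ℕ) (h : 1 ≤ l ∧ l ≤ k ∧ k ≤ n) : RealIdx n ⊕ CplxIdx n ⊕ CplxIdx n :=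
  if h' : l = k then Sum.inl ⟨k, by omega⟩
  else if s then Sum.inr (Sum.inr ⟨(k, l), by dsimp only; omega⟩)
  else Sum.inr (Sum.inl ⟨(k, l), by dsimp only; omega⟩)

/-- The arrays whose solid minors are the coordinate functions. -/
def sideArr (s : Bool) (p : MatPair n) : ℕ → ℕ → ℂ := if s then arr (dualPart p) else arr p.1

theorem sideArr_eq_zero {p : MatPair n} (hp : p ∈ dualUnitaryGroup n) (s : Bool) (x y : ℕ)
    (h : x < y) : sideArr s p x y = 0 := by
  cases s
  · exact arr_eq_zero hp.1 h
  · rw [sideArr, if_pos rfl, dualPart_eq hp, arr_map_star, arr_eq_zero hp.1 h, map_zero]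

theorem minorCoord_coordIdx {p : MatPair n} (hp : p ∈ dualUnitaryGroup n) (s : Bool) (k l : ℕ)
    (h : 1 ≤ l ∧ l ≤ k ∧ k ≤ n) : minorCoord (coordIdx s k l h) p = solid (sideArr s p) k l := by
  by_cases h' : l = k
  · subst h'
    rw [coordIdx, dif_pos rfl]
    cases s
    · exact solidMinor_eq_solid p.1 le_rfl h.2.2
    · rw [sideArr, if_pos rfl, dualPart_eq hp, solid_arr_map_star, conj_solid_full hp]
      exact solidMinor_eq_solid p.1 le_rfl h.2.2
  · rw [coordIdx, dif_neg h']
    cases s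
    · exact solidMinor_eq_solid p.1 h.2.1 h.2.2
    · exact solidMinor_eq_solid (dualPart p) h.2.1 h.2.2

theorem mapsTo_minorCoord (n : ℕ) :
    Set.MapsTo (fun p c => minorCoord c p) (minorChart n) (chartValues (RealIdx n) (CplxIdx n)) := by
  rintro p ⟨hp, h1, h2⟩
  have hconj : ∀ a : CplxIdx n, minorCoord (Sum.inr (Sum.inr a)) p =
      (starRingEnd ℂ) (minorCoord (Sum.inr (Sum.inl a)) p) := by
    intro a
    change solidMinor (dualPart p) a.1.1 a.1.2 a.2.2.1.le a.2.2.2 =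
      (starRingEnd ℂ) (solidMinor p.1 a.1.1 a.1.2 a.2.2.1.le a.2.2.2)
    rw [dualPart_eq hp, solidMinor_eq_solid, solidMinor_eq_solid, solid_arr_map_star]
  refine ⟨?_, h1, h2⟩
  rintro (k | a | a)
  · change minorCoord (Sum.inl k) p = (starRingEnd ℂ) (minorCoord (Sum.inl k) p)
    change solidMinor p.1 k.1 k.1 le_rfl k.2.2 =
      (starRingEnd ℂ) (solidMinor p.1 k.1 k.1 le_rfl k.2.2)
    rw [solidMinor_eq_solid, conj_solid_full hp]
  · exact hconj a
  · change minorCoord (Sum.inr (Sum.inl a)) p = (starRingEnd ℂ) (minorCoord (Sum.inr (Sum.inr a)) p)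
    rw [hconj, Complex.conj_conj]

theorem solid_ne_zero {p : MatPair n} (hp : p ∈ minorChart n) (s : Bool) {k l : ℕ}
    (hl : l ≤ k) (hk : k ≤ n) : solid (sideArr s p) k l ≠ 0 := by
  rcases Nat.eq_zero_or_pos l with rfl | h
  · simp [solid, minorOf]
  · rw [← minorCoord_coordIdx hp.1 s k l ⟨h, hl, hk⟩]
    exact chartValues_ne_zero (mapsTo_minorCoord n hp) _

/-- Expansion of a solid minor along its corner entry. -/
theorem solid_corner (a b : ℕ → ℕ → ℂ) {k l : ℕ} (hl : l ≤ k)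
    (h : ∀ x ≤ k, ∀ y ≤ l, (x, y) ≠ (k, l) → a x y = b x y) :
    solid a (k + 1) (l + 1) - solid b (k + 1) (l + 1) = (a k l - b k l) * solid a k l := by
  have hN : solid b k l = solid a k l := by
    rw [solid, solid, minorOf, minorOf]
    congr 1
    ext i j
    simp only [Matrix.of_apply, solidSeq, initSeq]
    exact (h _ (by omega) _ (by omega) (by simp; omega)).symm
  have e1 := Matrix.det_succ_row (Matrix.of fun i j => a (solidSeq (k + 1) (l + 1) i)
    (initSeq (l + 1) j)) (Fin.last l)
  have e2 := Matrix.det_succ_row (Matrix.of fun i j => b (solidSeq (k + 1) (l + 1) i)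
    (initSeq (l + 1) j)) (Fin.last l)
  -- The arrays differ at the corner only, so all cofactors along the last row agree and only the
  -- corner term survives in the difference.
  have hs : ∀ j : Fin (l + 1), ((Matrix.of fun i j => a (solidSeq (k + 1) (l + 1) i)
      (initSeq (l + 1) j)).submatrix (Fin.last l).succAbove j.succAbove) =
      ((Matrix.of fun i j => b (solidSeq (k + 1) (l + 1) i)
      (initSeq (l + 1) j)).submatrix (Fin.last l).succAbove j.succAbove) := by
    intro j
    ext x y
    simp only [Matrix.submatrix_apply, Matrix.of_apply, solidSeq, initSeq, Fin.succAbove_last,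
      Fin.val_castSucc]
    exact h _ (by omega) _ (by omega) (by simp; omega)
  rw [solid, solid, minorOf, minorOf, e1, e2, ← Finset.sum_sub_distrib,
    Finset.sum_eq_single (Fin.last l)]
  · rw [hs]
    have hk : solidSeq (k + 1) (l + 1) (Fin.last l) = k := by simp [solidSeq]; omega
    have hm : ((Matrix.of fun i j => b (solidSeq (k + 1) (l + 1) i)
        (initSeq (l + 1) j)).submatrix (Fin.last l).succAbove (Fin.last l).succAbove).det =
        solid a k l := by
      rw [← hN, solid, minorOf]
      congr 1
      ext x y
      simp [solidSeq, initSeq]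
    rw [hm]
    simp only [Matrix.of_apply, hk, initSeq, Fin.val_last]
    have hp : (-1 : ℂ) ^ (l + l) = 1 := by rw [← two_mul, pow_mul]; simp
    rw [hp]
    ring
  · intro j _ hj
    rw [hs]
    have hk : solidSeq (k + 1) (l + 1) (Fin.last l) = k := by simp [solidSeq]; omega
    have hj' : (j : ℕ) ≠ l := fun h => hj (by ext; simpa using h)
    simp only [Matrix.of_apply, hk, initSeq]
    rw [h k le_rfl j (by omega) (by simpa using hj')]
    ring
  · simp

theorem arr_ext {M N : Matrix (Fin n) (Fin n) ℂ} (h : ∀ x y, x < n → y < n → arr M x y = arr N x y) :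
    M = N := by
  ext i j
  have := h (n - 1 - i) (n - 1 - j) (by omega) (by omega)
  simp only [arr, show n - 1 - (i : ℕ) < n ∧ n - 1 - (j : ℕ) < n by omega] at this
  have ei : (⟨n - 1 - (n - 1 - i), by omega⟩ : Fin n) = i := by ext; simp only; omega
  have ej : (⟨n - 1 - (n - 1 - j), by omega⟩ : Fin n) = j := by ext; simp only; omega
  simpa [ei, ej] using this

/-- The entries are recovered one after another, row by row and from left to right: each is the
corner of a solid minor that depends on it affinely, with a non-zero solid minor as slope. The
matrix `f` is then determined by the reality condition. -/
theorem injOn_minorCoord (n : ℕ) : Set.InjOn (fun p c => minorCoord c p) (minorChart n) := by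
  intro p hp p' hp' hpp
  have hsol : ∀ k l, l ≤ k → k ≤ n → solid (arr p.1) k l = solid (arr p'.1) k l := by
    intro k l hl hk
    rcases Nat.eq_zero_or_pos l with rfl | h
    · simp [solid, minorOf]
    · have e1 := minorCoord_coordIdx hp.1 false k l ⟨h, hl, hk⟩
      have e2 := minorCoord_coordIdx hp'.1 false k l ⟨h, hl, hk⟩
      have := congrFun hpp (coordIdx false k l ⟨h, hl, hk⟩)
      simp only at this
      rw [e1, e2] at this
      exact this
  have key : ∀ x, x < n → ∀ y, arr p.1 x y = arr p'.1 x y := by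
    intro x
    induction x using Nat.strong_induction_on with
    | _ x ihx =>
      intro hx y
      induction y using Nat.strong_induction_on with
      | _ y ihy =>
        rcases lt_or_ge x y with h | h
        · rw [arr_eq_zero hp.1.1 h, arr_eq_zero hp'.1.1 h]
        · have := solid_corner (arr p.1) (arr p'.1) h (fun x' hx' y' hy' hne => by
            rcases hx'.lt_or_eq with h1 | rfl
            · exact ihx x' h1 (by omega) y'
            · exact ihy y' (lt_of_le_of_ne hy' fun h => hne (by rw [h])))
          rw [hsol _ _ (by omega) (by omega), sub_self] at this
          rcases mul_eq_zero.1 this.symm with h' | h'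
          · exact sub_eq_zero.1 h'
          · exact absurd h' (solid_ne_zero hp false h hx.le)
  have h1 : p.1 = p'.1 := arr_ext fun x y hx _ => key x hx y
  exact Prod.ext h1 (by rw [snd_eq hp.1, snd_eq hp'.1, h1])

/-- Lower triangular arrays with prescribed non-vanishing solid minors. -/
theorem exists_array (w : ℕ → ℕ → ℂ) (hw : ∀ k l, w k l ≠ 0) (hw0 : ∀ k, w k 0 = 1) (n : ℕ) :
    ∃ a : ℕ → ℕ → ℂ, (∀ x y, x < y → a x y = 0) ∧ ∀ k l, l ≤ k → k ≤ n → solid a k l = w k l := by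
  induction n with
  | zero =>
    refine ⟨fun _ _ => 0, fun _ _ _ => rfl, fun k l hl hk => ?_⟩
    obtain rfl : l = 0 := by omega
    simp [solid, minorOf, hw0]
  | succ n ih =>
    have hloc : ∀ (a b : ℕ → ℕ → ℂ) k l, l ≤ k → (∀ x < k, ∀ y < l, a x y = b x y) →
        solid a k l = solid b k l := by
      intro a b k l hl h
      rw [solid, solid, minorOf, minorOf]
      congr 1
      ext i j
      exact h _ (by simp only [solidSeq]; omega) _ (by simp only [initSeq]; omega)
    -- The new row is filled from left to right; after `m` steps the first `m` of its solid minors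
    -- have their prescribed values.
    suffices H : ∀ m ≤ n + 1, ∃ a : ℕ → ℕ → ℂ, (∀ x y, x < y → a x y = 0) ∧
        (∀ k l, l ≤ k → k ≤ n → solid a k l = w k l) ∧
        ∀ l ≤ m, solid a (n + 1) l = w (n + 1) l by
      obtain ⟨a, h1, h2, h3⟩ := H (n + 1) le_rfl
      refine ⟨a, h1, fun k l hl hk => ?_⟩
      rcases hk.lt_or_eq with h | rfl
      · exact h2 k l hl (by omega)
      · exact h3 l hl
    intro m
    induction m with
    | zero =>
      intro _
      obtain ⟨a, h1, h2⟩ := ih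
      refine ⟨a, h1, h2, fun l hl => ?_⟩
      obtain rfl : l = 0 := by omega
      simp [solid, minorOf, hw0]
    | succ m ihm =>
      intro hm
      obtain ⟨a, h1, h2, h3⟩ := ihm (by omega)
      -- Solution of the affine equation for the corner entry of Δ(n+1,m+1), with slope `w n m`.
      -- This entry occurs in none of the minors that are already adjusted.
      let b : ℕ → ℕ → ℂ := fun x y => if x = n ∧ y = m then
        a n m - (solid a (n + 1) (m + 1) - w (n + 1) (m + 1)) / w n m else a x y
      have hb : ∀ x y, (x, y) ≠ (n, m) → b x y = a x y := fun x y h =>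
        if_neg fun h' => h (by rw [h'.1, h'.2])
      refine ⟨b, fun x y h => ?_, fun k l hl hk => ?_, fun l hl => ?_⟩
      · rw [hb x y (by simp; omega), h1 x y h]
      · rw [hloc b a k l hl (fun x hx y _ => hb x y (by simp; omega)), h2 k l hl hk]
      · rcases hl.lt_or_eq with h | rfl
        · rw [hloc b a (n + 1) l (by omega) (fun x _ y hy => hb x y (by simp; omega)),
            h3 l (by omega)]
        · have := solid_corner a b (k := n) (l := m) (by omega) (fun x _ y _ h => (hb x y h).symm)
          rw [h2 n m (by omega) le_rfl] at this
          simp only [b, and_self, if_true] at this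
          have h4 : (solid a (n + 1) (m + 1) - w (n + 1) (m + 1)) / w n m * w n m =
            solid a (n + 1) (m + 1) - w (n + 1) (m + 1) := div_mul_cancel₀ _ (hw _ _)
          linear_combination -this - h4

/-- The array with prescribed solid minors gives `g`, and the reality condition dictates `f`. What
remains is that the diagonal of `g` is real, so that the diagonals of `g` and `f` are mutually
inverse. -/
theorem surjOn_minorCoord (n : ℕ) :
    Set.SurjOn (fun p c => minorCoord c p) (minorChart n) (chartValues (RealIdx n) (CplxIdx n)) := by
  intro v hv
  -- The default 1 is the value of the empty minor; for labels outside the triangle it only has to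
  -- be non-zero.
  let w : ℕ → ℕ → ℂ := fun k l =>
    if h : 1 ≤ l ∧ l ≤ k ∧ k ≤ n then v (coordIdx false k l h) else 1
  obtain ⟨a, ha, haw⟩ := exists_array w (fun k l => by
    simp only [w]; split_ifs
    · exact chartValues_ne_zero hv _
    · exact one_ne_zero) (fun k => by simp [w]) n
  let g : Matrix (Fin n) (Fin n) ℂ := Matrix.of fun i j => a (n - 1 - i) (n - 1 - j)
  have hg : ∀ x y, x < n → y < n → arr g x y = a x y := by
    intro x y hx hy
    simp only [arr, hx, hy, and_self, dif_pos, g, Matrix.of_apply]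
    congr 1 <;> omega
  have hsol : ∀ k l (h : 1 ≤ l ∧ l ≤ k ∧ k ≤ n), solid (arr g) k l = v (coordIdx false k l h) := by
    intro k l h
    have : solid (arr g) k l = solid a k l := by
      rw [solid, solid, minorOf, minorOf]
      congr 1
      ext i j
      exact hg _ _ (by simp only [solidSeq]; omega) (by simp only [initSeq]; omega)
    rw [this, haw k l h.2.1 h.2.2]
    simp only [w, h, and_self, dif_pos]
  have hup : ∀ i j, j < i → g i j = 0 := fun i j h => ha _ _ (by rw [Fin.lt_def] at h; omega)
  -- The diagonal entry is the quotient of the consecutive positive numbers Δ(x+1,x+1) and Δ(x,x).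
  have hdiag : ∀ x < n, 0 < (a x x).re ∧ (a x x).im = 0 := by
    have hpos : ∀ k ≤ n, 0 < (∏ x ∈ Finset.range k, a x x).re ∧
        (∏ x ∈ Finset.range k, a x x).im = 0 := by
      intro k hk
      rcases Nat.eq_zero_or_pos k with rfl | h
      · simp
      · rw [← solid_full ha, haw k k le_rfl hk]
        simp only [w, show 1 ≤ k ∧ k ≤ k ∧ k ≤ n by omega, dif_pos, and_self, coordIdx]
        refine ⟨hv.2.1 _, ?_⟩
        have := hv.1 (Sum.inl ⟨k, by omega⟩)
        simp only [conjIdx] at this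
        exact Complex.conj_eq_iff_im.1 this.symm
    intro x hx
    obtain ⟨h1, h2⟩ := hpos x hx.le
    obtain ⟨h3, h4⟩ := hpos (x + 1) hx
    rw [Finset.prod_range_succ] at h3 h4
    rw [Complex.mul_re, h2, zero_mul, sub_zero] at h3
    rw [Complex.mul_im, h2, zero_mul, add_zero] at h4
    exact ⟨(mul_pos_iff_of_pos_left h1).1 h3, (mul_eq_zero.1 h4).resolve_left h1.ne'⟩
  have hgd : ∀ i, g i i ≠ 0 ∧ (starRingEnd ℂ) (g i i) = g i i := by
    intro i
    obtain ⟨h1, h2⟩ := hdiag (n - 1 - i) (by omega)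
    refine ⟨fun h => ?_, Complex.conj_eq_iff_im.2 h2⟩
    change a _ _ = 0 at h
    rw [h] at h1
    simp at h1
  have hgu : IsUnit g.det := by
    rw [Matrix.det_of_isUpperTriangular (fun i j h => hup i j h), isUnit_iff_ne_zero,
      Finset.prod_ne_zero_iff]
    exact fun i _ => (hgd i).1
  have hginv : ∀ i j, j < i → g⁻¹ i j = 0 := by
    have hbt : Matrix.BlockTriangular g id := fun i j h => hup i j h
    have := Matrix.invertibleOfIsUnitDet g hgu
    exact fun i j h => Matrix.blockTriangular_inv_of_blockTriangular hbt h
  have hp : (g, (g⁻¹)ᴴ) ∈ dualUnitaryGroup n := by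
    refine ⟨hup, fun i j h => ?_, fun i => ?_, Matrix.conjTranspose_conjTranspose _⟩
    · change star (g⁻¹ j i) = 0
      rw [hginv j i h, star_zero]
    · have h1 := congrFun (congrFun (Matrix.mul_nonsing_inv g hgu) i) i
      rw [Matrix.mul_apply, Finset.sum_eq_single i] at h1
      · rw [Matrix.one_apply_eq] at h1
        have h2 := congrArg (starRingEnd ℂ) h1
        rw [map_mul, map_one, (hgd i).2] at h2
        exact h2
      · intro j _ hj
        rcases lt_or_gt_of_ne hj with h' | h'
        · rw [hup i j h', zero_mul]
        · rw [hginv j i h', mul_zero]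
      · simp
  have hval : ∀ c, minorCoord c (g, (g⁻¹)ᴴ) = v c := by
    have h1 : ∀ k l h, minorCoord (coordIdx false k l h) (g, (g⁻¹)ᴴ) = v (coordIdx false k l h) := by
      intro k l h
      rw [minorCoord_coordIdx hp]
      exact hsol k l h
    rintro (⟨k, hk⟩ | ⟨⟨k, l⟩, h⟩ | ⟨⟨k, l⟩, h⟩)
    · have := h1 k k ⟨hk.1, le_rfl, hk.2⟩
      simpa only [coordIdx, dif_pos] using this
    · have := h1 k l ⟨h.1, h.2.1.le, h.2.2⟩
      simpa only [coordIdx, dif_neg h.2.1.ne, Bool.false_eq_true, if_false] using this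
    · have := h1 k l ⟨h.1, h.2.1.le, h.2.2⟩
      simp only [coordIdx, dif_neg h.2.1.ne] at this
      have h3 := hv.1 (Sum.inr (Sum.inl ⟨(k, l), h⟩))
      simp only [conjIdx] at h3
      rw [h3]
      simp only [Bool.false_eq_true, if_false] at this
      rw [← this]
      change solidMinor (dualPart _) k l h.2.1.le h.2.2 =
        (starRingEnd ℂ) (solidMinor _ k l h.2.1.le h.2.2)
      rw [dualPart_eq hp, solidMinor_eq_solid, solidMinor_eq_solid, solid_arr_map_star]
  refine ⟨(g, (g⁻¹)ᴴ), ⟨hp, fun k => ?_, fun a => ?_⟩, funext hval⟩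
  · rw [hval]; exact hv.2.1 k
  · rw [hval]; exact hv.2.2 a

theorem bijOn_minorCoord (n : ℕ) :
    Set.BijOn (fun p c => minorCoord c p) (minorChart n) (chartValues (RealIdx n) (CplxIdx n)) :=
  ⟨mapsTo_minorCoord n, injOn_minorCoord n, surjOn_minorCoord n⟩

end

/-! ## Weights of Laurent expansions -/

section
variable {n : ℕ}

/-- The weight of a monomial. -/
def wt (η : RealIdx n ⊕ CplxIdx n → ℝ) (m : RealIdx n ⊕ CplxIdx n ⊕ CplxIdx n → ℤ) : ℝ :=
  ∑ r, (m r : ℝ) * η (actionIdx r)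

theorem wt_add (η : RealIdx n ⊕ CplxIdx n → ℝ) (m m' : RealIdx n ⊕ CplxIdx n ⊕ CplxIdx n → ℤ) :
    wt η (m + m') = wt η m + wt η m' := by
  simp only [wt, Pi.add_apply, Int.cast_add, add_mul, Finset.sum_add_distrib]

theorem wt_neg (η : RealIdx n ⊕ CplxIdx n → ℝ) (m : RealIdx n ⊕ CplxIdx n ⊕ CplxIdx n → ℤ) :
    wt η (-m) = -wt η m := by
  simp only [wt, Pi.neg_apply, Int.cast_neg, neg_mul, Finset.sum_neg_distrib]

theorem wt_single (η : RealIdx n ⊕ CplxIdx n → ℝ) (r : RealIdx n ⊕ CplxIdx n ⊕ CplxIdx n) :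
    wt η (Pi.single r 1) = η (actionIdx r) := by
  rw [wt, Finset.sum_eq_single r]
  · simp
  · intro b _ hb; simp [Pi.single_eq_of_ne hb]
  · simp

/-- The weight of the solid minor with labels `(k, l)`. -/
def solidWt (η : RealIdx n ⊕ CplxIdx n → ℝ) (k l : ℕ) : ℝ :=
  if h : 1 ≤ l ∧ l ≤ k ∧ k ≤ n then η (zetaIdx ⟨(k, l), h⟩) else 0

/-- The exponent of the solid minor with labels `(k, l)`. -/
def solidExp (n : ℕ) (s : Bool) (k l : ℕ) : RealIdx n ⊕ CplxIdx n ⊕ CplxIdx n → ℤ :=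
  if h : 1 ≤ l ∧ l ≤ k ∧ k ≤ n then Pi.single (coordIdx s k l h) 1 else 0

theorem actionIdx_coordIdx (s : Bool) (k l : ℕ) (h : 1 ≤ l ∧ l ≤ k ∧ k ≤ n) :
    actionIdx (coordIdx s k l h) = zetaIdx ⟨(k, l), h⟩ := by
  by_cases h' : l = k
  · subst h'
    simp [coordIdx, zetaIdx, actionIdx]
  · cases s <;> simp [coordIdx, zetaIdx, actionIdx, h']

theorem wt_solidExp (η : RealIdx n ⊕ CplxIdx n → ℝ) (s : Bool) (k l : ℕ) :
    wt η (solidExp n s k l) = solidWt η k l := by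
  rw [solidExp, solidWt]
  split_ifs with h
  · rw [wt_single, actionIdx_coordIdx]
  · simp [wt]

theorem solidWt_zero (η : RealIdx n ⊕ CplxIdx n → ℝ) (k : ℕ) : solidWt η k 0 = 0 := by
  simp [solidWt]

/-- The value of a monomial in the coordinates. -/
def monoVal (m : RealIdx n ⊕ CplxIdx n ⊕ CplxIdx n → ℤ) (p : MatPair n) : ℂ :=
  ∏ r, minorCoord r p ^ m r

theorem coord_ne_zero {p : MatPair n} (hp : p ∈ minorChart n)
    (r : RealIdx n ⊕ CplxIdx n ⊕ CplxIdx n) : minorCoord r p ≠ 0 :=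
  chartValues_ne_zero (mapsTo_minorCoord n hp) r

theorem monoVal_add {p : MatPair n} (hp : p ∈ minorChart n)
    (m m' : RealIdx n ⊕ CplxIdx n ⊕ CplxIdx n → ℤ) :
    monoVal (m + m') p = monoVal m p * monoVal m' p := by
  simp only [monoVal, Pi.add_apply, ← Finset.prod_mul_distrib]
  exact Finset.prod_congr rfl fun r _ => zpow_add₀ (coord_ne_zero hp r) _ _

theorem monoVal_neg (m : RealIdx n ⊕ CplxIdx n ⊕ CplxIdx n → ℤ) (p : MatPair n) :
    monoVal (-m) p = (monoVal m p)⁻¹ := by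
  simp [monoVal]

theorem monoVal_single (r : RealIdx n ⊕ CplxIdx n ⊕ CplxIdx n) (p : MatPair n) :
    monoVal (Pi.single r 1) p = minorCoord r p := by
  rw [monoVal, Finset.prod_eq_single r]
  · simp
  · intro b _ hb; simp [Pi.single_eq_of_ne hb]
  · simp

theorem monoVal_solidExp {p : MatPair n} (hp : p ∈ minorChart n) (s : Bool) {k l : ℕ} (hl : l ≤ k)
    (hk : k ≤ n) : monoVal (solidExp n s k l) p = solid (sideArr s p) k l := by
  rw [solidExp]
  split_ifs with h
  · rw [monoVal_single, minorCoord_coordIdx hp.1]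
  · obtain rfl : l = 0 := by omega
    simp [monoVal, solid, minorOf]

/-- Functions on the chart with a Laurent expansion all of whose exponents lie in `S`. -/
def ExpIn (S : Set (RealIdx n ⊕ CplxIdx n ⊕ CplxIdx n → ℤ)) (F : MatPair n → ℂ) : Prop :=
  ∃ q : ChartLaurent (RealIdx n) (CplxIdx n), (∀ m ∈ q.coeff.support, m ∈ S) ∧
    ∀ p ∈ minorChart n, q.eval (fun r => minorCoord r p) = F p

variable {S T U : Set (RealIdx n ⊕ CplxIdx n ⊕ CplxIdx n → ℤ)} {F G : MatPair n → ℂ}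

theorem ExpIn.congr (h : ExpIn S F) (hFG : ∀ p ∈ minorChart n, F p = G p) : ExpIn S G := by
  obtain ⟨q, h1, h2⟩ := h
  exact ⟨q, h1, fun p hp => (h2 p hp).trans (hFG p hp)⟩

theorem ExpIn.subset (h : ExpIn S F) (hST : S ⊆ T) : ExpIn T F := by
  obtain ⟨q, h1, h2⟩ := h
  exact ⟨q, fun m hm => hST (h1 m hm), h2⟩

theorem ExpIn.zero : ExpIn S fun _ => 0 :=
  ⟨0, by simp, fun p _ => ChartLaurent.eval_zero _⟩

theorem ExpIn.add (hF : ExpIn S F) (hG : ExpIn S G) : ExpIn S fun p => F p + G p := by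
  classical
  obtain ⟨q, h1, h2⟩ := hF
  obtain ⟨q', h1', h2'⟩ := hG
  refine ⟨q + q', fun m hm => ?_, fun p hp => ?_⟩
  · rcases Finset.mem_union.1 (Finsupp.support_add hm) with h | h
    · exact h1 m h
    · exact h1' m h
  · rw [ChartLaurent.eval_add _ _ (coord_ne_zero hp), h2 p hp, h2' p hp]

theorem ExpIn.mul (hF : ExpIn S F) (hG : ExpIn T G) (hU : ∀ m ∈ S, ∀ m' ∈ T, m + m' ∈ U) :
    ExpIn U fun p => F p * G p := by
  classical
  obtain ⟨q, h1, h2⟩ := hF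
  obtain ⟨q', h1', h2'⟩ := hG
  refine ⟨q * q', fun m hm => ?_, fun p hp => ?_⟩
  · obtain ⟨a, ha, b, hb, rfl⟩ := Finset.mem_add.1 (AddMonoidAlgebra.support_coeff_mul_subset q q' hm)
    exact hU a (h1 a ha) b (h1' b hb)
  · rw [ChartLaurent.eval_mul _ _ (coord_ne_zero hp), h2 p hp, h2' p hp]

theorem ExpIn.monoVal {m : RealIdx n ⊕ CplxIdx n ⊕ CplxIdx n → ℤ} (c : ℂ) (hm : m ∈ S) :
    ExpIn S fun p => c * monoVal m p :=
  ⟨AddMonoidAlgebra.single m c, fun m' hm' => by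
    rw [AddMonoidAlgebra.coeff_single] at hm'
    rw [Finset.mem_singleton.1 (Finsupp.support_single_subset hm')]; exact hm,
    fun p _ => ChartLaurent.eval_single m c _⟩

theorem ExpIn.const_mul (c : ℂ) (hF : ExpIn S F) : ExpIn S fun p => c * F p := by
  have h : ExpIn ({0} : Set (RealIdx n ⊕ CplxIdx n ⊕ CplxIdx n → ℤ)) fun _ => c :=
    (ExpIn.monoVal c (Set.mem_singleton 0)).congr fun p _ => by simp [_root_.monoVal]
  exact h.mul hF fun m hm m' hm' => by rw [Set.mem_singleton_iff.1 hm, zero_add]; exact hm'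

theorem ExpIn.sub (hF : ExpIn S F) (hG : ExpIn S G) : ExpIn S fun p => F p - G p :=
  (hF.add (hG.const_mul (-1))).congr fun p _ => by ring

theorem ExpIn.sum {α : Type*} (s : Finset α) {f : α → MatPair n → ℂ} (h : ∀ i ∈ s, ExpIn S (f i)) :
    ExpIn S fun p => ∑ i ∈ s, f i p := by
  classical
  induction s using Finset.induction_on with
  | empty => exact ExpIn.zero.congr fun p _ => by simp
  | insert i s hi ih =>
    exact ((h i (Finset.mem_insert_self i s)).add
      (ih fun j hj => h j (Finset.mem_insert_of_mem hj))).congr fun p _ => by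
        rw [Finset.sum_insert hi]

/-- Functions whose expansion has only monomials of weight less than `d`. -/
def WtLT (η : RealIdx n ⊕ CplxIdx n → ℝ) (d : ℝ) (F : MatPair n → ℂ) : Prop :=
  ExpIn {m | wt η m < d} F

/-- Functions whose expansion has only monomials of weight at most `d`. -/
def WtLE (η : RealIdx n ⊕ CplxIdx n → ℝ) (d : ℝ) (F : MatPair n → ℂ) : Prop :=
  ExpIn {m | wt η m ≤ d} F

variable {η : RealIdx n ⊕ CplxIdx n → ℝ} {d d' : ℝ}

theorem WtLT.le (h : WtLT η d F) : WtLE η d F :=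
  ExpIn.subset h fun m hm => (show wt η m < d from hm).le

theorem WtLT.mono (h : WtLT η d F) (hd : d ≤ d') : WtLT η d' F :=
  ExpIn.subset h fun _ hm => lt_of_lt_of_le hm hd

theorem WtLE.lt (h : WtLE η d F) (hd : d < d') : WtLT η d' F :=
  ExpIn.subset h fun _ hm => lt_of_le_of_lt hm hd

theorem WtLE.mul (hF : WtLE η d F) (hG : WtLE η d' G) : WtLE η (d + d') fun p => F p * G p :=
  ExpIn.mul hF hG fun m hm m' hm' => by
    simp only [Set.mem_ofPred_eq, wt_add] at *; linarith

theorem WtLT.mul_le (hF : WtLT η d F) (hG : WtLE η d' G) : WtLT η (d + d') fun p => F p * G p :=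
  ExpIn.mul hF hG fun m hm m' hm' => by
    simp only [Set.mem_ofPred_eq, wt_add] at *; linarith

theorem WtLE.mul_lt (hF : WtLE η d F) (hG : WtLT η d' G) : WtLT η (d + d') fun p => F p * G p :=
  ExpIn.mul hF hG fun m hm m' hm' => by
    simp only [Set.mem_ofPred_eq, wt_add] at *; linarith

/-- Dividing by a monomial in the coordinates only shifts exponents. This is why recursions that
divide by solid minors stay within Laurent polynomials and keep control of the weights. -/
theorem WtLT.div {m : RealIdx n ⊕ CplxIdx n ⊕ CplxIdx n → ℤ} (hG : WtLT η d G)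
    (h : ∀ p ∈ minorChart n, monoVal m p * F p = G p) : WtLT η (d - wt η m) F := by
  have h1 : ExpIn {m' | m' = -m} (monoVal (-m)) :=
    (ExpIn.monoVal (S := {m' | m' = -m}) 1 (by simp)).congr fun p _ => one_mul _
  refine (ExpIn.mul hG h1 fun a ha b hb => ?_).congr fun p hp => ?_
  · simp only [Set.mem_ofPred_eq] at *
    rw [hb, wt_add, wt_neg]; linarith
  · rw [← h p hp, monoVal_neg]
    have : monoVal m p ≠ 0 := Finset.prod_ne_zero_iff.2 fun r _ => zpow_ne_zero _ (coord_ne_zero hp r)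
    field_simp

theorem WtLE.solid (s : Bool) {k l : ℕ} (hl : l ≤ k) (hk : k ≤ n) :
    WtLE η (solidWt η k l) fun p => solid (sideArr s p) k l :=
  (ExpIn.monoVal (m := solidExp n s k l) 1 (by
    simp only [Set.mem_ofPred_eq, wt_solidExp, le_refl])).congr fun p hp => by
    rw [one_mul, monoVal_solidExp hp s hl hk]

theorem WtLT.div_solid (s : Bool) {k l : ℕ} (hl : l ≤ k) (hk : k ≤ n)
    (hG : WtLT η (d + solidWt η k l) G)
    (h : ∀ p ∈ minorChart n, solid (sideArr s p) k l * F p = G p) : WtLT η d F := by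
  have := WtLT.div (m := solidExp n s k l) hG fun p hp => by
    rw [monoVal_solidExp hp s hl hk, h p hp]
  rwa [wt_solidExp, add_sub_cancel_right] at this

/-- The inequality `λ^(k+1)_(l+1) > λ^(k)_(l+1)` in terms of weights. -/
def RowIneq (η : RealIdx n ⊕ CplxIdx n → ℝ) (k l : ℕ) : Prop :=
  solidWt η (k + 1) l + solidWt η k (l + 1) < solidWt η (k + 1) (l + 1) + solidWt η k l

/-- The inequality `λ^(k)_(l+1) > λ^(k+1)_(l+2)` in terms of weights. -/
def ColIneq (η : RealIdx n ⊕ CplxIdx n → ℝ) (k l : ℕ) : Prop :=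
  solidWt η (k + 1) (l + 2) + solidWt η k l < solidWt η (k + 1) (l + 1) + solidWt η k (l + 1)

/-! ### Exchange of rows -/

/-- Solid minors of size `k` with one exchanged row have smaller weight. -/
def RowSmall (η : RealIdx n ⊕ CplxIdx n → ℝ) (s : Bool) (k l : ℕ) : Prop :=
  ∀ (t : Fin l) (x : ℕ), x < k - l → WtLT η (solidWt η k l) fun p => rowRep (sideArr s p) k l t x

theorem rowRep_last_le {s : Bool} {k l : ℕ} (hl : l < k) (hk : k ≤ n) (h : RowSmall η s k (l + 1))
    {x : ℕ} (hx : x < k - l) :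
    WtLE η (solidWt η k (l + 1)) fun p => rowRep (sideArr s p) (k + 1) (l + 1) (Fin.last l) x := by
  by_cases hx' : x = k - l - 1
  · obtain ⟨ε, -, hε⟩ := rowRep_last_sub_one k l hl
    exact (ExpIn.const_mul ε (WtLE.solid s (by omega) hk)).congr fun p _ => by rw [hx', hε]
  · obtain ⟨ε, -, hε⟩ := rowRep_last k l x hl (by omega)
    exact (ExpIn.const_mul ε (h 0 x (by omega)).le).congr fun p _ => by rw [hε]

theorem rowRep_last_lt {s : Bool} {k l : ℕ} (hl : l < k) (h : RowSmall η s k (l + 1))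
    {x : ℕ} (hx : x < k - l - 1) :
    WtLT η (solidWt η k (l + 1)) fun p => rowRep (sideArr s p) (k + 1) (l + 1) (Fin.last l) x := by
  obtain ⟨ε, -, hε⟩ := rowRep_last k l x hl (by omega)
  exact (ExpIn.const_mul ε (h 0 x (by omega))).congr fun p _ => by rw [hε]

theorem rowRep_next_le {s : Bool} {k l : ℕ} (hl : l < k) (hk : k + 1 ≤ n)
    (h : RowSmall η s (k + 1) l) (t : Fin l) :
    WtLE η (solidWt η (k + 1) l) fun p => rowRep (sideArr s p) k l t k := by
  obtain ⟨l, rfl⟩ : ∃ l', l = l' + 1 := ⟨l - 1, by have := t.2; omega⟩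
  refine Fin.cases ?_ (fun t => ?_) t
  · obtain ⟨ε, -, hε⟩ := rowRep_next_zero k l hl.le
    exact (ExpIn.const_mul ε (WtLE.solid s (by omega) hk)).congr fun p _ => by rw [hε]
  · obtain ⟨ε, -, hε⟩ := rowRep_next_succ k l hl.le t
    exact (ExpIn.const_mul ε (h t.castSucc (k - (l + 1)) (by omega)).le).congr fun p _ => by rw [hε]

theorem rowRep_next_lt {s : Bool} {k l : ℕ} (hl : l < k)
    (h : RowSmall η s (k + 1) l) (t : Fin l) (ht : (t : ℕ) ≠ 0) :
    WtLT η (solidWt η (k + 1) l) fun p => rowRep (sideArr s p) k l t k := by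
  obtain ⟨l, rfl⟩ : ∃ l', l = l' + 1 := ⟨l - 1, by have := t.2; omega⟩
  obtain ⟨t, rfl⟩ := Fin.exists_succ_eq.2 (fun h0 => ht (by simp [h0]) : t ≠ 0)
  obtain ⟨ε, -, hε⟩ := rowRep_next_succ k l hl.le t
  exact (ExpIn.const_mul ε (h t.castSucc (k - (l + 1)) (by omega))).congr fun p _ => by rw [hε]

/-- Exchanging a row other than the first one with the preceding row. -/
theorem rowRep_lt_of_ne {s : Bool} {k l : ℕ} (hl : l < k) (hk : k + 1 ≤ n)
    (h1 : RowSmall η s k l) (h2 : RowSmall η s k (l + 1)) (h3 : RowSmall η s (k + 1) l) {d : ℝ}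
    (hd1 : solidWt η (k + 1) (l + 1) ≤ d)
    (hd2 : solidWt η (k + 1) l + solidWt η k (l + 1) - solidWt η k l ≤ d)
    (hd3 : l ≠ 0 → solidWt η k (l + 1) < d) (t : Fin (l + 1)) {x : ℕ} (hx : x < k - l)
    (htx : (t : ℕ) ≠ 0 ∨ x ≠ k - l - 1) :
    WtLT η d fun p => rowRep (sideArr s p) (k + 1) (l + 1) t x := by
  -- The bound `d` is left free: it is the weight of Δ(k+1,l+1) when the row inequality holds, and
  -- that of Δ(k+1,l)Δ(k,l+1)/Δ(k,l) when it is violated.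
  refine Fin.lastCases (fun htx => ?_) (fun t htx => ?_) t htx
  · rcases Nat.eq_zero_or_pos l with rfl | hl0
    · refine (rowRep_last_lt hl h2 (by simp at htx; omega)).mono ?_
      rw [solidWt_zero, solidWt_zero] at hd2
      linarith
    · exact (rowRep_last_le hl (by omega) h2 hx).lt (hd3 (by omega))
  · refine WtLT.div_solid s (k := k) (l := l) hl.le (by omega) (G := fun p =>
      solid (sideArr s p) (k + 1) (l + 1) * rowRep (sideArr s p) k l t x -
        rowRep (sideArr s p) k l t k * rowRep (sideArr s p) (k + 1) (l + 1) (Fin.last l) x)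
      (ExpIn.sub ?_ ?_) fun p _ => rowRep_castSucc _ hl.le t x
    · exact ((WtLE.solid s (by omega) hk).mul_lt (h1 t x hx)).mono (by linarith)
    · rcases htx with ht | hx'
      · exact ((rowRep_next_lt hl h3 t (by simpa using ht)).mul_le
          (rowRep_last_le hl (by omega) h2 hx)).mono (by linarith)
      · exact ((rowRep_next_le hl hk h3 t).mul_lt
          (rowRep_last_lt hl h2 (by omega))).mono (by linarith)

/-- In the three-term relation every product contains a factor already known to be light, with one
exception: exchanging the first row for its predecessor produces, for `l > 0`, the monomial
Δ(k+1,l)Δ(k,l+1)/Δ(k,l). The row inequality says that this monomial is lighter than Δ(k+1,l+1). -/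
theorem rowSmall_step {s : Bool} {k l : ℕ} (hl : l < k) (hk : k + 1 ≤ n)
    (h1 : RowSmall η s k l) (h2 : RowSmall η s k (l + 1)) (h3 : RowSmall η s (k + 1) l)
    (hG : RowIneq η k l) (hG' : solidWt η k (l + 1) < solidWt η (k + 1) (l + 1)) :
    RowSmall η s (k + 1) (l + 1) := by
  intro t x hx
  rw [RowIneq] at hG
  by_cases htx : (t : ℕ) ≠ 0 ∨ x ≠ k - l - 1
  · exact rowRep_lt_of_ne hl hk h1 h2 h3 le_rfl (by linarith) (fun _ => hG') t (by omega) htx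
  -- The exceptional exchange, of position 0 with row k-l-1. For `l = 0` this position is also the
  -- last one.
  · refine Fin.lastCases ?_ (fun t => ?_) t
    · exact (rowRep_last_le hl (by omega) h2 (by omega)).lt hG'
    · refine WtLT.div_solid s (k := k) (l := l) hl.le (by omega) (G := fun p =>
        solid (sideArr s p) (k + 1) (l + 1) * rowRep (sideArr s p) k l t x -
          rowRep (sideArr s p) k l t k * rowRep (sideArr s p) (k + 1) (l + 1) (Fin.last l) x)
        (ExpIn.sub ?_ ?_) fun p _ => rowRep_castSucc _ hl.le t x
      · exact ((WtLE.solid s (by omega) hk).mul_lt (h1 t x (by omega))).mono (by linarith)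
      · exact ((rowRep_next_le hl hk h3 t).mul
          (rowRep_last_le hl (by omega) h2 (by omega))).lt (by linarith)

/-- The row inequality says that ζ^(k+1)_l - ζ^(k)_l increases with `l`; it starts at 0, the weight
of empty minors. -/
theorem solidWt_lt_succ {k l₀ : ℕ} (hG : ∀ l < l₀, RowIneq η k l) {l : ℕ} (hl : l < l₀) :
    solidWt η k (l + 1) < solidWt η (k + 1) (l + 1) := by
  induction l with
  | zero =>
    have := hG 0 hl
    rw [RowIneq, solidWt_zero, solidWt_zero] at this
    linarith
  | succ l ih =>
    have := hG (l + 1) hl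
    rw [RowIneq] at this
    have := ih (by omega)
    linarith

/-- The cut-off `l₀` allows the row inequality to fail from `l₀` on, as needed when a single
inequality is violated on purpose. -/
theorem rowSmall_level {s : Bool} {k l₀ : ℕ} (hk : k + 1 ≤ n) (h : ∀ l, RowSmall η s k l)
    (hl₀ : l₀ ≤ k) (hG : ∀ l < l₀, RowIneq η k l) : ∀ l ≤ l₀, RowSmall η s (k + 1) l := by
  intro l
  induction l with
  | zero => exact fun _ t => t.elim0
  | succ l ih =>
    intro hl
    exact rowSmall_step (by omega) hk (h l) (h (l + 1)) (ih (by omega)) (hG l (by omega))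
      (solidWt_lt_succ hG (by omega))

theorem rowSmall {s : Bool} {k : ℕ} (hk : k ≤ n) (hG : ∀ k' l, l < k' → k' < k → RowIneq η k' l) :
    ∀ l, RowSmall η s k l := by
  induction k with
  | zero => intro l t x hx; omega
  | succ k ih =>
    intro l
    have h := rowSmall_level (s := s) (l₀ := k) hk
      (ih (by omega) fun k' l h1 h2 => hG k' l h1 (by omega)) le_rfl fun l hl => hG k l hl (by omega)
    rcases le_or_gt l k with h' | h'
    · exact h l h'
    · intro t x hx; omega

/-! ### Exchange of columns -/

/-- Solid minors with one exchanged column have smaller weight. -/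
def ColSmall (η : RealIdx n ⊕ CplxIdx n → ℝ) (s : Bool) (k l : ℕ) : Prop :=
  ∀ (t : Fin l) (y : ℕ), l ≤ y → WtLT η (solidWt η k l) fun p => colRep (sideArr s p) k l t y

/-- Of the two products in `colRep_last`, the first is light by induction on the level. The second
has to be strictly lighter for one of two reasons: the larger minor is strictly light, or the column
inequality leaves room. The alternative in the hypotheses serves the proof of the inclusion of cones
as well as that of its converse. -/
theorem colRep_last_of_gt {s : Bool} {k l : ℕ} (hl : l < k) (hk : k + 1 ≤ n)
    (h1 : ColSmall η s k (l + 1)) {d : ℝ} (hd1 : solidWt η (k + 1) (l + 1) ≤ d)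
    (hd2 : solidWt η (k + 1) (l + 2) + solidWt η k l - solidWt η k (l + 1) ≤ d) {y : ℕ}
    (hy : l + 1 ≤ y)
    (hy' : (WtLT η (solidWt η (k + 1) (l + 2)) fun p =>
      colRep (sideArr s p) (k + 1) (l + 2) (Fin.last (l + 1)) y) ∨
      (WtLE η (solidWt η (k + 1) (l + 2)) fun p =>
        colRep (sideArr s p) (k + 1) (l + 2) (Fin.last (l + 1)) y) ∧
      solidWt η (k + 1) (l + 2) + solidWt η k l - solidWt η k (l + 1) < d) :
    WtLT η d fun p => colRep (sideArr s p) (k + 1) (l + 1) (Fin.last l) y := by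
  obtain ⟨ε, δ, -, -, h⟩ := colRep_last k l hl
  refine WtLT.div_solid s (k := k) (l := l + 1) hl (by omega) (ExpIn.add ?_ ?_) fun p _ =>
    h (sideArr s p) y
  · exact ExpIn.const_mul ε (((WtLE.solid s (by omega) hk).mul_lt
      (h1 (Fin.last l) y hy)).mono (by linarith))
  · refine ExpIn.const_mul δ ?_
    rcases hy' with hy' | ⟨hy', hd3⟩
    · exact (hy'.mul_le (WtLE.solid s hl.le (by omega))).mono (by linarith)
    · exact (hy'.mul (WtLE.solid s hl.le (by omega))).lt (by linarith)

theorem colRep_castSucc_lt {s : Bool} {k l : ℕ} (hl : l ≤ k) (hk : k + 1 ≤ n)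
    (h1 : ColSmall η s k l) {d : ℝ} (hd1 : solidWt η (k + 1) (l + 1) ≤ d) (t : Fin l) {y : ℕ}
    (hy : l ≤ y) (hT : WtLE η d fun p => colRep (sideArr s p) (k + 1) (l + 1) (Fin.last l) y) :
    WtLT η d fun p => colRep (sideArr s p) (k + 1) (l + 1) t.castSucc y := by
  refine WtLT.div_solid s (k := k) (l := l) hl (by omega) (ExpIn.sub ?_ ?_) fun p _ =>
    colRep_castSucc _ t y
  · exact ((WtLE.solid s (by omega) hk).mul_lt (h1 t y hy)).mono (by linarith)
  · exact ((h1 t l le_rfl).mul_le hT).mono (by linarith)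

theorem colRep_top {s : Bool} {k y : ℕ} (hy : k ≤ y) (t : Fin k) {d : ℝ} :
    WtLT η d fun p => colRep (sideArr s p) k k t y :=
  ExpIn.zero.congr fun _ hp => (colRep_eq_zero (sideArr_eq_zero hp.1 s) t hy).symm

theorem colRep_succ_le {s : Bool} {k l : ℕ} (hl : l + 1 ≤ k) (hk : k ≤ n)
    (h : ColSmall η s k (l + 1)) {y : ℕ} (hy : l ≤ y) :
    WtLE η (solidWt η k (l + 1)) fun p => colRep (sideArr s p) k (l + 1) (Fin.last l) y := by
  rcases hy.eq_or_lt with rfl | hy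
  · exact ExpIn.congr (WtLE.solid s hl hk) fun p _ => (colRep_self _ _ _).symm
  · exact (h (Fin.last l) y hy).le

/-- The recursion for columns passes from size l+2 to size l+1, so the induction descends in `l`. It
starts at full size, where a column beyond the diagonal of a triangular array makes the minor
vanish. The cut-off `l₀` allows the inequality to fail below it. -/
theorem colSmall_level {s : Bool} {k l₀ : ℕ} (hk : k + 1 ≤ n) (h : ∀ l ≤ k, ColSmall η s k l)
    (hG : ∀ l, l₀ ≤ l → l < k → ColIneq η k l) :
    ∀ j l, l + j = k → l₀ ≤ l → ColSmall η s (k + 1) (l + 1) := by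
  intro j
  induction j with
  | zero =>
    intro l hl _ t y hy
    obtain rfl : l = k := by omega
    exact colRep_top hy t
  | succ j ih =>
    intro l hl hl₀ t y hy
    have hG' := hG l hl₀ (by omega)
    rw [ColIneq] at hG'
    have hT := colRep_last_of_gt (d := solidWt η (k + 1) (l + 1)) (by omega) hk
      (h (l + 1) (by omega)) le_rfl (by linarith) hy
      (Or.inr ⟨colRep_succ_le (by omega) hk (ih (l + 1) (by omega) (by omega)) hy, by linarith⟩)
    refine Fin.lastCases hT (fun t => ?_) t
    exact colRep_castSucc_lt (by omega) hk (h l (by omega)) le_rfl t (by omega) hT.le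

theorem colSmall {s : Bool} {k : ℕ} (hk : k ≤ n) (hG : ∀ k' l, l < k' → k' < k → ColIneq η k' l) :
    ∀ l ≤ k, ColSmall η s k l := by
  induction k with
  | zero =>
    intro l hl t
    exact absurd t.2 (by omega)
  | succ k ih =>
    intro l hl
    rcases l with - | l
    · exact fun t => t.elim0
    · exact colSmall_level (l₀ := 0) hk
        (ih (by omega) fun k' l h1 h2 => hG k' l h1 (by omega))
        (fun l _ hl => hG k l hl (by omega)) (k - l) l (by omega) (by omega)

end

/-! ## Leading terms of the brackets of solid minors -/

section
variable {n : ℕ}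

/-- The array (of `g` or of `dualPart`) to which a coordinate belongs. -/
def coordSide : RealIdx n ⊕ CplxIdx n ⊕ CplxIdx n → Bool
  | Sum.inl _ => false
  | Sum.inr (Sum.inl _) => false
  | Sum.inr (Sum.inr _) => true

/-- The label `(k, l)` of a coordinate. -/
def coordLabel : RealIdx n ⊕ CplxIdx n ⊕ CplxIdx n → TriIdx n
  | Sum.inl k => ⟨(k.1, k.1), k.2.1, le_rfl, k.2.2⟩
  | Sum.inr (Sum.inl a) => a.tri
  | Sum.inr (Sum.inr a) => a.tri

theorem minorCoord_eq (c : RealIdx n ⊕ CplxIdx n ⊕ CplxIdx n) : minorCoord c =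
    fun p => solid (sideArr (coordSide c) p) (coordLabel c).1.1 (coordLabel c).1.2 := by
  ext p
  rcases c with k | a | a
  · exact solidMinor_eq_solid p.1 le_rfl k.2.2
  · exact solidMinor_eq_solid p.1 a.2.2.1.le a.2.2.2
  · exact solidMinor_eq_solid (dualPart p) a.2.2.1.le a.2.2.2

theorem coordIdx_coordLabel (c : RealIdx n ⊕ CplxIdx n ⊕ CplxIdx n) :
    coordIdx (coordSide c) (coordLabel c).1.1 (coordLabel c).1.2 (coordLabel c).2 = c := by
  rcases c with k | a | a
  · simp [coordIdx, coordLabel]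
  · exact dif_neg a.2.2.1.ne
  · exact dif_neg a.2.2.1.ne

theorem solidExp_coordLabel (c : RealIdx n ⊕ CplxIdx n ⊕ CplxIdx n) :
    solidExp n (coordSide c) (coordLabel c).1.1 (coordLabel c).1.2 = Pi.single c 1 := by
  rw [solidExp, dif_pos (coordLabel c).2, coordIdx_coordLabel]

theorem solidWt_coordLabel (η : RealIdx n ⊕ CplxIdx n → ℝ)
    (c : RealIdx n ⊕ CplxIdx n ⊕ CplxIdx n) :
    solidWt η (coordLabel c).1.1 (coordLabel c).1.2 = η (actionIdx c) := by
  rw [← wt_solidExp η (coordSide c), solidExp_coordLabel, wt_single]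

/-- The coefficient (divided by `i`) of the log-canonical part of the bracket of two solid minors,
of `g` (`false`) or of `dualPart` (`true`). -/
def minorSlope : Bool → Bool → ℕ → ℕ → ℕ → ℕ → ℝ
  | false, false, k, l, p, q =>
    ((if p ≤ k ∧ p - q ≤ k - l then 1 else 0) - 1 / 2) * (((min l q : ℕ) : ℝ) - overlap k l p q)
  | true, true, k, l, p, q =>
    ((if k ≤ p ∧ k - l ≤ p - q then 1 else 0) - 1 / 2) * (((min l q : ℕ) : ℝ) - overlap k l p q)
  | false, true, k, l, p, q => (((min l q : ℕ) : ℝ) - overlap k l p q) / 2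
  | true, false, k, l, p, q => -((((min q l : ℕ) : ℝ) - overlap p q k l) / 2)

/-- Exchange of columns between two arrays. -/
def colSum (n : ℕ) (A B : ℕ → ℕ → ℂ) (k l p q : ℕ) : ℂ :=
  ∑ i : Fin l, ∑ j : Fin q, if (i : ℕ) = j then ∑ y ∈ Finset.range n,
    (if l ≤ y ∧ q ≤ y then colRep A k l i y * colRep B p q j y else 0) else 0

/-- Exchange of rows between two arrays. -/
def rowSum (n : ℕ) (A B : ℕ → ℕ → ℂ) (k l p q : ℕ) : ℂ :=
  ∑ i : Fin l, ∑ j : Fin q, if solidSeq k l i = solidSeq p q j then ∑ x ∈ Finset.range n,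
    (if x < k - l ∧ x < p - q then rowRep A k l i x * rowRep B p q j x else 0) else 0

/-- The part of the bracket of two solid minors which is not log-canonical. -/
def crossTerm (s s' : Bool) (k l p q : ℕ) (P : MatPair n) : ℂ :=
  match s, s' with
  | false, false => 0
  | true, true => 0
  | false, true => Complex.I * colSum n (sideArr false P) (sideArr true P) k l p q +
      -Complex.I * rowSum n (sideArr false P) (sideArr true P) k l p q
  | true, false => -Complex.I * colSum n (sideArr false P) (sideArr true P) p q k l +
      Complex.I * rowSum n (sideArr false P) (sideArr true P) p q k l

theorem dualBracket_solid (s s' : Bool) {k l p q : ℕ} (hl : l ≤ k) (hk : k ≤ n) (hq : q ≤ p)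
    (hp : p ≤ n) {P : MatPair n} (hP : IsUnit P.2) :
    dualBracket (fun P => solid (sideArr s P) k l) (fun P => solid (sideArr s' P) p q) P =
      (Complex.I * minorSlope s s' k l p q) * (solid (sideArr s P) k l * solid (sideArr s' P) p q) +
        crossTerm s s' k l p q P := by
  cases s <;> cases s'
  · refine (dualBracket_left_left_eq hl hk hq hp P).trans ?_
    simp only [minorSlope, crossTerm, sideArr, add_zero, Complex.ofReal_mul, Complex.ofReal_sub,
      Complex.ofReal_div, Complex.ofReal_natCast, Complex.ofReal_ofNat, Complex.ofReal_one,
      Complex.ofReal_zero, apply_ite Complex.ofReal]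
    rfl
  · refine (dualBracket_left_right_eq hl hk hq hp hP).trans ?_
    simp only [minorSlope, crossTerm, sideArr, colSum, rowSum, Bool.false_eq_true, if_false, if_true,
      Complex.ofReal_sub, Complex.ofReal_div, Complex.ofReal_natCast,
      Complex.ofReal_ofNat]
    ring
  · refine (dualBracket_swap (fun M => solid (arr M) p q) (fun M => solid (arr (M⁻¹)ᵀ) k l)
      P).trans ?_
    refine (congrArg Neg.neg (dualBracket_left_right_eq hq hp hl hk hP)).trans ?_
    simp only [minorSlope, crossTerm, sideArr, colSum, rowSum, Bool.false_eq_true, if_false, if_true,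
      Complex.ofReal_sub, Complex.ofReal_div, Complex.ofReal_neg,
      Complex.ofReal_natCast, Complex.ofReal_ofNat]
    ring
  · refine (dualBracket_right_right_eq hl hk hq hp hP).trans ?_
    simp only [minorSlope, crossTerm, sideArr, add_zero, Complex.ofReal_mul, Complex.ofReal_sub,
      Complex.ofReal_div, Complex.ofReal_natCast, Complex.ofReal_ofNat, Complex.ofReal_one,
      Complex.ofReal_zero, apply_ite Complex.ofReal]
    rfl

variable {η : RealIdx n ⊕ CplxIdx n → ℝ} {d d' : ℝ}

/-- In the remainder the new column lies outside both minors, so both factors of each product are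
light. -/
theorem wtLT_colSum {k l p q : ℕ} (h1 : ColSmall η false k l) (h2 : ColSmall η true p q) :
    WtLT η (solidWt η k l + solidWt η p q)
      fun P => colSum n (sideArr false P) (sideArr true P) k l p q := by
  refine ExpIn.sum _ fun i _ => ExpIn.sum _ fun j _ => ?_
  split_ifs
  · refine ExpIn.sum _ fun y _ => ?_
    split_ifs with hy
    · exact (h1 i y hy.1).mul_le (h2 j y hy.2).le
    · exact ExpIn.zero
  · exact ExpIn.zero

theorem wtLT_rowSum {k l p q : ℕ} (h1 : RowSmall η false k l) (h2 : RowSmall η true p q) :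
    WtLT η (solidWt η k l + solidWt η p q)
      fun P => rowSum n (sideArr false P) (sideArr true P) k l p q := by
  refine ExpIn.sum _ fun i _ => ExpIn.sum _ fun j _ => ?_
  split_ifs
  · refine ExpIn.sum _ fun y _ => ?_
    split_ifs with hy
    · exact (h1 i y hy.1).mul_le (h2 j y hy.2).le
    · exact ExpIn.zero
  · exact ExpIn.zero

/-- The interlacing inequalities in terms of weights. -/
def Interlacing (η : RealIdx n ⊕ CplxIdx n → ℝ) : Prop :=
  ∀ k l, l < k → k < n → RowIneq η k l ∧ ColIneq η k l

theorem wtLT_crossTerm (hη : Interlacing η) (s s' : Bool) {k l p q : ℕ} (hl : l ≤ k) (hk : k ≤ n)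
    (hq : q ≤ p) (hp : p ≤ n) :
    WtLT η (solidWt η k l + solidWt η p q) (crossTerm (n := n) s s' k l p q) := by
  have hr : ∀ s {k}, k ≤ n → ∀ l, RowSmall η s k l := fun s k hk =>
    rowSmall hk fun k' l h1 h2 => (hη k' l h1 (by omega)).1
  have hc : ∀ s {k}, k ≤ n → ∀ l ≤ k, ColSmall η s k l := fun s k hk =>
    colSmall hk fun k' l h1 h2 => (hη k' l h1 (by omega)).2
  cases s <;> cases s'
  · exact ExpIn.zero
  · exact ((wtLT_colSum (hc _ hk _ hl) (hc _ hp _ hq)).const_mul _).add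
      ((wtLT_rowSum (hr _ hk _) (hr _ hp _)).const_mul _)
  · rw [add_comm]
    exact ((wtLT_colSum (hc _ hp _ hq) (hc _ hk _ hl)).const_mul _).add
      ((wtLT_rowSum (hr _ hp _) (hr _ hk _)).const_mul _)
  · exact ExpIn.zero

/-! ### Coefficients of the bracket table -/

theorem ChartLaurent.eq_of_eval_chart {q q' : ChartLaurent (RealIdx n) (CplxIdx n)}
    (h : ∀ p ∈ minorChart n, q.eval (fun r => minorCoord r p) = q'.eval fun r => minorCoord r p) :
    q = q' := by
  refine ChartLaurent.ext_of_eval fun v hv => ?_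
  obtain ⟨p, hp, rfl⟩ := surjOn_minorCoord n hv
  exact h p hp

theorem ExpIn.mem_support {S : Set (RealIdx n ⊕ CplxIdx n ⊕ CplxIdx n → ℤ)} {F : MatPair n → ℂ}
    (hF : ExpIn S F) {q : ChartLaurent (RealIdx n) (CplxIdx n)}
    (hq : ∀ p ∈ minorChart n, q.eval (fun r => minorCoord r p) = F p) :
    ∀ m ∈ q.coeff.support, m ∈ S := by
  obtain ⟨q', h1, h2⟩ := hF
  rw [ChartLaurent.eq_of_eval_chart fun p hp => (hq p hp).trans (h2 p hp).symm]
  exact h1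

/-- If a Laurent polynomial is the sum of a monomial and of terms with exponents in `S`, then its
difference with the monomial has its support in `S`. -/
theorem sub_single_mem_support {S : Set (RealIdx n ⊕ CplxIdx n ⊕ CplxIdx n → ℤ)}
    {F : MatPair n → ℂ} (hF : ExpIn S F) {q : ChartLaurent (RealIdx n) (CplxIdx n)} (u : ℂ)
    (m : RealIdx n ⊕ CplxIdx n ⊕ CplxIdx n → ℤ)
    (hq : ∀ p ∈ minorChart n, q.eval (fun r => minorCoord r p) = u * monoVal m p + F p) :
    ∀ m' ∈ (q - AddMonoidAlgebra.single m u).coeff.support, m' ∈ S := by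
  refine hF.mem_support fun p hp => ?_
  have h1 := ChartLaurent.eval_add (q - AddMonoidAlgebra.single m u) (AddMonoidAlgebra.single m u)
    (coord_ne_zero hp)
  rw [sub_add_cancel, hq p hp, ChartLaurent.eval_single] at h1
  rw [monoVal] at h1
  linear_combination -h1

theorem coeff_eq_of_expansion {S : Set (RealIdx n ⊕ CplxIdx n ⊕ CplxIdx n → ℤ)}
    {F : MatPair n → ℂ} (hF : ExpIn S F) {q : ChartLaurent (RealIdx n) (CplxIdx n)} {u : ℂ}
    {m : RealIdx n ⊕ CplxIdx n ⊕ CplxIdx n → ℤ} (hm : m ∉ S)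
    (hq : ∀ p ∈ minorChart n, q.eval (fun r => minorCoord r p) = u * monoVal m p + F p) :
    q.coeff m = u := by
  have h1 := mt (sub_single_mem_support hF u m hq m) hm
  rw [Finsupp.notMem_support_iff, AddMonoidAlgebra.coeff_sub, Finsupp.sub_apply,
    AddMonoidAlgebra.coeff_single, Finsupp.single_eq_same] at h1
  exact sub_eq_zero.1 h1

theorem monoVal_logExponent {p : MatPair n} (hp : p ∈ minorChart n)
    (c d : RealIdx n ⊕ CplxIdx n ⊕ CplxIdx n) :
    monoVal (logExponent c d) p = minorCoord c p * minorCoord d p := by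
  rw [logExponent, monoVal_add hp, monoVal_single, monoVal_single]

theorem wt_logExponent (c d : RealIdx n ⊕ CplxIdx n ⊕ CplxIdx n) :
    wt η (logExponent c d) = η (actionIdx c) + η (actionIdx d) := by
  rw [logExponent, wt_add, wt_single, wt_single]

/-- The coefficients of the log-canonical part. -/
def coordSlope (c d : RealIdx n ⊕ CplxIdx n ⊕ CplxIdx n) : ℝ :=
  minorSlope (coordSide c) (coordSide d) (coordLabel c).1.1 (coordLabel c).1.2 (coordLabel d).1.1
    (coordLabel d).1.2

/-- The part of the brackets of coordinates which is not log-canonical. -/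
def coordCross (c d : RealIdx n ⊕ CplxIdx n ⊕ CplxIdx n) : MatPair n → ℂ :=
  crossTerm (coordSide c) (coordSide d) (coordLabel c).1.1 (coordLabel c).1.2 (coordLabel d).1.1
    (coordLabel d).1.2

theorem dualBracket_minorCoord (c d : RealIdx n ⊕ CplxIdx n ⊕ CplxIdx n) {p : MatPair n}
    (hp : p ∈ minorChart n) : dualBracket (minorCoord c) (minorCoord d) p =
      (Complex.I * coordSlope c d) * monoVal (logExponent c d) p + coordCross c d p := by
  rw [monoVal_logExponent hp, minorCoord_eq c, minorCoord_eq d]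
  exact dualBracket_solid _ _ (coordLabel c).2.2.1 (coordLabel c).2.2.2 (coordLabel d).2.2.1
    (coordLabel d).2.2.2 (isUnit_snd hp.1)

theorem wtLT_coordCross (hη : Interlacing η) (c d : RealIdx n ⊕ CplxIdx n ⊕ CplxIdx n) :
    WtLT η (η (actionIdx c) + η (actionIdx d)) (coordCross c d) := by
  rw [← solidWt_coordLabel η c, ← solidWt_coordLabel η d]
  exact wtLT_crossTerm hη _ _ (coordLabel c).2.2.1 (coordLabel c).2.2.2 (coordLabel d).2.2.1
    (coordLabel d).2.2.2

theorem IsMinorBracketTable.eval_eq {P : BracketTable (RealIdx n) (CplxIdx n)}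
    (hP : IsMinorBracketTable P) (c d : RealIdx n ⊕ CplxIdx n ⊕ CplxIdx n) :
    ∀ p ∈ minorChart n, (P c d).eval (fun r => minorCoord r p) =
      (Complex.I * coordSlope c d) * monoVal (logExponent c d) p + coordCross c d p :=
  fun p hp => (hP c d p hp).symm.trans (dualBracket_minorCoord c d hp)

theorem IsMinorBracketTable.eq {P P' : BracketTable (RealIdx n) (CplxIdx n)}
    (hP : IsMinorBracketTable P) (hP' : IsMinorBracketTable P') : P' = P := by
  funext c d
  exact ChartLaurent.eq_of_eval_chart fun p hp => (hP' c d p hp).symm.trans (hP c d p hp)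

/-! ### Explicit weights -/

/-- The weights with prescribed `λ^(k)_l`. -/
def etaOf (lam : ℕ → ℕ → ℝ) : RealIdx n ⊕ CplxIdx n → ℝ
  | Sum.inl k => (1 / 2) * ∑ i ∈ Finset.range k.1, lam k.1 (i + 1)
  | Sum.inr a => (1 / 2) * ∑ i ∈ Finset.range a.1.2, lam a.1.1 (i + 1)

theorem solidWt_etaOf (lam : ℕ → ℕ → ℝ) {k l : ℕ} (hl : l ≤ k) (hk : k ≤ n) :
    solidWt (n := n) (etaOf lam) k l = (1 / 2) * ∑ i ∈ Finset.range l, lam k (i + 1) := by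
  rw [solidWt]
  split_ifs with h
  · rw [zetaIdx]
    split_ifs with h'
    · simp only at h'
      subst h'
      rfl
    · rfl
  · obtain rfl : l = 0 := by omega
    simp

theorem rowIneq_etaOf {lam : ℕ → ℕ → ℝ} {k l : ℕ} (hl : l < k) (hk : k < n) :
    RowIneq (n := n) (etaOf lam) k l ↔ lam k (l + 1) < lam (k + 1) (l + 1) := by
  rw [RowIneq, solidWt_etaOf _ (by omega) hk, solidWt_etaOf _ hl hk.le,
    solidWt_etaOf _ (by omega) hk, solidWt_etaOf _ hl.le hk.le, Finset.sum_range_succ,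
    Finset.sum_range_succ]
  constructor <;> intro h <;> linarith

theorem colIneq_etaOf {lam : ℕ → ℕ → ℝ} {k l : ℕ} (hl : l < k) (hk : k < n) :
    ColIneq (n := n) (etaOf lam) k l ↔ lam (k + 1) (l + 2) < lam k (l + 1) := by
  rw [ColIneq, solidWt_etaOf _ (by omega) hk, solidWt_etaOf _ hl hk.le,
    solidWt_etaOf _ (by omega) hk, solidWt_etaOf _ hl.le hk.le, Finset.sum_range_succ,
    Finset.sum_range_succ _ l, Finset.sum_range_succ _ l]
  constructor <;> intro h <;> linarith

/-- A Gelfand-Zeitlin pattern with gaps of size one, with two entries moved. -/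
def shiftedPattern (u v : ℕ × ℕ) (ε : ℝ) (k l : ℕ) : ℝ :=
  (k : ℝ) - 2 * l + (if (k, l) = u then ε else 0) - (if (k, l) = v then ε else 0)

/-- A single interlacing weight suffices to obtain the Laurent expansions and to read off the
log-canonical coefficients, neither of which depends on the weight. -/
theorem interlacing_base : Interlacing (n := n) (etaOf (shiftedPattern (0, 0) (0, 0) 0)) := by
  intro k l hl hk
  rw [rowIneq_etaOf hl hk, colIneq_etaOf hl hk]
  simp only [shiftedPattern, ite_self]
  push_cast
  constructor <;> linarith

variable (n) in
/-- The bracket table of the solid minors exists. -/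
theorem exists_isMinorBracketTable :
    ∃ P : BracketTable (RealIdx n) (CplxIdx n), IsMinorBracketTable P := by
  have h : ∀ c d : RealIdx n ⊕ CplxIdx n ⊕ CplxIdx n, ∃ q : ChartLaurent (RealIdx n) (CplxIdx n),
      ∀ p ∈ minorChart n, dualBracket (minorCoord c) (minorCoord d) p =
        q.eval fun r => minorCoord r p := by
    intro c d
    obtain ⟨q, -, h⟩ := (ExpIn.monoVal (S := Set.univ) (Complex.I * coordSlope c d)
      (m := logExponent c d) (Set.mem_univ _)).add
        ((wtLT_coordCross (interlacing_base (n := n)) c d).subset (Set.subset_univ _))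
    exact ⟨q, fun p hp => (dualBracket_minorCoord c d hp).trans (h p hp).symm⟩
  choose P hP using h
  exact ⟨P, hP⟩

/-- At an interlacing weight the remainder has only monomials lighter than the product of the two
coordinates, so it cannot alter the coefficient of that product. -/
theorem logCoeff_eq {P : BracketTable (RealIdx n) (CplxIdx n)} (hP : IsMinorBracketTable P)
    (c d : RealIdx n ⊕ CplxIdx n ⊕ CplxIdx n) : logCoeff P c d = Complex.I * coordSlope c d :=
  coeff_eq_of_expansion (wtLT_coordCross interlacing_base c d) (by
    simp only [Set.mem_ofPred_eq, wt_logExponent, lt_irrefl, not_false_eq_true]) (hP.eval_eq c d)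

theorem realityConditions {P : BracketTable (RealIdx n) (CplxIdx n)} (hP : IsMinorBracketTable P) :
    RealityConditions P := by
  have h : ∀ c d, (logCoeff P c d).re = 0 := fun c d => by rw [logCoeff_eq hP]; simp
  refine ⟨fun i j => ?_, fun i a => h _ _, fun a b => h _ _, fun a b => h _ _⟩
  -- For two minors of full size the row sets are nested initial segments, so the overlap equals the
  -- smaller size and the slope vanishes.
  rw [logCoeff_eq hP, coordSlope]
  simp [minorSlope, coordSide, coordLabel, overlap]

theorem interlacing_subset {P : BracketTable (RealIdx n) (CplxIdx n)} (hP : IsMinorBracketTable P)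
    (hη : Interlacing η) : η ∈ tropicalCone P := by
  intro c d
  rw [bracketRemainder, logCoeff_eq hP]
  exact sub_single_mem_support (wtLT_coordCross hη c d) _ _ (hP.eval_eq c d)

end

/-! ## The tropical cone -/

section
variable {n : ℕ} {η : RealIdx n ⊕ CplxIdx n → ℝ} {d d' : ℝ}

/-- A dominant monomial in the remainder of a bracket gives an inequality on the tropical cone. -/
theorem wt_lt_of_dominant {P : BracketTable (RealIdx n) (CplxIdx n)} (hP : IsMinorBracketTable P)
    (c c' : RealIdx n ⊕ CplxIdx n ⊕ CplxIdx n) {η₀ : RealIdx n ⊕ CplxIdx n → ℝ} {u : ℂ}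
    (hu : u ≠ 0) (m : RealIdx n ⊕ CplxIdx n ⊕ CplxIdx n → ℤ)
    (hF : WtLT η₀ (wt η₀ m) fun p => coordCross c c' p - u * monoVal m p)
    (hη : η ∈ tropicalCone P) : wt η m < η (actionIdx c) + η (actionIdx c') := by
  refine hη c c' m ?_
  rw [Finsupp.mem_support_iff]
  -- The auxiliary weight `η₀` only serves to isolate the coefficient of `m` and to show that it is
  -- not zero; the resulting condition is then imposed on `η`.
  have hm : m ∉ {m' | wt η₀ m' < wt η₀ m} := by
    simp only [Set.mem_ofPred_eq, lt_irrefl, not_false_eq_true]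
  rw [coeff_eq_of_expansion hF hm fun p hp => ?_]
  · exact hu
  · have h1 := ChartLaurent.eval_add (bracketRemainder P c c')
      (AddMonoidAlgebra.single (logExponent c c') (logCoeff P c c')) (coord_ne_zero hp)
    rw [bracketRemainder, sub_add_cancel, hP.eval_eq c c' p hp, ChartLaurent.eval_single,
      logCoeff_eq hP, ← monoVal] at h1
    rw [bracketRemainder, logCoeff_eq hP]
    linear_combination -h1

/-- The leading term of a sum of products, in which one product dominates. -/
theorem wtLT_dominant_sum {l m : ℕ} {f g : Fin l → ℕ → MatPair n → ℂ} {F G : MatPair n → ℂ}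
    (cond : ℕ → Prop) [DecidablePred cond] (i₀ : Fin l) {y₀ : ℕ} (hy₀ : y₀ < m) (hc : cond y₀)
    (hf : ∀ i y, cond y → i ≠ i₀ ∨ y ≠ y₀ → WtLT η d (f i y))
    (hg : ∀ i y, cond y → i ≠ i₀ ∨ y ≠ y₀ → WtLT η d (g i y))
    (hf₀ : WtLT η d fun p => f i₀ y₀ p - F p) (hg₀ : WtLT η d fun p => g i₀ y₀ p - G p)
    (hF : WtLE η d F) (hG : WtLE η d G) :
    WtLT η (d + d) fun p => (∑ i, ∑ y ∈ Finset.range m,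
      if cond y then f i y p * g i y p else 0) - F p * G p := by
  have h : WtLT η (d + d) fun p => ∑ i, ∑ y ∈ Finset.range m,
      ((if cond y then f i y p * g i y p else 0) -
        if i = i₀ then if y = y₀ then F p * G p else 0 else 0) := by
    refine ExpIn.sum _ fun i _ => ExpIn.sum _ fun y _ => ?_
    by_cases hiy : i = i₀ ∧ y = y₀
    · obtain ⟨rfl, rfl⟩ := hiy
      simp only [if_pos hc, if_true]
      have e1 : WtLT η (d + d) fun p => (f i y p - F p) * (g i y p - G p) := hf₀.mul_le hg₀.le
      exact ((e1.add (hf₀.mul_le hG)).add (hF.mul_lt hg₀)).congr fun p _ => by ring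
    · have e : ∀ p, (if i = i₀ then if y = y₀ then F p * G p else 0 else 0) = 0 := fun p => by
        rw [← ite_and, if_neg hiy]
      simp only [e, sub_zero]
      rw [not_and_or] at hiy
      split_ifs with hy
      · exact (hf i y hy hiy).mul_le (hg i y hy hiy).le
      · exact ExpIn.zero
  refine h.congr fun p _ => ?_
  simp only [Finset.sum_sub_distrib]
  congr 1
  rw [Finset.sum_eq_single i₀ (fun i _ hi => by simp [hi]) (by simp)]
  simp [hy₀]

/-! ### Violated inequality for rows -/

/-- The exponent of `Δ(k+1, l) Δ(k, l+1) / Δ(k, l)`. -/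
def rowExp (n : ℕ) (s : Bool) (k l : ℕ) : RealIdx n ⊕ CplxIdx n ⊕ CplxIdx n → ℤ :=
  solidExp n s (k + 1) l + solidExp n s k (l + 1) + -solidExp n s k l

theorem wt_rowExp (η : RealIdx n ⊕ CplxIdx n → ℝ) (s : Bool) (k l : ℕ) :
    wt η (rowExp n s k l) = solidWt η (k + 1) l + solidWt η k (l + 1) - solidWt η k l := by
  rw [rowExp, wt_add, wt_add, wt_neg, wt_solidExp, wt_solidExp, wt_solidExp, sub_eq_add_neg]

theorem monoVal_rowExp {p : MatPair n} (hp : p ∈ minorChart n) (s : Bool) {k l : ℕ} (hl : l < k)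
    (hk : k < n) : solid (sideArr s p) k l * monoVal (rowExp n s k l) p =
      solid (sideArr s p) (k + 1) l * solid (sideArr s p) k (l + 1) := by
  rw [rowExp, monoVal_add hp, monoVal_add hp, monoVal_neg, monoVal_solidExp hp _ (by omega) hk,
    monoVal_solidExp hp _ hl hk.le, monoVal_solidExp hp _ hl.le hk.le]
  have := solid_ne_zero hp s hl.le hk.le
  field_simp

/-- For `l > 0`, in the three-term relation for position 0 and row k-l-1 one product is exactly
±Δ(k+1,l)Δ(k,l+1), and the other is lighter. For `l = 0` the exchanged minor itself is ±Δ(k,1). The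
sign is the same for `g` and `dualPart`, so it drops out of their product. -/
theorem rowRep_leading {k l : ℕ} (hl : l < k) (hk : k < n)
    (h : ∀ s, RowSmall η s k l)
    (hd : solidWt η (k + 1) (l + 1) ≤
      solidWt η (k + 1) l + solidWt η k (l + 1) - solidWt η k l) :
    ∃ ε : ℂ, ε * ε = 1 ∧ ∀ s,
      WtLT η (solidWt η (k + 1) l + solidWt η k (l + 1) - solidWt η k l) fun p =>
        rowRep (sideArr s p) (k + 1) (l + 1) 0 (k - l - 1) - ε * monoVal (rowExp n s k l) p := by
  obtain ⟨ε, hε, hε'⟩ := rowRep_last_sub_one k l hl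
  rcases l with - | l
  · refine ⟨ε, hε, fun s => ExpIn.zero.congr fun p hp => ?_⟩
    have h1 := monoVal_rowExp hp s hl hk
    have h2 : ∀ k, solid (sideArr s p) k 0 = 1 := by simp [solid, minorOf]
    rw [h2, h2, one_mul, one_mul] at h1
    have h3 : rowRep (sideArr s p) (k + 1) (0 + 1) 0 (k - 0 - 1) = _ := hε' (sideArr s p)
    rw [h1, h3, sub_self]
  · obtain ⟨ε', hε1, hε2⟩ := rowRep_next_zero k l hl.le
    refine ⟨-(ε' * ε), by linear_combination ε * ε * hε1 + hε, fun s => ?_⟩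
    refine WtLT.div_solid s hl.le hk.le (G := fun p => solid (sideArr s p) (k + 1) (l + 1 + 1) *
      rowRep (sideArr s p) k (l + 1) 0 (k - (l + 1) - 1)) ?_ fun p hp => ?_
    · exact ((WtLE.solid s (by omega) hk).mul_lt (h s 0 _ (by omega))).mono (by linarith)
    · have h1 := monoVal_rowExp hp s hl hk
      have h2 := rowRep_castSucc (sideArr s p) hl.le 0 (k - (l + 1) - 1)
      rw [hε', hε2, Fin.castSucc_zero] at h2
      linear_combination h2 + ε' * ε * h1

/-- When the row inequality at (k,l) is allowed to fail, the exchange of the first row for its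
predecessor, made in both minors, outweighs every other row exchange, while all column exchanges
remain lighter than Δ(k+1,l+1) and its conjugate. -/
theorem wtLT_coordCross_row (k l : ℕ) (hl : l < k) (hk : k < n)
    (hr : ∀ k' l', l' < k' → k' < k + 1 → (k', l') ≠ (k, l) → RowIneq η k' l')
    (hc : ∀ k' l', l' < k' → k' < k + 1 → ColIneq η k' l')
    (hd : solidWt η (k + 1) (l + 1) ≤
      solidWt η (k + 1) l + solidWt η k (l + 1) - solidWt η k l)
    (h : 1 ≤ l + 1 ∧ l + 1 < k + 1 ∧ k + 1 ≤ n) :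
    WtLT η (wt η (rowExp n false k l + rowExp n true k l)) fun p =>
      coordCross (Sum.inr (Sum.inl ⟨(k + 1, l + 1), h⟩)) (Sum.inr (Sum.inr ⟨(k + 1, l + 1), h⟩)) p -
        -Complex.I * monoVal (rowExp n false k l + rowExp n true k l) p := by
  have h1 : ∀ s l', RowSmall η s k l' := fun s =>
    rowSmall hk.le fun k' l' h1 h2 => hr k' l' h1 (by omega) (by simp; omega)
  have hG : ∀ l' < l, RowIneq η k l' := fun l' hl' => hr k l' (by omega) (by omega) (by simp; omega)
  have h2 : ∀ s, RowSmall η s (k + 1) l := fun s => rowSmall_level hk (h1 s) hl.le hG l le_rfl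
  have h3 : ∀ s, ColSmall η s (k + 1) (l + 1) := fun s =>
    colSmall hk hc (l + 1) (by omega)
  -- For `l = 0` the two weights coincide. The last row is then also the first one, and its exchange
  -- with the preceding row is the dominant term itself.
  have h4 : l ≠ 0 → solidWt η k (l + 1) <
      solidWt η (k + 1) l + solidWt η k (l + 1) - solidWt η k l := by
    intro h0
    obtain ⟨l, rfl⟩ := Nat.exists_eq_succ_of_ne_zero h0
    have := solidWt_lt_succ hG (Nat.lt_succ_self l)
    simp only [Nat.succ_eq_add_one] at *
    linarith
  obtain ⟨ε, hε, hlead⟩ := rowRep_leading hl hk (fun s => h1 s l) hd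
  set D := solidWt η (k + 1) l + solidWt η k (l + 1) - solidWt η k l with hD
  have hne : ∀ s (i : Fin (l + 1)) x, x < k - l → i ≠ 0 ∨ x ≠ k - l - 1 →
      WtLT η D fun p => rowRep (sideArr s p) (k + 1) (l + 1) i x := by
    intro s i x hx hix
    refine rowRep_lt_of_ne hl hk (h1 s l) (h1 s (l + 1)) (h2 s) hd le_rfl h4 i hx ?_
    exact hix.imp_left fun hi h0 => hi (Fin.ext (by simpa using h0))
  have hmono : ∀ s, WtLE η D fun p => ε * monoVal (rowExp n s k l) p := fun s =>
    ExpIn.monoVal ε (by simp only [Set.mem_ofPred_eq, wt_rowExp, hD, le_refl])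
  have hsum := wtLT_dominant_sum (m := n) (fun x => x < k - l) 0 (y₀ := k - l - 1) (by omega)
    (by omega) (hne false) (hne true) (hlead false) (hlead true) (hmono false) (hmono true)
  rw [wt_add, wt_rowExp, wt_rowExp, ← hD]
  have hcol := (wtLT_colSum (h3 false) (h3 true)).mono (add_le_add hd hd)
  refine ((hcol.const_mul Complex.I).sub (hsum.const_mul Complex.I)).congr fun p hp => ?_
  have e : rowSum n (sideArr false p) (sideArr true p) (k + 1) (l + 1) (k + 1) (l + 1) =
      ∑ i : Fin (l + 1), ∑ x ∈ Finset.range n, if x < k - l then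
        rowRep (sideArr false p) (k + 1) (l + 1) i x *
          rowRep (sideArr true p) (k + 1) (l + 1) i x else 0 := by
    rw [rowSum]
    refine Finset.sum_congr rfl fun i _ => ?_
    rw [Finset.sum_eq_single i]
    · simp only [if_true, and_self, Nat.add_sub_add_right]
    · intro j _ hj
      rw [if_neg fun h' => hj (solidSeq_injective _ _ h').symm]
    · simp
  have e2 : coordCross (Sum.inr (Sum.inl ⟨(k + 1, l + 1), h⟩))
      (Sum.inr (Sum.inr ⟨(k + 1, l + 1), h⟩)) p = Complex.I * colSum n (sideArr false p)
        (sideArr true p) (k + 1) (l + 1) (k + 1) (l + 1) + -Complex.I * rowSum n (sideArr false p)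
        (sideArr true p) (k + 1) (l + 1) (k + 1) (l + 1) := rfl
  rw [e2, e, monoVal_add hp]
  linear_combination Complex.I * monoVal (rowExp n false k l) p * monoVal (rowExp n true k l) p * hε

/-- A test pattern that violates only this inequality makes the monomial of `wtLT_coordCross_row`
visible in the bracket of Δ(k+1,l+1) with its conjugate; the cone condition for this monomial is
twice the row inequality. -/
theorem rowIneq_of_mem_tropicalCone {P : BracketTable (RealIdx n) (CplxIdx n)}
    (hP : IsMinorBracketTable P) (hη : η ∈ tropicalCone P) {k l : ℕ} (hl : l < k) (hk : k < n) :
    RowIneq η k l := by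
  have hc : 1 ≤ l + 1 ∧ l + 1 < k + 1 ∧ k + 1 ≤ n := by omega
  have h := wt_lt_of_dominant hP _ _ (neg_ne_zero.2 Complex.I_ne_zero) _
    -- All gaps of the base pattern are 1. Moving λ^(k)_(l+1) up and λ^(k+1)_(l+1) down by ε makes
    -- the gap between them 1-2ε, while every other gap stays at least 1-ε; any ε strictly between
    -- 1/2 and 1 would do.
    (wtLT_coordCross_row (η := etaOf (shiftedPattern (k, l + 1) (k + 1, l + 1) (7 / 10))) k l hl hk
      (fun k' l' h1 h2 h3 => ?_) (fun k' l' h1 h2 => ?_) ?_ hc) hη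
  · rw [wt_add, wt_rowExp, wt_rowExp, ← solidWt_coordLabel η, ← solidWt_coordLabel η] at h
    change _ < solidWt η (k + 1) (l + 1) + solidWt η (k + 1) (l + 1) at h
    rw [RowIneq]
    linarith
  · rw [rowIneq_etaOf h1 (by omega)]
    simp only [ne_eq, Prod.mk.injEq] at h3
    simp only [shiftedPattern, Prod.mk.injEq]
    push_cast
    split_ifs <;> first | omega | linarith
  · rw [colIneq_etaOf h1 (by omega)]
    simp only [shiftedPattern, Prod.mk.injEq]
    push_cast
    split_ifs <;> first | omega | linarith
  · have := (rowIneq_etaOf (n := n)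
      (lam := shiftedPattern (k, l + 1) (k + 1, l + 1) (7 / 10)) hl hk).not.2 (by
        simp only [shiftedPattern, Prod.mk.injEq]
        push_cast
        split_ifs <;> first | omega | linarith)
    rw [RowIneq] at this
    linarith

/-! ### Violated inequality for columns -/

/-- The exponent of `Δ(k+1, l+2) Δ(k, l) / Δ(k, l+1)`. -/
def colExp (n : ℕ) (s : Bool) (k l : ℕ) : RealIdx n ⊕ CplxIdx n ⊕ CplxIdx n → ℤ :=
  solidExp n s (k + 1) (l + 2) + solidExp n s k l + -solidExp n s k (l + 1)

theorem wt_colExp (η : RealIdx n ⊕ CplxIdx n → ℝ) (s : Bool) (k l : ℕ) :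
    wt η (colExp n s k l) = solidWt η (k + 1) (l + 2) + solidWt η k l - solidWt η k (l + 1) := by
  rw [colExp, wt_add, wt_add, wt_neg, wt_solidExp, wt_solidExp, wt_solidExp, sub_eq_add_neg]

theorem monoVal_colExp {p : MatPair n} (hp : p ∈ minorChart n) (s : Bool) {k l : ℕ} (hl : l < k)
    (hk : k < n) : solid (sideArr s p) k (l + 1) * monoVal (colExp n s k l) p =
      solid (sideArr s p) (k + 1) (l + 2) * solid (sideArr s p) k l := by
  rw [colExp, monoVal_add hp, monoVal_add hp, monoVal_neg, monoVal_solidExp hp _ (by omega) hk,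
    monoVal_solidExp hp _ hl hk.le, monoVal_solidExp hp _ hl.le hk.le]
  have := solid_ne_zero hp s (l := l + 1) hl hk.le
  field_simp

/-- If the last column `l` is exchanged for the adjacent column l+1, the larger minor in
`colRep_last` is Δ(k+1,l+2) itself, while the other product is lighter. -/
theorem colRep_leading {k l : ℕ} (hl : l < k) (hk : k < n)
    (h : ∀ s, ColSmall η s k (l + 1))
    (hd : solidWt η (k + 1) (l + 1) ≤
      solidWt η (k + 1) (l + 2) + solidWt η k l - solidWt η k (l + 1)) :
    ∃ ε : ℂ, ε * ε = 1 ∧ ∀ s,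
      WtLT η (solidWt η (k + 1) (l + 2) + solidWt η k l - solidWt η k (l + 1)) fun p =>
        colRep (sideArr s p) (k + 1) (l + 1) (Fin.last l) (l + 1) -
          ε * monoVal (colExp n s k l) p := by
  obtain ⟨ε, δ, hε, hδ, hrel⟩ := colRep_last k l hl
  refine ⟨δ, hδ, fun s => ?_⟩
  refine WtLT.div_solid s (l := l + 1) hl hk.le (G := fun p => ε *
    (solid (sideArr s p) (k + 1) (l + 1) * colRep (sideArr s p) k (l + 1) (Fin.last l) (l + 1)))
    (ExpIn.const_mul ε ?_) fun p hp => ?_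
  · exact ((WtLE.solid s (by omega) hk).mul_lt (h s (Fin.last l) _ le_rfl)).mono (by linarith)
  · have h1 := monoVal_colExp hp s hl hk
    have h2 := hrel (sideArr s p) (l + 1)
    rw [colRep_self (sideArr s p) (k + 1) (l + 1)] at h2
    linear_combination h2 - δ * h1

/-- The counterpart for columns: the dominant term exchanges the last column for the adjacent one in
both minors. Column sums enter the remainder with the opposite sign to row sums, hence the
coefficient i. -/
theorem wtLT_coordCross_col (k l : ℕ) (hl : l < k) (hk : k < n)
    (hr : ∀ k' l', l' < k' → k' < k + 1 → RowIneq η k' l')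
    (hc : ∀ k' l', l' < k' → k' < k + 1 → (k', l') ≠ (k, l) → ColIneq η k' l')
    (hd : solidWt η (k + 1) (l + 1) ≤
      solidWt η (k + 1) (l + 2) + solidWt η k l - solidWt η k (l + 1))
    (h : 1 ≤ l + 1 ∧ l + 1 < k + 1 ∧ k + 1 ≤ n) :
    WtLT η (wt η (colExp n false k l + colExp n true k l)) fun p =>
      coordCross (Sum.inr (Sum.inl ⟨(k + 1, l + 1), h⟩)) (Sum.inr (Sum.inr ⟨(k + 1, l + 1), h⟩)) p -
        Complex.I * monoVal (colExp n false k l + colExp n true k l) p := by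
  have h1 : ∀ s, ∀ l' ≤ k, ColSmall η s k l' := fun s =>
    colSmall hk.le fun k' l' h1 h2 => hc k' l' h1 (by omega) (by simp; omega)
  have h2 : ∀ s, ColSmall η s (k + 1) (l + 2) := fun s =>
    colSmall_level (l₀ := l + 1) hk (h1 s)
      (fun l' h1 h2 => hc k l' h2 (by omega) (by simp; omega)) (k - (l + 1)) (l + 1) (by omega) le_rfl
  have h3 : ∀ s, RowSmall η s (k + 1) (l + 1) := fun s => rowSmall hk hr (l + 1)
  obtain ⟨ε, hε, hlead⟩ := colRep_leading hl hk (fun s => h1 s (l + 1) hl) hd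
  set D := solidWt η (k + 1) (l + 2) + solidWt η k l - solidWt η k (l + 1) with hD
  have hmono : ∀ s, WtLE η D fun p => ε * monoVal (colExp n s k l) p := fun s =>
    ExpIn.monoVal ε (by simp only [Set.mem_ofPred_eq, wt_colExp, hD, le_refl])
  have hlast : ∀ s y, l + 1 < y →
      WtLT η D fun p => colRep (sideArr s p) (k + 1) (l + 1) (Fin.last l) y := fun s y hy =>
    colRep_last_of_gt hl hk (h1 s (l + 1) hl) hd hD.symm.le hy.le (Or.inl (h2 s _ y hy))
  have hlast' : ∀ s y, l + 1 ≤ y →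
      WtLE η D fun p => colRep (sideArr s p) (k + 1) (l + 1) (Fin.last l) y := by
    intro s y hy
    rcases hy.eq_or_lt with rfl | hy
    · exact ((hlead s).le.add (hmono s)).congr fun p _ => sub_add_cancel _ _
    · exact (hlast s y hy).le
  have hne : ∀ s (i : Fin (l + 1)) y, l + 1 ≤ y → i ≠ Fin.last l ∨ y ≠ l + 1 →
      WtLT η D fun p => colRep (sideArr s p) (k + 1) (l + 1) i y := by
    intro s i y hy
    refine Fin.lastCases (fun hiy => ?_) (fun i _ => ?_) i
    · exact hlast s y (lt_of_le_of_ne hy (hiy.resolve_left (by simp)).symm)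
    · exact colRep_castSucc_lt hl.le hk (h1 s l hl.le) hd i (by omega) (hlast' s y hy)
  have hsum := wtLT_dominant_sum (m := n) (fun y => l + 1 ≤ y) (Fin.last l) (y₀ := l + 1) (by omega)
    le_rfl (hne false) (hne true) (hlead false) (hlead true) (hmono false) (hmono true)
  rw [wt_add, wt_colExp, wt_colExp, ← hD]
  have hrow := (wtLT_rowSum (h3 false) (h3 true)).mono (add_le_add hd hd)
  refine ((hsum.const_mul Complex.I).sub (hrow.const_mul Complex.I)).congr fun p hp => ?_
  have e : colSum n (sideArr false p) (sideArr true p) (k + 1) (l + 1) (k + 1) (l + 1) =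
      ∑ i : Fin (l + 1), ∑ y ∈ Finset.range n, if l + 1 ≤ y then
        colRep (sideArr false p) (k + 1) (l + 1) i y *
          colRep (sideArr true p) (k + 1) (l + 1) i y else 0 := by
    rw [colSum]
    refine Finset.sum_congr rfl fun i _ => ?_
    rw [Finset.sum_eq_single i]
    · simp only [if_true, and_self]
    · intro j _ hj
      rw [if_neg fun h' => hj (Fin.ext h').symm]
    · simp
  have e2 : coordCross (Sum.inr (Sum.inl ⟨(k + 1, l + 1), h⟩))
      (Sum.inr (Sum.inr ⟨(k + 1, l + 1), h⟩)) p = Complex.I * colSum n (sideArr false p)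
        (sideArr true p) (k + 1) (l + 1) (k + 1) (l + 1) + -Complex.I * rowSum n (sideArr false p)
        (sideArr true p) (k + 1) (l + 1) (k + 1) (l + 1) := rfl
  rw [e2, e, monoVal_add hp]
  linear_combination -Complex.I * monoVal (colExp n false k l) p * monoVal (colExp n true k l) p * hε

theorem colIneq_of_mem_tropicalCone {P : BracketTable (RealIdx n) (CplxIdx n)}
    (hP : IsMinorBracketTable P) (hη : η ∈ tropicalCone P) {k l : ℕ} (hl : l < k) (hk : k < n) :
    ColIneq η k l := by
  have hc : 1 ≤ l + 1 ∧ l + 1 < k + 1 ∧ k + 1 ≤ n := by omega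
  have h := wt_lt_of_dominant hP _ _ Complex.I_ne_zero _
    -- Now λ^(k+1)_(l+2) is moved up and λ^(k)_(l+1) down, so that only the inequality between these
    -- two fails.
    (wtLT_coordCross_col (η := etaOf (shiftedPattern (k + 1, l + 2) (k, l + 1) (7 / 10))) k l hl hk
      (fun k' l' h1 h2 => ?_) (fun k' l' h1 h2 h3 => ?_) ?_ hc) hη
  · rw [wt_add, wt_colExp, wt_colExp, ← solidWt_coordLabel η, ← solidWt_coordLabel η] at h
    change _ < solidWt η (k + 1) (l + 1) + solidWt η (k + 1) (l + 1) at h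
    rw [ColIneq]
    linarith
  · rw [rowIneq_etaOf h1 (by omega)]
    simp only [shiftedPattern, Prod.mk.injEq]
    push_cast
    split_ifs <;> first | omega | linarith
  · rw [colIneq_etaOf h1 (by omega)]
    simp only [ne_eq, Prod.mk.injEq] at h3
    simp only [shiftedPattern, Prod.mk.injEq]
    push_cast
    split_ifs <;> first | omega | linarith
  · have := (colIneq_etaOf (n := n)
      (lam := shiftedPattern (k + 1, l + 2) (k, l + 1) (7 / 10)) hl hk).not.2 (by
        simp only [shiftedPattern, Prod.mk.injEq]
        push_cast
        split_ifs <;> first | omega | linarith)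
    rw [ColIneq] at this
    linarith

theorem mem_tropicalCone_iff {P : BracketTable (RealIdx n) (CplxIdx n)}
    (hP : IsMinorBracketTable P) : η ∈ tropicalCone P ↔ Interlacing η :=
  ⟨fun h _ _ hl hk => ⟨rowIneq_of_mem_tropicalCone hP h hl hk,
    colIneq_of_mem_tropicalCone hP h hl hk⟩, interlacing_subset hP⟩

/-! ### The pairing of actions and angles -/

/-- The pairing of `ζ^(k)_l` and `φ^(p)_q` is `-1/2` times this number. -/
def pairNumber (k l p q : ℕ) : ℕ := min l q - (k + q - p)

/-- The slopes against φ's coordinate and against its conjugate cancel if the rows [p-q,p) lie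
weakly to the left of [k-l,k), and otherwise add up to minus the number of non-common rows of the
smaller minor. For l = k the first case is excluded by q < p, so the real coordinates, whose pairing
is defined without the factor 1/2, obey the same formula. -/
theorem tropicalPairing_eq {P : BracketTable (RealIdx n) (CplxIdx n)}
    (hP : IsMinorBracketTable P) (j : TriIdx n) (a : CplxIdx n) :
    tropicalPairing P (zetaIdx j) a = -(1 / 2) * (pairNumber j.1.1 j.1.2 a.1.1 a.1.2 : ℝ) := by
  obtain ⟨⟨k, l⟩, h1, h2, h3⟩ := j
  obtain ⟨⟨p, q⟩, g1, g2, g3⟩ := a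
  simp only at h1 h2 h3 g1 g2 g3 ⊢
  have him : ∀ c d, (logCoeff P c d).im = coordSlope c d := fun c d => by
    rw [logCoeff_eq hP]; simp
  have hov : (p ≤ k ∧ p - q ≤ k - l → pairNumber k l p q = 0) ∧
      (¬(p ≤ k ∧ p - q ≤ k - l) → min l q = overlap k l p q + pairNumber k l p q) := by
    rw [pairNumber, overlap]
    omega
  rw [zetaIdx]
  split_ifs with h
  · simp only at h
    subst h
    rw [tropicalPairing, him]
    have : ¬(p ≤ l ∧ p - q ≤ l - l) := by omega
    simp only [coordSlope, coordSide, coordLabel, CplxIdx.tri, minorSlope]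
    rw [if_neg this, hov.2 this]
    push_cast
    ring
  · rw [tropicalPairing, Complex.sub_im, him, him]
    simp only [coordSlope, coordSide, coordLabel, CplxIdx.tri, minorSlope]
    by_cases h' : p ≤ k ∧ p - q ≤ k - l
    · rw [if_pos h', hov.1 h']
      push_cast
      ring
    · rw [if_neg h', hov.2 h']
      push_cast
      ring

end

/-! ## Maps between cones times tori with a linear lift -/

section Torus
open TorusSystem
variable {α κ β μ : Type*}

/-- The homomorphism of tori given by an integer matrix. -/
def angleMap [Fintype κ] (M : Matrix μ κ ℤ) (x : κ → Real.Angle) : μ → Real.Angle :=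
  fun a => ∑ q, M a q • x q

/-- The lift of `angleMap` to universal covers. -/
def angleLift [Fintype κ] (M : Matrix μ κ ℤ) : (κ → ℝ) →ₗ[ℝ] (μ → ℝ) where
  toFun x a := ∑ q, (M a q : ℝ) * x q
  map_add' x y := by ext a; simp [mul_add, Finset.sum_add_distrib]
  map_smul' c x := by ext a; simp [Finset.mul_sum, mul_left_comm]

theorem angleMap_coe [Fintype κ] (M : Matrix μ κ ℤ) (x : κ → ℝ) :
    angleMap M (fun q => (x q : Real.Angle)) = fun a => (angleLift M x a : Real.Angle) := by
  ext a
  simp only [angleMap, angleLift, LinearMap.coe_mk, AddHom.coe_mk]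
  have h : ((∑ q, (M a q : ℝ) * x q : ℝ) : Real.Angle) = ∑ q, ((M a q * x q : ℝ) : Real.Angle) :=
    map_sum Real.Angle.coeHom _ _
  rw [h]
  exact Finset.sum_congr rfl fun q _ => by rw [← zsmul_eq_mul, Real.Angle.coe_zsmul]

theorem angleMap_mul [Fintype κ] [Fintype μ] {ν : Type*} (M' : Matrix ν μ ℤ) (M : Matrix μ κ ℤ)
    (x : κ → Real.Angle) : angleMap M' (angleMap M x) = angleMap (M' * M) x := by
  ext a
  simp only [angleMap, Matrix.mul_apply, Finset.smul_sum, Finset.sum_smul, mul_smul]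
  exact Finset.sum_comm

theorem angleMap_one [Fintype κ] [DecidableEq κ] (x : κ → Real.Angle) :
    angleMap (1 : Matrix κ κ ℤ) x = x := by
  ext a
  rw [angleMap, Finset.sum_eq_single a]
  · simp
  · intro b _ hb
    rw [Matrix.one_apply_ne hb.symm, zero_smul]
  · simp

theorem exists_angle_lift (x : κ → Real.Angle) : ∃ q : κ → ℝ, x = fun a => (q a : Real.Angle) := by
  have h : ∀ a, ∃ r : ℝ, x a = r := fun a => by
    induction x a using Real.Angle.induction_on with
    | _ r => exact ⟨r, rfl⟩
  choose q hq using h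
  exact ⟨q, funext hq⟩

/-- The pull-back of a function to the universal cover. -/
def liftFun (X : TorusSystem α κ) (F : X.Points → ℝ) (q : (α → ℝ) × (κ → ℝ)) : ℝ :=
  Function.extend Subtype.val F 0 (q.1, fun a => (q.2 a : Real.Angle))

theorem liftFun_apply {X : TorusSystem α κ} (F : X.Points → ℝ) {y : α → ℝ} (hy : y ∈ X.cone)
    (q : κ → ℝ) : liftFun X F (y, q) = F ⟨(y, fun a => (q a : Real.Angle)), hy, Set.mem_univ _⟩ :=
  Subtype.val_injective.extend_apply F 0
    ⟨(y, fun a => (q a : Real.Angle)), hy, Set.mem_univ _⟩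

/-- The direction of a coordinate. -/
def coordDir [DecidableEq α] [DecidableEq κ] : α ⊕ κ → (α → ℝ) × (κ → ℝ)
  | Sum.inl j => (Pi.single j 1, 0)
  | Sum.inr a => (0, Pi.single a 1)

/-- The map of cones times tori is given by a linear map and an integer matrix. -/
def HasLinearLift [Fintype κ] {X : TorusSystem α κ} {Y : TorusSystem β μ}
    (Φ : X.Points → Y.Points) (A : (α → ℝ) →ₗ[ℝ] (β → ℝ)) (M : Matrix μ κ ℤ) : Prop :=
  ∀ x, (Φ x).1 = (A x.1.1, angleMap M x.1.2)

variable {X : TorusSystem α κ} {Y : TorusSystem β μ}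

theorem isOpen_lift_domain (X : TorusSystem α κ) :
    IsOpen (X.cone ×ˢ (Set.univ : Set (κ → ℝ))) := X.isOpen_cone.prod isOpen_univ

theorem liftFun_action (j : α) :
    Set.EqOn (liftFun X fun x => x.1.1 j) (fun q => q.1 j) (X.cone ×ˢ Set.univ) := by
  rintro ⟨y, q⟩ ⟨hy, -⟩
  rw [liftFun_apply _ hy]

theorem liftFun_sin (a : κ) :
    Set.EqOn (liftFun X fun x => (x.1.2 a).sin) (fun q => Real.sin (q.2 a))
      (X.cone ×ˢ Set.univ) := by
  rintro ⟨y, q⟩ ⟨hy, -⟩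
  rw [liftFun_apply _ hy, Real.Angle.sin_coe]

theorem HasLinearLift.apply [Fintype κ] {Φ : X.Points → Y.Points}
    {A : (α → ℝ) →ₗ[ℝ] (β → ℝ)} {M : Matrix μ κ ℤ} (h : HasLinearLift Φ A M)
    {y : α → ℝ} (hy : y ∈ X.cone) (q : κ → ℝ) :
    ∃ hy' : A y ∈ Y.cone, Φ ⟨(y, fun a => (q a : Real.Angle)), hy, Set.mem_univ _⟩ =
      ⟨(A y, fun a => (angleLift M q a : Real.Angle)), hy', Set.mem_univ _⟩ := by
  have h1 := h ⟨(y, fun a => (q a : Real.Angle)), hy, Set.mem_univ _⟩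
  simp only [angleMap_coe] at h1
  have h2 := (Φ ⟨(y, fun a => (q a : Real.Angle)), hy, Set.mem_univ _⟩).2.1
  rw [h1] at h2
  exact ⟨h2, Subtype.ext h1⟩

theorem sum_push_forward [Fintype α] [Fintype κ] [Fintype β] [Fintype μ] (A : β → α → ℝ)
    (B : α → κ → ℝ) (M : μ → κ → ℝ) (f : β → ℝ) (h : μ → ℝ) :
    ∑ j, ∑ a, B j a * ((∑ j', A j' j * f j') * ∑ a', M a' a * h a') =
      ∑ j', ∑ a', (∑ j, ∑ a, A j' j * B j a * M a' a) * (f j' * h a') := by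
  have h1 : ∀ j a, B j a * ((∑ j', A j' j * f j') * ∑ a', M a' a * h a') =
      ∑ p : β × μ, A p.1 j * B j a * M p.2 a * (f p.1 * h p.2) := by
    intro j a
    rw [Finset.sum_mul_sum, Fintype.sum_prod_type, Finset.mul_sum]
    refine Finset.sum_congr rfl fun j' _ => ?_
    rw [Finset.mul_sum]
    exact Finset.sum_congr rfl fun a' _ => by ring
  have h2 : ∀ j' a', (∑ j, ∑ a, A j' j * B j a * M a' a) * (f j' * h a') =
      ∑ p : α × κ, A j' p.1 * B p.1 p.2 * M a' p.2 * (f j' * h a') := by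
    intro j' a'
    rw [Fintype.sum_prod_type, Finset.sum_mul]
    exact Finset.sum_congr rfl fun j _ => Finset.sum_mul _ _ _
  simp only [h1, h2]
  rw [← Fintype.sum_prod_type' fun j a => ∑ p : β × μ, A p.1 j * B j a * M p.2 a * (f p.1 * h p.2),
    ← Fintype.sum_prod_type' fun j' a' => ∑ p : α × κ, A j' p.1 * B p.1 p.2 * M a' p.2 *
      (f j' * h a'), Finset.sum_comm]

/-- The lift of a map. -/
def torusLift [Fintype α] [Fintype κ] (A : (α → ℝ) →ₗ[ℝ] (β → ℝ)) (M : Matrix μ κ ℤ) :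
    (α → ℝ) × (κ → ℝ) →L[ℝ] (β → ℝ) × (μ → ℝ) :=
  LinearMap.toContinuousLinearMap (A.prodMap (angleLift M))

theorem torusLift_apply [Fintype α] [Fintype κ] (A : (α → ℝ) →ₗ[ℝ] (β → ℝ))
    (M : Matrix μ κ ℤ) (y : α → ℝ) (q : κ → ℝ) :
    torusLift A M (y, q) = (A y, angleLift M q) := rfl

theorem smooth_action [Fintype α] [Fintype κ] (X : TorusSystem α κ) (j : α) :
    X.Smooth fun x => x.1.1 j :=
  ContDiffOn.congr (by fun_prop) (liftFun_action j)

theorem smooth_sin [Fintype α] [Fintype κ] (X : TorusSystem α κ) (a : κ) :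
    X.Smooth fun x => (x.1.2 a).sin :=
  ContDiffOn.congr (by fun_prop) (liftFun_sin a)

theorem HasLinearLift.liftFun_comp [Fintype α] [Fintype κ] {Φ : X.Points → Y.Points}
    {A : (α → ℝ) →ₗ[ℝ] (β → ℝ)} {M : Matrix μ κ ℤ} (h : HasLinearLift Φ A M) (F : Y.Points → ℝ) :
    Set.EqOn (liftFun X (F ∘ Φ)) (liftFun Y F ∘ torusLift A M) (X.cone ×ˢ Set.univ) := by
  rintro ⟨y, q⟩ ⟨hy, -⟩
  obtain ⟨hy', h1⟩ := h.apply hy q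
  rw [liftFun_apply _ hy, Function.comp_apply, Function.comp_apply, torusLift_apply,
    liftFun_apply _ hy', h1]

variable [Fintype α] [Fintype κ] [Fintype β] [Fintype μ]

theorem TorusSystem.Smooth.differentiableAt {F : X.Points → ℝ} (hF : X.Smooth F) {y : α → ℝ}
    (hy : y ∈ X.cone) (q : κ → ℝ) : DifferentiableAt ℝ (liftFun X F) (y, q) :=
  (hF.contDiffAt ((isOpen_lift_domain X).mem_nhds ⟨hy, Set.mem_univ _⟩)).differentiableAt (by simp)

theorem partialDeriv_eq_fderiv [DecidableEq α] [DecidableEq κ] {F : X.Points → ℝ} (hF : X.Smooth F)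
    {y : α → ℝ} (hy : y ∈ X.cone) (q : κ → ℝ) (u : α ⊕ κ) :
    X.partialDeriv u F ⟨(y, fun a => (q a : Real.Angle)), hy, Set.mem_univ _⟩ =
      fderiv ℝ (liftFun X F) (y, q) (coordDir u) := by
  rw [← (hF.differentiableAt hy q).lineDeriv_eq_fderiv, lineDeriv, partialDeriv]
  congr 1
  ext s
  rw [liftFun]
  congr 1
  rcases u with j | a
  · ext b
    · simp [TorusSystem.translate, coordDir, Pi.single_apply]
    · simp [TorusSystem.translate, coordDir]
  · ext b
    · simp [TorusSystem.translate, coordDir]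
    · by_cases h : b = a
      · subst h; simp [TorusSystem.translate, coordDir]
      · simp [TorusSystem.translate, coordDir, h]

variable {Φ : X.Points → Y.Points} {A : (α → ℝ) →ₗ[ℝ] (β → ℝ)} {M : Matrix μ κ ℤ}

theorem HasLinearLift.smooth_comp (h : HasLinearLift Φ A M) {F : Y.Points → ℝ} (hF : Y.Smooth F) :
    X.Smooth (F ∘ Φ) := by
  refine ContDiffOn.congr ?_ (h.liftFun_comp F)
  refine ContDiffOn.comp hF (torusLift A M).contDiff.contDiffOn ?_
  rintro ⟨y, q⟩ ⟨hy, -⟩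
  exact ⟨(h.apply hy q).1, Set.mem_univ _⟩

variable [DecidableEq α] [DecidableEq κ] [DecidableEq β] [DecidableEq μ]

/-- The chain rule on the universal cover, where the map is linear with constant differential. -/
theorem HasLinearLift.partialDeriv_comp (h : HasLinearLift Φ A M) {F : Y.Points → ℝ}
    (hF : Y.Smooth F) (x : X.Points) :
    (∀ j, X.partialDeriv (Sum.inl j) (F ∘ Φ) x =
      ∑ j', A (Pi.single j 1) j' * Y.partialDeriv (Sum.inl j') F (Φ x)) ∧
    ∀ a, X.partialDeriv (Sum.inr a) (F ∘ Φ) x =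
      ∑ a', (M a' a : ℝ) * Y.partialDeriv (Sum.inr a') F (Φ x) := by
  obtain ⟨⟨y, t⟩, hy, -⟩ := x
  obtain ⟨q, rfl⟩ := exists_angle_lift t
  obtain ⟨hy', h1⟩ := h.apply hy q
  have key : ∀ u, X.partialDeriv u (F ∘ Φ) ⟨(y, fun a => (q a : Real.Angle)), hy, Set.mem_univ _⟩ =
      fderiv ℝ (liftFun Y F) (A y, angleLift M q) (torusLift A M (coordDir u)) := by
    intro u
    rw [partialDeriv_eq_fderiv (h.smooth_comp hF) hy, Filter.EventuallyEq.fderiv_eq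
      ((h.liftFun_comp F).eventuallyEq_of_mem ((isOpen_lift_domain X).mem_nhds
        ⟨hy, Set.mem_univ _⟩)), fderiv_comp (y, q) (g := liftFun Y F) (f := torusLift A M)
      (hF.differentiableAt hy' _)
      (torusLift A M).differentiableAt, (torusLift A M).fderiv]
    rfl
  rw [h1]
  constructor
  · intro j
    have e : torusLift A M (coordDir (Sum.inl j)) =
        ∑ j', A (Pi.single j 1) j' • (coordDir (Sum.inl j') : (β → ℝ) × (μ → ℝ)) := by
      rw [coordDir, torusLift_apply, map_zero]
      refine Prod.ext ?_ ?_
      · rw [Prod.fst_sum]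
        ext b
        simp [coordDir, Pi.single_apply]
      · rw [Prod.snd_sum]
        simp [coordDir]
    rw [key, e, map_sum]
    exact Finset.sum_congr rfl fun j' _ => by
      rw [map_smul, smul_eq_mul, partialDeriv_eq_fderiv hF hy']
  · intro a
    have e : torusLift A M (coordDir (Sum.inr a)) =
        ∑ a', (M a' a : ℝ) • (coordDir (Sum.inr a') : (β → ℝ) × (μ → ℝ)) := by
      rw [coordDir, torusLift_apply, map_zero]
      refine Prod.ext ?_ ?_
      · rw [Prod.fst_sum]
        simp [coordDir]
      · rw [Prod.snd_sum]
        ext b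
        simp [coordDir, Pi.single_apply, angleLift]
    rw [key, e, map_sum]
    exact Finset.sum_congr rfl fun j' _ => by
      rw [map_smul, smul_eq_mul, partialDeriv_eq_fderiv hF hy']


/-- The bracket of an action-angle system. -/
theorem bracket_actionAngle {B : α → κ → ℝ} (hX : X.tensor = actionAngleTensor B)
    (F H : X.Points → ℝ) (x : X.Points) : X.bracket F H x = ∑ j, ∑ a, B j a *
      (X.partialDeriv (Sum.inl j) F x * X.partialDeriv (Sum.inr a) H x -
        X.partialDeriv (Sum.inl j) H x * X.partialDeriv (Sum.inr a) F x) := by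
  rw [bracket, hX]
  simp only [Fintype.sum_sum_type, actionAngleTensor, zero_mul, Finset.sum_const_zero, zero_add,
    add_zero]
  rw [Finset.sum_comm (s := (Finset.univ : Finset κ)), ← Finset.sum_add_distrib]
  refine Finset.sum_congr rfl fun j _ => ?_
  rw [← Finset.sum_add_distrib]
  exact Finset.sum_congr rfl fun a _ => by ring

/-- Push-forward of the constant bracket of an action-angle system. -/
theorem HasLinearLift.bracket_comp (h : HasLinearLift Φ A M) {B : α → κ → ℝ}
    (hX : X.tensor = actionAngleTensor B) {F H : Y.Points → ℝ} (hF : Y.Smooth F) (hH : Y.Smooth H)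
    (x : X.Points) : X.bracket (F ∘ Φ) (H ∘ Φ) x = ∑ j', ∑ a',
      (∑ j, ∑ a, A (Pi.single j 1) j' * B j a * M a' a) *
        (Y.partialDeriv (Sum.inl j') F (Φ x) * Y.partialDeriv (Sum.inr a') H (Φ x) -
          Y.partialDeriv (Sum.inl j') H (Φ x) * Y.partialDeriv (Sum.inr a') F (Φ x)) := by
  rw [bracket_actionAngle hX]
  simp only [(h.partialDeriv_comp hF x).1, (h.partialDeriv_comp hF x).2,
    (h.partialDeriv_comp hH x).1, (h.partialDeriv_comp hH x).2, mul_sub, Finset.sum_sub_distrib]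
  rw [sum_push_forward (fun j' j => A (Pi.single j 1) j') B fun a' a => (M a' a : ℝ),
    sum_push_forward (fun j' j => A (Pi.single j 1) j') B fun a' a => (M a' a : ℝ)]

/-- Both bivectors and the differential of the map are constant, so invariance of the bracket is an
identity of matrices. The linear lift of the inverse gives the converse half of the comparison of
smooth functions. -/
theorem isPoissonIso_of_hasLinearLift {Φ : X.Points ≃ Y.Points} {A' : (β → ℝ) →ₗ[ℝ] (α → ℝ)}
    {M' : Matrix κ μ ℤ} (h : HasLinearLift Φ A M) (h' : HasLinearLift Φ.symm A' M')
    {B : α → κ → ℝ} (hX : X.tensor = actionAngleTensor B) {C : β → μ → ℝ}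
    (hY : Y.tensor = actionAngleTensor C)
    (hBC : ∀ j' a', ∑ j, ∑ a, A (Pi.single j 1) j' * B j a * M a' a = C j' a') :
    IsPoissonIso Φ := by
  refine ⟨fun F => ⟨fun hF => h.smooth_comp hF, fun hF => ?_⟩, fun F H hF hH x => ?_⟩
  · have := h'.smooth_comp hF
    rwa [Function.comp_assoc, Equiv.self_comp_symm, Function.comp_id] at this
  · rw [h.bracket_comp hX hF hH, bracket_actionAngle hY]
    simp only [hBC]

theorem partialDeriv_action (j : α) (u : α ⊕ κ) (x : X.Points) :
    X.partialDeriv u (fun x => x.1.1 j) x = if u = Sum.inl j then 1 else 0 := by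
  obtain ⟨⟨y, t⟩, hy, -⟩ := x
  obtain ⟨q, rfl⟩ := exists_angle_lift t
  rw [partialDeriv_eq_fderiv (smooth_action X j) hy, Filter.EventuallyEq.fderiv_eq
    ((liftFun_action j).eventuallyEq_of_mem ((isOpen_lift_domain X).mem_nhds ⟨hy, Set.mem_univ _⟩))]
  have h : HasFDerivAt (fun q : (α → ℝ) × (κ → ℝ) => q.1 j)
      ((ContinuousLinearMap.proj j).comp (ContinuousLinearMap.fst ℝ (α → ℝ) (κ → ℝ))) (y, q) :=
    ((ContinuousLinearMap.proj j).comp (ContinuousLinearMap.fst ℝ (α → ℝ) (κ → ℝ))).hasFDerivAt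
  rw [h.fderiv]
  rcases u with i | b <;> simp [coordDir, Pi.single_apply, eq_comm]

/-- An angle is not a real function on the torus; its sine is, and at angle 0 both have the same
differential. -/
theorem partialDeriv_sin (a : κ) (u : α ⊕ κ) (x : X.Points) (hx : x.1.2 = 0) :
    X.partialDeriv u (fun x => (x.1.2 a).sin) x = if u = Sum.inr a then 1 else 0 := by
  revert hx
  obtain ⟨⟨y, t⟩, hy, -⟩ := x
  intro hx
  have ht : t = fun a => ((0 : κ → ℝ) a : Real.Angle) := by
    ext b; simpa using congrFun hx b
  clear hx
  subst ht
  rw [partialDeriv_eq_fderiv (smooth_sin X a) hy, Filter.EventuallyEq.fderiv_eq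
    ((liftFun_sin a).eventuallyEq_of_mem ((isOpen_lift_domain X).mem_nhds ⟨hy, Set.mem_univ _⟩))]
  have h : HasFDerivAt (fun q : (α → ℝ) × (κ → ℝ) => q.2 a)
      ((ContinuousLinearMap.proj a).comp (ContinuousLinearMap.snd ℝ (α → ℝ) (κ → ℝ))) (y, 0) :=
    ((ContinuousLinearMap.proj a).comp (ContinuousLinearMap.snd ℝ (α → ℝ) (κ → ℝ))).hasFDerivAt
  rw [h.sin.fderiv]
  rcases u with i | b <;> simp [coordDir, Pi.single_apply, eq_comm]

/-- A Poisson isomorphism with a linear lift preserves the constant pairing. -/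
theorem pairing_of_isPoissonIso {Φ : X.Points ≃ Y.Points} (h : HasLinearLift Φ A M)
    {B : α → κ → ℝ} (hX : X.tensor = actionAngleTensor B) {C : β → μ → ℝ}
    (hY : Y.tensor = actionAngleTensor C) (hΦ : IsPoissonIso Φ) (hne : X.cone.Nonempty)
    (j' : β) (a' : μ) : ∑ j, ∑ a, A (Pi.single j 1) j' * B j a * M a' a = C j' a' := by
  obtain ⟨y, hy⟩ := hne
  -- A homomorphism of tori fixes the origin, so sines can be used as angle coordinates both at this
  -- point and at its image.
  let x : X.Points := ⟨(y, 0), hy, Set.mem_univ _⟩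
  have hx : (Φ x).1.2 = 0 := by
    rw [h x]
    ext a
    simp [angleMap, x]
  have h1 := hΦ.2 _ _ (smooth_action Y j') (smooth_sin Y a') x
  rw [h.bracket_comp hX (smooth_action Y j') (smooth_sin Y a'), bracket_actionAngle hY] at h1
  simpa [partialDeriv_action, partialDeriv_sin _ _ _ hx] using h1

end Torus

/-! ## Comparison with the Gelfand-Zeitlin system -/

section
variable {n : ℕ}

/-- The label of an action variable. -/
def triLabel : RealIdx n ⊕ CplxIdx n → TriIdx n
  | Sum.inl k => ⟨(k.1, k.1), k.2.1, le_rfl, k.2.2⟩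
  | Sum.inr a => a.tri

theorem zetaIdx_triLabel (r : RealIdx n ⊕ CplxIdx n) : zetaIdx (triLabel r) = r := by
  rcases r with k | a
  · simp [triLabel, zetaIdx]
  · exact dif_neg a.2.2.1.ne

theorem triLabel_zetaIdx (j : TriIdx n) : triLabel (zetaIdx j) = j := by
  obtain ⟨⟨k, l⟩, h⟩ := j
  rw [zetaIdx]
  split_ifs with h'
  · simp only at h'
    subst h'
    rfl
  · rfl

/-- A triangular pattern as a function of two natural numbers. -/
def patternOf {R : Type*} [Zero R] (x : TriIdx n → R) (k l : ℕ) : R :=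
  if h : 1 ≤ l ∧ l ≤ k ∧ k ≤ n then x ⟨(k, l), h⟩ else 0

theorem patternOf_apply {R : Type*} [Zero R] (x : TriIdx n → R) (i : TriIdx n) :
    patternOf x i.1.1 i.1.2 = x i := dif_pos i.2

theorem sum_row {R : Type*} [AddCommMonoid R] (x : TriIdx n → R) {k l : ℕ} (hl : l ≤ k)
    (hk : k ≤ n) : ∑ i : TriIdx n with i.1.1 = k ∧ i.1.2 ≤ l, x i =
      ∑ i ∈ Finset.range l, patternOf x k (i + 1) := by
  refine Finset.sum_bij' (fun i _ => i.1.2 - 1)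
    (fun i hi => ⟨(k, i + 1), by rw [Finset.mem_range] at hi; dsimp only; omega⟩) ?_ ?_ ?_ ?_ ?_
  · intro i hi
    have := i.2
    simp only [Finset.mem_filter] at hi
    rw [Finset.mem_range]
    omega
  · intro i hi
    rw [Finset.mem_range] at hi
    simp only [Finset.mem_filter, Finset.mem_univ, true_and]
    omega
  · intro i hi
    have := i.2
    simp only [Finset.mem_filter, Finset.mem_univ, true_and] at hi
    refine Subtype.ext (Prod.ext hi.1.symm ?_)
    simp only
    omega
  · intro i hi
    simp
  · intro i hi
    have := i.2
    simp only [Finset.mem_filter, Finset.mem_univ, true_and] at hi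
    rw [Nat.sub_add_cancel this.1, ← hi.1, patternOf_apply]

/-- The map `ζ^(k)_l = (λ^(k)_1 + ⋯ + λ^(k)_l) / 2`. -/
def actionMap (n : ℕ) : (TriIdx n → ℝ) →ₗ[ℝ] (RealIdx n ⊕ CplxIdx n → ℝ) where
  toFun x r := (1 / 2) * ∑ i : TriIdx n with
    i.1.1 = (triLabel r).1.1 ∧ i.1.2 ≤ (triLabel r).1.2, x i
  map_add' x y := by ext r; simp [Finset.sum_add_distrib, mul_add]
  map_smul' c x := by
    ext r
    simp only [Pi.smul_apply, smul_eq_mul, ← Finset.mul_sum, RingHom.id_apply]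
    ring

theorem actionMap_apply (x : TriIdx n → ℝ) (r : RealIdx n ⊕ CplxIdx n) :
    actionMap n x r = (1 / 2) * ∑ i : TriIdx n with
      i.1.1 = (triLabel r).1.1 ∧ i.1.2 ≤ (triLabel r).1.2, x i := rfl

theorem actionMap_eq_etaOf (x : TriIdx n → ℝ) : actionMap n x = etaOf (patternOf x) := by
  ext r
  rw [actionMap_apply, sum_row x (triLabel r).2.2.1 (triLabel r).2.2.2]
  rcases r with k | a <;> rfl

/-- The inverse of `actionMap`. -/
def actionInv (n : ℕ) : (RealIdx n ⊕ CplxIdx n → ℝ) →ₗ[ℝ] (TriIdx n → ℝ) where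
  toFun η i := 2 * (solidWt η i.1.1 i.1.2 - solidWt η i.1.1 (i.1.2 - 1))
  map_add' x y := by
    ext i
    simp only [solidWt, Pi.add_apply]
    split_ifs <;> ring
  map_smul' c x := by
    ext i
    simp only [solidWt, Pi.smul_apply, smul_eq_mul, RingHom.id_apply]
    split_ifs <;> ring

theorem actionInv_actionMap (x : TriIdx n → ℝ) : actionInv n (actionMap n x) = x := by
  ext i
  have h := i.2
  obtain ⟨l, hl⟩ := Nat.exists_eq_succ_of_ne_zero (show i.1.2 ≠ 0 by omega)
  change 2 * (solidWt (actionMap n x) i.1.1 i.1.2 - solidWt (actionMap n x) i.1.1 (i.1.2 - 1)) = _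
  rw [actionMap_eq_etaOf, solidWt_etaOf _ h.2.1 h.2.2, solidWt_etaOf _ (by omega) h.2.2,
    ← patternOf_apply x i, hl, Nat.succ_eq_add_one, Nat.add_sub_cancel, Finset.sum_range_succ]
  ring

theorem actionMap_actionInv (η : RealIdx n ⊕ CplxIdx n → ℝ) :
    actionMap n (actionInv n η) = η := by
  ext r
  have h := (triLabel r).2
  rw [actionMap_apply, sum_row _ h.2.1 h.2.2]
  have e : ∀ i ∈ Finset.range (triLabel r).1.2, patternOf (actionInv n η) (triLabel r).1.1 (i + 1) =
      2 * (solidWt η (triLabel r).1.1 (i + 1) - solidWt η (triLabel r).1.1 i) := by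
    intro i hi
    rw [Finset.mem_range] at hi
    exact dif_pos (by omega)
  rw [Finset.sum_congr rfl e, ← Finset.mul_sum, Finset.sum_range_sub, solidWt_zero, solidWt,
    dif_pos h]
  have : zetaIdx ⟨((triLabel r).1.1, (triLabel r).1.2), h⟩ = r := zetaIdx_triLabel r
  rw [this]
  ring

theorem interlacing_actionMap (x : TriIdx n → ℝ) : Interlacing (actionMap n x) ↔ x ∈ gzCone n := by
  have e : ∀ k l (h : 1 ≤ l ∧ l ≤ k ∧ k ≤ n), patternOf x k l = x ⟨(k, l), h⟩ := fun k l h =>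
    dif_pos h
  rw [actionMap_eq_etaOf]
  constructor
  · rintro h ⟨⟨k, l⟩, h1, h2, h3⟩
    dsimp only at h1 h2 h3
    obtain ⟨k, rfl⟩ := Nat.exists_eq_succ_of_ne_zero (show k ≠ 0 by omega)
    obtain ⟨l, rfl⟩ := Nat.exists_eq_succ_of_ne_zero (show l ≠ 0 by omega)
    have := h k l (by omega) (by omega)
    rw [rowIneq_etaOf (by omega) (by omega), colIneq_etaOf (by omega) (by omega),
      e _ _ ⟨by omega, by omega, by omega⟩, e _ _ ⟨by omega, by omega, by omega⟩,
      e _ _ ⟨by omega, by omega, by omega⟩] at this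
    exact this
  · intro h k l hl hk
    rw [rowIneq_etaOf hl hk, colIneq_etaOf hl hk, e _ _ ⟨by omega, by omega, by omega⟩,
      e _ _ ⟨by omega, by omega, by omega⟩, e _ _ ⟨by omega, by omega, by omega⟩]
    exact h ⟨(k + 1, l + 1), by dsimp only; omega⟩

theorem gzCone_nonempty (n : ℕ) : (gzCone n).Nonempty := by
  refine ⟨fun i => (i.1.1 : ℝ) - 2 * i.1.2, ?_⟩
  rintro ⟨⟨k, l⟩, h1, h2, h3⟩
  dsimp only at h1 h2 h3
  obtain ⟨k, rfl⟩ := Nat.exists_eq_succ_of_ne_zero (show k ≠ 0 by omega)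
  simp only [CplxIdx.down, TriIdx.up, CplxIdx.tri, CplxIdx.next, Nat.succ_eq_add_one,
    Nat.add_sub_cancel]
  push_cast
  constructor <;> linarith

/-! ### Angles -/

/-- The integer matrix which expresses the angles `φ` by the angles `ψ`. -/
def angleMatrix (n : ℕ) : Matrix (CplxIdx n) (TriIdx (n - 1)) ℤ :=
  fun a q => if q.1.1 + a.1.2 - a.1.1 < q.1.2 ∧ q.1.2 ≤ a.1.2 then 1 else 0

/-- The unitriangular matrix with prescribed entries below the diagonal. -/
def unitriMatrix (m : CplxIdx n → TriIdx (n - 1) → ℤ) : Matrix (CplxIdx n) (TriIdx (n - 1)) ℤ :=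
  fun a q => if q = a.down then 1 else if labelBefore a.down q then m a q else 0

theorem not_labelBefore_self (q : TriIdx n) : ¬labelBefore q q := by
  simp [labelBefore]

theorem angleMap_unitriMatrix (m : CplxIdx n → TriIdx (n - 1) → ℤ)
    (x : TriIdx (n - 1) → Real.Angle) (a : CplxIdx n) :
    angleMap (unitriMatrix m) x a =
      x a.down + ∑ q : TriIdx (n - 1) with labelBefore a.down q, m a q • x q := by
  have e : x a.down = ∑ q, if q = a.down then x q else 0 := by simp
  rw [angleMap, Finset.sum_filter, e, ← Finset.sum_add_distrib]
  refine Finset.sum_congr rfl fun q _ => ?_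
  rw [unitriMatrix]
  by_cases h : q = a.down
  · subst h
    simp [not_labelBefore_self]
  · by_cases h' : labelBefore a.down q <;> simp [h, h']

/-- At upper index k-1 the condition reads l-1 < q ≤ l and leaves only the diagonal label; for
larger upper indices the interval is empty. -/
theorem angleMatrix_eq_unitriMatrix : angleMatrix n = unitriMatrix (angleMatrix n) := by
  ext a q
  obtain ⟨⟨k, l⟩, h1, h2, h3⟩ := a
  obtain ⟨⟨p, q⟩, g1, g2, g3⟩ := q
  dsimp only at h1 h2 h3 g1 g2 g3
  simp only [angleMatrix, unitriMatrix, CplxIdx.down, labelBefore, Subtype.mk.injEq, Prod.mk.injEq]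
  split_ifs <;> first | rfl | omega

/-- The labels of the angles `φ` and `ψ` correspond to each other. -/
def downEquiv (n : ℕ) : CplxIdx n ≃ TriIdx (n - 1) where
  toFun := CplxIdx.down
  invFun q := ⟨(q.1.1 + 1, q.1.2), by have := q.2; dsimp only; omega⟩
  left_inv a := by
    have := a.2
    refine Subtype.ext (Prod.ext ?_ rfl)
    simp only [CplxIdx.down]
    omega
  right_inv q := by simp [CplxIdx.down]

theorem det_unitriMatrix (m : CplxIdx n → TriIdx (n - 1) → ℤ) :
    ((unitriMatrix m).submatrix (downEquiv n).symm id).det = 1 := by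
  have hdown : ∀ q, ((downEquiv n).symm q).down = q := (downEquiv n).apply_symm_apply
  -- The relation `labelBefore` is the strict lexicographic order with the upper index reversed; for
  -- this linear order the matrix is upper unitriangular.
  let key : TriIdx (n - 1) → ℕᵒᵈ ×ₗ ℕ := fun q => toLex (OrderDual.toDual q.1.1, q.1.2)
  have hkey : Function.Injective key := by
    intro p q h
    have h1 := congrArg (fun z => (OrderDual.ofDual (ofLex z).1, (ofLex z).2)) h
    exact Subtype.ext h1
  have hlt : ∀ p q, labelBefore p q → key p < key q := by
    intro p q h
    rw [Prod.Lex.lt_iff]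
    exact h.imp id fun h => ⟨congrArg OrderDual.toDual h.1.symm, h.2⟩
  rw [@Matrix.det_of_isUpperTriangular _ _ _ _ _ _ (LinearOrder.lift' key hkey)]
  · refine Finset.prod_eq_one fun q _ => ?_
    rw [Matrix.submatrix_apply, unitriMatrix, hdown]
    simp
  · intro p q hpq
    have hpq' : key q < key p := hpq
    have hne : q ≠ p := fun h => hpq'.ne (congrArg key h)
    have hnb : ¬labelBefore p q := fun h => lt_asymm hpq' (hlt _ _ h)
    rw [Matrix.submatrix_apply, unitriMatrix, hdown, id]
    simp only [hne, hnb, if_false]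

/-- Determinant 1 makes the inverse integral, which is what allows it to act on angles modulo 2π. -/
theorem exists_inverse_unitriMatrix (m : CplxIdx n → TriIdx (n - 1) → ℤ) :
    ∃ M' : Matrix (TriIdx (n - 1)) (CplxIdx n) ℤ,
      unitriMatrix m * M' = 1 ∧ M' * unitriMatrix m = 1 := by
  set T := (unitriMatrix m).submatrix (downEquiv n).symm id with hT
  have hdet : IsUnit T.det := by rw [hT, det_unitriMatrix]; exact isUnit_one
  have hm : unitriMatrix m = T.submatrix (downEquiv n) id := by
    ext a q
    simp [hT]
  refine ⟨T⁻¹.submatrix id (downEquiv n), ?_, ?_⟩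
  · have := Matrix.submatrix_mul_equiv T T⁻¹ (downEquiv n) (Equiv.refl _) (downEquiv n)
    rw [Matrix.mul_nonsing_inv _ hdet] at this
    rw [hm]
    exact this.trans (Matrix.submatrix_one_equiv _)
  · have := Matrix.submatrix_mul_equiv T⁻¹ T (id : TriIdx (n - 1) → _) (downEquiv n) id
    rw [Matrix.nonsing_inv_mul _ hdet] at this
    rw [hm]
    exact this.trans (Matrix.submatrix_id_id _)

/-! ### The pairing -/

theorem sum_actionMap_single (M : Matrix (CplxIdx n) (TriIdx (n - 1)) ℤ)
    (r : RealIdx n ⊕ CplxIdx n) (a : CplxIdx n) :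
    ∑ j, ∑ q, actionMap n (Pi.single j 1) r * (if j = TriIdx.up q then -1 else 0) * (M a q : ℝ) =
      -(1 / 2) * ((∑ q : TriIdx (n - 1) with
        q.1.1 = (triLabel r).1.1 ∧ q.1.2 ≤ (triLabel r).1.2, M a q : ℤ) : ℝ) := by
  have h : ∀ j, actionMap n (Pi.single j 1) r =
      if j.1.1 = (triLabel r).1.1 ∧ j.1.2 ≤ (triLabel r).1.2 then 1 / 2 else 0 := by
    intro j
    rw [actionMap_apply, Finset.sum_filter, Finset.sum_eq_single j]
    · split_ifs <;> simp
    · intro b _ hb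
      simp [Pi.single_eq_of_ne hb]
    · simp
  rw [Finset.sum_comm, Finset.sum_filter, Int.cast_sum, Finset.mul_sum]
  refine Finset.sum_congr rfl fun q _ => ?_
  rw [Finset.sum_eq_single q.up]
  · rw [h, if_pos rfl]
    have : q.up.1 = q.1 := rfl
    rw [this]
    split_ifs
    · ring
    · simp
  · intro j _ hj
    rw [if_neg hj]
    ring
  · simp

/-- With a = (p,q), the k-th row of the pattern has ones exactly on the labels in the interval
(k+q-p, q], and the partial sum counts those up to `l`. For k = n there are no angles, and the pair
number vanishes because p ≤ n. -/
theorem sum_angleMatrix (j : TriIdx n) (a : CplxIdx n) :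
    ∑ q : TriIdx (n - 1) with q.1.1 = j.1.1 ∧ q.1.2 ≤ j.1.2, angleMatrix n a q =
      pairNumber j.1.1 j.1.2 a.1.1 a.1.2 := by
  have hj := j.2
  have ha := a.2
  rcases Nat.lt_or_ge (n - 1) j.1.1 with h | h
  · rw [Finset.sum_eq_zero, pairNumber]
    · have : min j.1.2 a.1.2 - (j.1.1 + a.1.2 - a.1.1) = 0 := by omega
      rw [this, Nat.cast_zero]
    · intro q hq
      have := q.2
      simp only [Finset.mem_filter] at hq
      omega
  · rw [sum_row _ hj.2.1 h]
    have e : ∀ i ∈ Finset.range j.1.2, patternOf (angleMatrix n a) j.1.1 (i + 1) =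
        if i ∈ Finset.Ico (j.1.1 + a.1.2 - a.1.1) a.1.2 then 1 else 0 := by
      intro i hi
      rw [Finset.mem_range] at hi
      rw [patternOf, dif_pos (by omega)]
      simp only [angleMatrix, Finset.mem_Ico]
      split_ifs <;> first | rfl | omega
    rw [Finset.sum_congr rfl e, Finset.sum_boole]
    congr 1
    have e2 : (Finset.range j.1.2).filter
        (fun i => i ∈ Finset.Ico (j.1.1 + a.1.2 - a.1.1) a.1.2) =
          Finset.Ico (j.1.1 + a.1.2 - a.1.1) (min j.1.2 a.1.2) := by
      ext i
      simp only [Finset.mem_filter, Finset.mem_range, Finset.mem_Ico, lt_min_iff]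
      tauto
    rw [e2, Nat.card_Ico, pairNumber]

/-- Consecutive partial sums along a row differ by one entry. This gives the uniqueness of the
integer matrix. -/
theorem eq_of_row_sums {x y : TriIdx (n - 1) → ℤ} (h : ∀ j : TriIdx n,
    ∑ q : TriIdx (n - 1) with q.1.1 = j.1.1 ∧ q.1.2 ≤ j.1.2, x q =
      ∑ q : TriIdx (n - 1) with q.1.1 = j.1.1 ∧ q.1.2 ≤ j.1.2, y q) : x = y := by
  have h' : ∀ k l, l ≤ k → k ≤ n - 1 → ∑ i ∈ Finset.range l, patternOf x k (i + 1) =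
      ∑ i ∈ Finset.range l, patternOf y k (i + 1) := by
    intro k l hl hk
    rcases Nat.eq_zero_or_pos l with rfl | h0
    · simp
    · have := h ⟨(k, l), h0, hl, hk.trans (Nat.sub_le n 1)⟩
      rwa [sum_row _ hl hk, sum_row _ hl hk] at this
  ext ⟨⟨k, l⟩, h1, h2, h3⟩
  dsimp only at h1 h2 h3
  obtain ⟨l, rfl⟩ := Nat.exists_eq_succ_of_ne_zero (show l ≠ 0 by omega)
  have e1 := h' k (l + 1) h2 h3
  rw [Finset.sum_range_succ, Finset.sum_range_succ, h' k l (by omega) h3] at e1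
  have e2 := add_left_cancel e1
  rwa [patternOf, patternOf, dif_pos ⟨h1, h2, h3⟩, dif_pos ⟨h1, h2, h3⟩] at e2

theorem tropicalPairing_eq_neg_half {P : BracketTable (RealIdx n) (CplxIdx n)}
    (hP : IsMinorBracketTable P) (r : RealIdx n ⊕ CplxIdx n) (a : CplxIdx n) :
    tropicalPairing P r a =
      -(1 / 2) * (pairNumber (triLabel r).1.1 (triLabel r).1.2 a.1.1 a.1.2 : ℝ) := by
  rw [← tropicalPairing_eq hP (triLabel r) a, zetaIdx_triLabel]

theorem pairing_angleMatrix {P : BracketTable (RealIdx n) (CplxIdx n)}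
    (hP : IsMinorBracketTable P) (r : RealIdx n ⊕ CplxIdx n) (a : CplxIdx n) :
    ∑ j, ∑ q, actionMap n (Pi.single j 1) r * (if j = TriIdx.up q then -1 else 0) *
      (angleMatrix n a q : ℝ) = tropicalPairing P r a := by
  rw [sum_actionMap_single, sum_angleMatrix, tropicalPairing_eq_neg_half hP, Int.cast_natCast]

theorem eq_angleMatrix_of_pairing {P : BracketTable (RealIdx n) (CplxIdx n)}
    (hP : IsMinorBracketTable P) {M : Matrix (CplxIdx n) (TriIdx (n - 1)) ℤ}
    (h : ∀ r a, ∑ j, ∑ q, actionMap n (Pi.single j 1) r * (if j = TriIdx.up q then -1 else 0) *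
      (M a q : ℝ) = tropicalPairing P r a) : M = angleMatrix n := by
  funext a
  refine eq_of_row_sums fun j => ?_
  have h1 := h (zetaIdx j) a
  rw [sum_actionMap_single, tropicalPairing_eq_neg_half hP, triLabel_zetaIdx] at h1
  have h2 := mul_left_cancel₀ (by norm_num) h1
  rw [sum_angleMatrix]
  exact_mod_cast h2

/-! ### The isomorphism -/

/-- The isomorphism of the Gelfand-Zeitlin system with the tropicalization. -/
theorem exists_gelfandZeitlinEquiv {P : BracketTable (RealIdx n) (CplxIdx n)}
    (hP : IsMinorBracketTable P) :
    ∃ (Φ : (gelfandZeitlin n).Points ≃ (tropicalization P).Points)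
      (M' : Matrix (TriIdx (n - 1)) (CplxIdx n) ℤ),
      HasLinearLift Φ (actionMap n) (angleMatrix n) ∧
        HasLinearLift Φ.symm (actionInv n) M' := by
  obtain ⟨M', h1, h2⟩ := exists_inverse_unitriMatrix (angleMatrix n)
  rw [← angleMatrix_eq_unitriMatrix] at h1 h2
  have hcone : ∀ x, actionMap n x ∈ tropicalCone P ↔ x ∈ gzCone n := fun x => by
    rw [mem_tropicalCone_iff hP, interlacing_actionMap]
  refine ⟨{
    toFun := fun x => ⟨(actionMap n x.1.1, angleMap (angleMatrix n) x.1.2),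
      (hcone _).2 x.2.1, Set.mem_univ _⟩
    invFun := fun y => ⟨(actionInv n y.1.1, angleMap M' y.1.2),
      (hcone _).1 (by rw [actionMap_actionInv]; exact y.2.1), Set.mem_univ _⟩
    left_inv := fun x => Subtype.ext (Prod.ext (actionInv_actionMap _) ?_)
    right_inv := fun y => Subtype.ext (Prod.ext (actionMap_actionInv _) ?_) }, M',
    fun x => rfl, fun y => rfl⟩
  · exact (angleMap_mul _ _ _).trans (by rw [h2, angleMap_one])
  · exact (angleMap_mul _ _ _).trans (by rw [h1, angleMap_one])

end

end

/-! ### The main theorem -/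

theorem mainTheorem1 (n : ℕ) :
    -- the solid minors are coordinates on their chart
    Set.BijOn (fun p c => minorCoord c p) (minorChart n) (chartValues (RealIdx n) (CplxIdx n)) ∧
    -- in which the Poisson bracket has uniquely determined Laurent polynomial coefficients,
    ∃ P : BracketTable (RealIdx n) (CplxIdx n),
      IsMinorBracketTable P ∧ (∀ P', IsMinorBracketTable P' → P' = P) ∧
      -- which admit a linear scaling,
      RealityConditions P ∧
      -- and the tropicalization is isomorphic to the Gelfand-Zeitlin system.
      ∃! Φ : (gelfandZeitlin n).Points ≃ (tropicalization P).Points,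
        TorusSystem.IsPoissonIso Φ ∧
        (∀ x, ∀ j : TriIdx n, (Φ x).1.1 (zetaIdx j) =
          (1 / 2) * ∑ i : TriIdx n with i.1.1 = j.1.1 ∧ i.1.2 ≤ j.1.2, x.1.1 i) ∧
        (∃ m : CplxIdx n → TriIdx (n - 1) → ℤ, ∀ x, ∀ a : CplxIdx n,
          (Φ x).1.2 a = x.1.2 a.down +
            ∑ q : TriIdx (n - 1) with labelBefore a.down q, m a q • x.1.2 q) := by
  obtain ⟨P, hP⟩ := exists_isMinorBracketTable n
  obtain ⟨Φ, M', h, h'⟩ := exists_gelfandZeitlinEquiv hP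
  refine ⟨bijOn_minorCoord n, P, hP, fun P' hP' => hP.eq hP', realityConditions hP, Φ,
    ⟨isPoissonIso_of_hasLinearLift h h' rfl rfl (pairing_angleMatrix hP), fun x j => ?_,
      angleMatrix n, fun x a => ?_⟩, ?_⟩
  · rw [h x]
    simp only [actionMap_apply, triLabel_zetaIdx]
  · have e := angleMap_unitriMatrix (angleMatrix n) x.1.2 a
    rw [← angleMatrix_eq_unitriMatrix] at e
    exact (congrFun (congrArg Prod.snd (h x)) a).trans e
  · rintro Ψ ⟨hΨ, h1, m, h2⟩
    -- The prescribed form says that the map is linear on actions and given by a unitriangular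
    -- integer matrix on angles; only the entries of `m` after the diagonal label enter.
    -- Preservation of the constant pairing then determines this matrix.
    have hlift : HasLinearLift Ψ (actionMap n) (unitriMatrix m) := by
      intro x
      refine Prod.ext (funext fun r => ?_) (funext fun a => ?_)
      · have := h1 x (triLabel r)
        rwa [zetaIdx_triLabel] at this
      · exact (h2 x a).trans (angleMap_unitriMatrix m x.1.2 a).symm
    have hM : unitriMatrix m = angleMatrix n := eq_angleMatrix_of_pairing hP
      (pairing_of_isPoissonIso hlift rfl rfl hΨ (gzCone_nonempty n))
    refine Equiv.ext fun x => Subtype.ext ?_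
    rw [hlift x, h x, hM]
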